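/- **Notation.** For $\tau=x+iy\in\mathbb H$, $q^r=\exp(2\pi i r\tau)$. For $u,v\notin\mathbb Z+\tau\mathbb Z$ let $$\vartheta(z;\tau)=\sum_{n\in\mathbb Z+\frac12}e^{\pi i n^2\tau+2\pi i n(z+\frac12)},\qquad \mu(u,v;\tau)=\frac{e^{\pi i u}}{\vartheta(v;\tau)}\sum_{n\in\mathbb Z}\frac{(-1)^n e^{\pi i n(n+1)\tau+2\pi i n v}}{1-e^{2\pi i n\tau+2\pi i u}},$$ $$R(u;\tau)=\sum_{n\in\mathbb Z+\frac12}\Big(\operatorname{sgn}(n)-E\big((n+\tfrac{\operatorname{Im}u}{y})\sqrt{2y}\big)\Big)(-1)^{n-\frac12}e^{-\pi i n^2\tau-2\pi i n u},\qquad E(t)=2\int_0^t e^{-\pi w^2}\,dw,$$ $\tilde\mu(u,v;\tau)=\mu(u,v;\tau)+\frac i2R(u-v;\tau)$. For integers $a,c$ with $c>0$, $c\nmid a$ put $$M(a,c;\tau)=q^{-\frac12\left(\frac ac-\frac12\right)^2}\,\tilde\mu\!\left(\tfrac{a\tau}{c},\tfrac{\tau}{2};\tau\right).$$ With $\lfloor\cdot\rfloor$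 and $\{\cdot\}$ the floor and fractional part, let $\nu(u,w)=\frac{u+w}2-\frac18$ if $u+w\le1$, $\nu(u,w)=\frac78-\frac{u+w}2$ if $u+w>1$ (for $0\le u,w<1$), and for $u,w\in\mathbb R$ $$\tilde\nu(u,w)=\tfrac12(\lfloor u\rfloor-\lfloor w\rfloor)^2+(\lfloor u\rfloor-\lfloor w\rfloor)(\{u\}-\{w\})+k(u,w),$$ where $k(u,w)=\min(\frac18,\nu(\{u\},\{w\}))$ if $\{u\}-\{w\}=\pm\frac12$ and $k(u,w)=\nu(\{u\},\{w\})$ otherwise. A harmonic weak Maass form of weight $\frac12$ on a congruence subgroup $\Gamma\subseteq\Gamma_0(4)$ is a smooth $f:\mathbb H\to\mathbb C$ with $f(A\tau)=\left(\frac{\gamma}{\delta}\right)\varepsilon(\delta)^{-1}(\gamma\tau+\delta)^{1/2}f(\tau)$ for all $A=\begin{pmatrix}\alpha&\beta\\\gamma&\delta\end{pmatrix}\in\Gamma$ (here the power is the principal branch, $\left(\frac\gamma\delta\right)$ is the Jacobi symbol, extended by $\left(\frac{0}{\pm1}\right)=1$ and, for negative $\delta$, by $\left(\frac{\gamma}{\delta}\right)=\left(\frac{\gamma}{|\delta|}\right)$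 if $\gamma>0$ and $-\left(\frac{\gamma}{|\delta|}\right)$ if $\gamma<0$, and $\varepsilon(\delta)=1$ if $\delta\equiv1\pmod 4$, $\varepsilon(\delta)=i$ otherwise), which is annihilated by $-y^2(\partial_x^2+\partial_y^2)+\frac i2y(\partial_x+i\partial_y)$, and such that for every $B\in SL_2(\mathbb Z)$ with lower row $(\gamma,\delta)$ the function $(\gamma\tau+\delta)^{-1/2}f(B\tau)$ has at most linear exponential growth as $\tau\to i\infty$. For $\gcd(\alpha,\gamma)=1$, choose $A=\begin{pmatrix}\alpha&\beta\\\gamma&\delta\end{pmatrix}\in SL_2(\mathbb Z)$ and write, for some integer $N\ge1$, $$(\gamma\tau+\delta)^{-1/2}f(A\tau)=\sum_{n\ge n_0}a(n)q^{n/N}+\sum_{n\ge1}b(n)\,\Gamma\!\left(\tfrac12,\tfrac{4\pi ny}{N}\right)q^{-n/N},\qquad \Gamma(s,t)=\int_t^\infty e^{-w}w^{s-1}\,dw.$$ The invariant order of the holomorphic part of $f$ at the cusp $\frac\alpha\gamma$ is $m_0/N$, where $m_0$ is the least $n$ with $a(n)\ne0$ ($+\infty$ if there is none). **Proposition 6.4.**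 Suppose $a,c,m$ are integers, $c>0$, $m>0$, $c\nmid a$, and $\tau\mapsto M(a,c;m\tau)$ is a harmonic weak Maass form of weight $\frac12$ on some congruence subgroup. Suppose $\alpha,\gamma$ are non-negative integers with $\gcd(\alpha,\gamma)=1$. Then the invariant order of the holomorphic part of $M(a,c;m\tau)$ at the cusp $\frac\alpha\gamma$ exists, is independent of the choices of $A$ and $N$, and is at least $$-\frac{g^2x^2}{2m}\left(\frac ac-\frac12\right)^2+\frac{g^2}{m}\,\tilde\nu\!\left(\frac{ax}{c},\frac x2\right),\qquad g=\gcd(m,\gamma),\quad x=\frac{m\alpha}{g}.$$ -/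

import Mathlib

open Filter Asymptotics
open scoped UpperHalfPlane MatrixGroups ContDiff

noncomputable section

/-! ### Zwegers' functions -/

/-- `ϑ(z;τ) = ∑_{n ∈ ℤ+1/2} exp(πi n² τ + 2πi n (z + 1/2))`; the summation index is `n = j + 1/2`,
`j ∈ ℤ`. -/
def zwTheta (z τ : ℂ) : ℂ :=
  ∑' j : ℤ, Complex.exp (Real.pi * Complex.I * ((j : ℂ) + 1 / 2) ^ 2 * τ
    + 2 * Real.pi * Complex.I * ((j : ℂ) + 1 / 2) * (z + 1 / 2))

/-- `μ(u,v;τ)`, for `u, v ∉ ℤ + τℤ` and `Im τ > 0`. -/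
def zwMu (u v τ : ℂ) : ℂ :=
  Complex.exp (Real.pi * Complex.I * u) / zwTheta v τ *
    ∑' n : ℤ, (-1 : ℂ) ^ n *
        Complex.exp (Real.pi * Complex.I * n * (n + 1) * τ + 2 * Real.pi * Complex.I * n * v) /
      (1 - Complex.exp (2 * Real.pi * Complex.I * n * τ + 2 * Real.pi * Complex.I * u))

/-- `E(x) = 2 ∫_0^x exp(-π w²) dw`, needed only at real arguments. -/
def zwE (x : ℝ) : ℝ := 2 * ∫ w in (0 : ℝ)..x, Real.exp (-Real.pi * w ^ 2)

/-- `R(u;τ) = ∑_{n ∈ ℤ+1/2} (sgn n - E((n + a)√(2y))) (-1)^{n-1/2} exp(-πi n² τ - 2πi n u)` with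
`y = Im τ`, `a = Im u / Im τ`; the summation index is `n = j + 1/2`, `j ∈ ℤ`. -/
def zwR (u τ : ℂ) : ℂ :=
  ∑' j : ℤ,
    ((Real.sign ((j : ℝ) + 1 / 2)
        - zwE (((j : ℝ) + 1 / 2 + u.im / τ.im) * Real.sqrt (2 * τ.im)) : ℝ) : ℂ) *
      (-1 : ℂ) ^ j *
      Complex.exp (-Real.pi * Complex.I * ((j : ℂ) + 1 / 2) ^ 2 * τ
        - 2 * Real.pi * Complex.I * ((j : ℂ) + 1 / 2) * u)

/-- The completed function `μ̃(u,v;τ) = μ(u,v;τ) + (i/2) R(u-v;τ)`. -/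
def zwMuTilde (u v τ : ℂ) : ℂ := zwMu u v τ + Complex.I / 2 * zwR (u - v) τ

/-- `M(a,c;τ) = q^{-(1/2)(a/c-1/2)²} μ̃(aτ/c, τ/2; τ)`, where `q^r = exp(2πi r τ)`. -/
def bigM (a c : ℤ) (τ : ℂ) : ℂ :=
  Complex.exp (2 * Real.pi * Complex.I * (-(1 / 2) * ((a : ℂ) / c - 1 / 2) ^ 2) * τ) *
    zwMuTilde (a * τ / c) (τ / 2) τ

/-- The function `τ ↦ M(a,c;mτ)` on the upper half plane. -/
def bigMScaled (a c m : ℤ) (τ : ℍ) : ℂ := bigM a c (m * (τ : ℂ))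

/-! ### The quantities `ν(u,w)` and `ν̃(u,w)` -/

/-- `ν(u,w)`, for `0 ≤ u, w < 1`. -/
def nuOrd (u w : ℝ) : ℝ := if u + w ≤ 1 then (u + w) / 2 - 1 / 8 else 7 / 8 - (u + w) / 2

/-- `k(u,w)`. -/
def kOrd (u w : ℝ) : ℝ :=
  if Int.fract u - Int.fract w = 1 / 2 ∨ Int.fract u - Int.fract w = -(1 / 2) then
    min (1 / 8) (nuOrd (Int.fract u) (Int.fract w))
  else nuOrd (Int.fract u) (Int.fract w)

/-- `ν̃(u,w)`. -/
def nuTilde (u w : ℝ) : ℝ :=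
  1 / 2 * ((⌊u⌋ : ℝ) - ⌊w⌋) ^ 2
    + ((⌊u⌋ : ℝ) - ⌊w⌋) * (Int.fract u - Int.fract w) + kOrd u w

/-! ### Harmonic weak Maass forms of half-integral weight -/

/-- The Jacobi symbol `(m/n)` extended to negative `n` (used for odd `n` prime to `m`); in
particular `(0/±1) = 1`. -/
def extJacobi (m n : ℤ) : ℤ :=
  if m < 0 ∧ n < 0 then -jacobiSym m n.natAbs else jacobiSym m n.natAbs

/-- `ε(δ)`, which is `1` if `δ ≡ 1 (mod 4)` and `i` otherwise. -/
def epsMult (d : ℤ) : ℂ := if d % 4 = 1 then 1 else Complex.I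

/-- `τ ↦ (γτ+δ)^{-κ/2} f(Aτ)` for `A = (α β; γ δ)`, with the principal branch of the power. -/
def halfSlash (κ : ℤ) (f : ℍ → ℂ) (A : SL(2, ℤ)) (τ : ℍ) : ℂ :=
  (((A 1 0 : ℤ) : ℂ) * (τ : ℂ) + ((A 1 1 : ℤ) : ℂ)) ^ (-((κ : ℂ) / 2)) * f (A • τ)

/-- `∂F/∂x`. -/
def partialX (F : ℂ → ℂ) (z : ℂ) : ℂ := fderiv ℝ F z 1

/-- `∂F/∂y`. -/
def partialY (F : ℂ → ℂ) (z : ℂ) : ℂ := fderiv ℝ F z Complex.I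

/-- The weight `k` hyperbolic Laplacian
`Δ_k = -y² (∂²/∂x² + ∂²/∂y²) + i k y (∂/∂x + i ∂/∂y)`. -/
def hypLaplacian (k : ℝ) (F : ℂ → ℂ) (z : ℂ) : ℂ :=
  -((z.im : ℂ) ^ 2) * (partialX (partialX F) z + partialY (partialY F) z)
    + Complex.I * k * z.im * (partialX F z + Complex.I * partialY F z)

/-- `f` is a harmonic weak Maass form of weight `κ/2` (`κ` an odd integer) on the subgroup `Γ`:
`Γ` is a congruence subgroup contained in `Γ₀(4)`; `f` is smooth; it satisfies
`f(Aτ) = (γ/δ)^κ ε(δ)^{-κ} (γτ+δ)^{κ/2} f(τ)` for `A ∈ Γ`; it is annihilated by `Δ_{κ/2}`; and at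
every cusp it has at most linear exponential growth. -/
structure IsHarmonicWeakMaassForm (κ : ℤ) (Γ : Subgroup SL(2, ℤ)) (f : ℍ → ℂ) : Prop where
  odd_weight : Odd κ
  congruence : CongruenceSubgroup.IsCongruenceSubgroup Γ
  le_gamma0 : Γ ≤ CongruenceSubgroup.Gamma0 4
  smooth : ContDiffOn ℝ ∞ (f ∘ UpperHalfPlane.ofComplex) {z : ℂ | 0 < z.im}
  transform : ∀ A ∈ Γ, ∀ τ : ℍ,
    f (A • τ) = (extJacobi (A 1 0) (A 1 1) : ℂ) ^ κ * epsMult (A 1 1) ^ (-κ) *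
      (((A 1 0 : ℤ) : ℂ) * (τ : ℂ) + ((A 1 1 : ℤ) : ℂ)) ^ ((κ : ℂ) / 2) * f τ
  harmonic : ∀ z : ℂ, 0 < z.im →
    hypLaplacian ((κ : ℝ) / 2) (f ∘ UpperHalfPlane.ofComplex) z = 0
  growth : ∀ A : SL(2, ℤ), ∃ C : ℝ,
    halfSlash κ f A =O[UpperHalfPlane.atImInfty] fun τ : ℍ => Real.exp (C * τ.im)

/-! ### The holomorphic part and its invariant order at a cusp -/

/-- The upper incomplete Gamma function `Γ(s,x) = ∫_x^∞ e^{-t} t^{s-1} dt`, for `x > 0`. -/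
def upperGamma (s x : ℝ) : ℝ := ∫ t in Set.Ioi x, Real.exp (-t) * t ^ (s - 1)

/-- `h = h⁺ + h⁻` on the upper half plane, with the holomorphic part
`h⁺(τ) = ∑_{n ≥ n₀} a(n) exp(2πi n τ / N)` and the non-holomorphic part
`h⁻(τ) = ∑_{n ≥ 1} b(n) Γ(1-k, 4π n y / N) exp(-2πi n τ / N)`, where `y = Im τ`, `k` is the weight,
and both series converge (absolutely) at every `τ`. -/
def HasMaassExpansion (k : ℝ) (h : ℍ → ℂ) (N : ℕ) (a : ℤ → ℂ) (b : ℕ → ℂ) : Prop :=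
  0 < N ∧ (∃ n₀ : ℤ, ∀ n < n₀, a n = 0) ∧
  ∃ hplus hminus : ℍ → ℂ,
    (∀ τ : ℍ, HasSum
      (fun n : ℤ => a n * Complex.exp (2 * Real.pi * Complex.I * n * (τ : ℂ) / N)) (hplus τ)) ∧
    (∀ τ : ℍ, HasSum
      (fun n : ℕ => b (n + 1) * (upperGamma (1 - k) (4 * Real.pi * (n + 1 : ℕ) * τ.im / N) : ℂ) *
        Complex.exp (-2 * Real.pi * Complex.I * (n + 1 : ℕ) * (τ : ℂ) / N)) (hminus τ)) ∧
    ∀ τ : ℍ, h τ = hplus τ + hminus τ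

/-- `r` is the invariant order at `∞` of the holomorphic part of `h`: for an expansion as above,
`r = m₀ / N`, where `a(m₀) ≠ 0` is the first nonzero coefficient of the holomorphic part
(and `r = ∞` if the holomorphic part vanishes). -/
def IsHolOrderAtInfty (k : ℝ) (h : ℍ → ℂ) (r : WithTop ℝ) : Prop :=
  ∃ (N : ℕ) (a : ℤ → ℂ) (b : ℕ → ℂ), HasMaassExpansion k h N a b ∧
    (((∀ n, a n = 0) ∧ r = ⊤) ∨
      ∃ m₀ : ℤ, a m₀ ≠ 0 ∧ (∀ n < m₀, a n = 0) ∧ r = (((m₀ : ℝ) / N : ℝ) : WithTop ℝ))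

/-- `r` is the invariant order at the cusp `α/γ` of the holomorphic part of `f`, a form of weight
`κ/2`: the invariant order at `∞` for `(γτ+δ)^{-κ/2} f(Aτ)`, where `A ∈ SL₂(ℤ)` has first
column `(α, γ)`. -/
def IsHolOrderAtCusp (κ : ℤ) (f : ℍ → ℂ) (α γ : ℤ) (r : WithTop ℝ) : Prop :=
  ∃ A : SL(2, ℤ), A 0 0 = α ∧ A 1 0 = γ ∧ IsHolOrderAtInfty ((κ : ℝ) / 2) (halfSlash κ f A) r

end

noncomputable section

/-! ### The theta function -/

/-! Put F(τ) = e^{-πi(p-s)((p-s)τ+(r-t))} μ̃(pτ+r, sτ+t; τ) (`zwF`). Then M(a,c;τ) is F for (p,r) =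
(a/c,0), (s,t) = (1/2,0). The exponential turns the Jacobi-type behaviour of μ̃ into a right action
of SL₂(ℤ) on the two row vectors, up to a continuous square root of a multiple of γτ+δ
(`zwFTransforms`). Factor diag(m,1)·A = B·(g e; 0 m/g) with B in SL₂(ℤ) of first column (x, γ/g).
The expansion at α/γ is then, up to a constant, that of F with p = ax/c, s = x/2, taken at
(g²τ+ge)/m (`exists_halfSlash_bigMScaled_eq`); the substitution scales orders by g²/m. Integer
shifts of p and s cost only constants, so both may be reduced to [0,1).

The law under τ ↦ -1/τ is obtained by Liouville. Multiplying μ̃ by ϑ(v) removes the poles in v. The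
derivative of R with respect to the conjugate variable is a conjugate theta function, and theta
inversion makes these derivatives cancel between R(u;τ) and its transform
(`differentiable_zwRInvSum`). The difference of the two sides is thus entire in v, with multipliers
1 and e^{-2πiu}, and such a function vanishes when u is off the lattice (`zwNum_inversion`).

For reduced p, s and d = p-s, the Appell sum divided by ϑ has order at least ν(p,s), and the
exponential contributes -d²/2. In R one writes sgn(n) - E = (sgn(n) - sgn(n+d)) + (sgn(n+d) - E).
The last bracket is an incomplete Gamma function; the first is nonzero only for n = ±1/2 and |d| ≥
1/2, and is holomorphic in τ. For d = ±1/2 it gives a constant term, which is why k takes a minimum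
with 1/8; for d > 1/2 it has exactly the order already predicted (`norm_zwFCorr_le`,
`exists_hasMaassExpansion_zwF`).

The order is well defined because Fourier coefficients on horizontal lines are unique and the
incomplete Gamma factors die as y → ∞, which isolates a(n) (`HasMaassExpansion.coeff_unique`);
changing N rescales indices, and changing A is a translation of τ. -/

open Complex in
lemma zwTheta_eq_jacobiTheta₂ (z τ : ℂ) :
    zwTheta z τ = exp (Real.pi * I * τ / 4 + Real.pi * I * (z + 1 / 2)) *
      jacobiTheta₂ (z + 1 / 2 + τ / 2) τ := by
  rw [zwTheta, jacobiTheta₂, ← tsum_mul_left]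
  refine tsum_congr fun j => ?_
  rw [jacobiTheta₂_term, ← exp_add]
  congr 1
  ring

open Complex in
lemma hasSum_zwTheta (z : ℂ) {τ : ℂ} (hτ : 0 < τ.im) :
    HasSum (fun j : ℤ => exp (Real.pi * I * ((j : ℂ) + 1 / 2) ^ 2 * τ
      + 2 * Real.pi * I * ((j : ℂ) + 1 / 2) * (z + 1 / 2))) (zwTheta z τ) := by
  rw [zwTheta_eq_jacobiTheta₂]
  have h := (hasSum_jacobiTheta₂_term (z + 1 / 2 + τ / 2) hτ).mul_left
    (exp (Real.pi * I * τ / 4 + Real.pi * I * (z + 1 / 2)))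
  refine h.congr_fun fun j => ?_
  rw [jacobiTheta₂_term, ← exp_add]
  congr 1
  ring

open Complex in
lemma zwTheta_add_one (z τ : ℂ) : zwTheta (z + 1) τ = -zwTheta z τ := by
  rw [zwTheta_eq_jacobiTheta₂, zwTheta_eq_jacobiTheta₂,
    show z + 1 + 1 / 2 + τ / 2 = z + 1 / 2 + τ / 2 + 1 by ring, jacobiTheta₂_add_left,
    show Real.pi * I * τ / 4 + Real.pi * I * (z + 1 + 1 / 2) =
      Real.pi * I * τ / 4 + Real.pi * I * (z + 1 / 2) + Real.pi * I by ring, exp_add _ (_ * I),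
    exp_pi_mul_I]
  ring

open Complex in
lemma zwTheta_add_period (z τ : ℂ) :
    zwTheta (z + τ) τ = -exp (-Real.pi * I * τ - 2 * Real.pi * I * z) * zwTheta z τ := by
  rw [zwTheta_eq_jacobiTheta₂, zwTheta_eq_jacobiTheta₂,
    show z + τ + 1 / 2 + τ / 2 = z + 1 / 2 + τ / 2 + τ by ring, jacobiTheta₂_add_left',
    ← mul_assoc, ← mul_assoc, ← exp_add, ← neg_one_mul (exp _), ← exp_pi_mul_I, ← exp_add,
    ← exp_add]
  congr 1
  rw [exp_eq_exp_iff_exists_int]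
  refine ⟨-1, ?_⟩
  push_cast
  ring

open Complex in
lemma zwTheta_modular_add_one (z τ : ℂ) :
    zwTheta z (τ + 1) = exp (Real.pi * I / 4) * zwTheta z τ := by
  rw [zwTheta, zwTheta, ← tsum_mul_left]
  refine tsum_congr fun j => ?_
  rw [← exp_add, exp_eq_exp_iff_exists_int]
  obtain ⟨k, hk⟩ := Int.even_mul_succ_self j
  refine ⟨k, ?_⟩
  have hk' : (j : ℂ) * (j + 1) = k + k := by exact_mod_cast hk
  linear_combination (Real.pi * I) * hk'

open Complex in
lemma zwTheta_inversion (z : ℂ) {τ : ℂ} (hτ : 0 < τ.im) :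
    zwTheta (z / τ) (-1 / τ) =
      -I * (-I * τ) ^ (1 / 2 : ℂ) * exp (Real.pi * I * z ^ 2 / τ) * zwTheta z τ := by
  have h0 : τ ≠ 0 := by rintro rfl; simp at hτ
  have hs : (-I * τ) ^ (1 / 2 : ℂ) ≠ 0 := by simp [cpow_eq_zero_iff, h0]
  rw [zwTheta_eq_jacobiTheta₂, zwTheta_eq_jacobiTheta₂,
    jacobiTheta₂_functional_equation (z + 1 / 2 + τ / 2) τ,
    show z / τ + 1 / 2 + -1 / τ / 2 = (z + 1 / 2 + τ / 2) / τ + -1 / τ by field_simp; ring,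
    jacobiTheta₂_add_left']
  have hI : (-I : ℂ) = exp (-Real.pi / 2 * I) := by
    have := exp_neg_pi_div_two_mul_I
    rw [← this]
  have e : -I * (-I * τ) ^ (1 / 2 : ℂ) * exp (Real.pi * I * z ^ 2 / τ) *
      (exp (Real.pi * I * τ / 4 + Real.pi * I * (z + 1 / 2)) *
        (1 / (-I * τ) ^ (1 / 2 : ℂ) * exp (-Real.pi * I * (z + 1 / 2 + τ / 2) ^ 2 / τ) *
          jacobiTheta₂ ((z + 1 / 2 + τ / 2) / τ) (-1 / τ))) =
      (-I) * (exp (Real.pi * I * z ^ 2 / τ) *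
      exp (Real.pi * I * τ / 4 + Real.pi * I * (z + 1 / 2)) *
        exp (-Real.pi * I * (z + 1 / 2 + τ / 2) ^ 2 / τ)) *
          jacobiTheta₂ ((z + 1 / 2 + τ / 2) / τ) (-1 / τ) := by
    field_simp
  rw [e, ← mul_assoc, hI, ← exp_add, ← exp_add, ← exp_add, ← exp_add]
  congr 2
  field_simp
  ring

lemma differentiable_zwTheta {τ : ℂ} (hτ : 0 < τ.im) : Differentiable ℂ (zwTheta · τ) := by
  intro z
  have : (zwTheta · τ) = fun z => Complex.exp (Real.pi * Complex.I * τ / 4 +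
      Real.pi * Complex.I * (z + 1 / 2)) * jacobiTheta₂ (z + 1 / 2 + τ / 2) τ :=
    funext fun z => zwTheta_eq_jacobiTheta₂ z τ
  rw [this]
  refine DifferentiableAt.mul (by fun_prop) ?_
  exact (differentiableAt_jacobiTheta₂_fst _ hτ).comp z (by fun_prop)

lemma zwTheta_sub_one (z τ : ℂ) : zwTheta (z - 1) τ = -zwTheta z τ := by
  have := zwTheta_add_one (z - 1) τ
  rw [sub_add_cancel] at this
  rw [this, neg_neg]

lemma zwTheta_add_int (z τ : ℂ) (l : ℤ) : zwTheta (z + l) τ = (-1) ^ l * zwTheta z τ := by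
  induction l with
  | zero => simp
  | succ n ih =>
    push_cast at ih ⊢
    rw [← add_assoc, zwTheta_add_one, ih, zpow_add_one₀ (by norm_num)]
    ring
  | pred n ih =>
    push_cast at ih ⊢
    rw [← add_sub_assoc, zwTheta_sub_one, ih, zpow_sub_one₀ (by norm_num)]
    norm_num

/-! ### Non-vanishing of the theta function at the points of order two -/

open Complex in
lemma exp_pi_mul_I_mul_int (n : ℤ) : exp (Real.pi * I * n) = (-1) ^ n := by
  rw [← exp_pi_mul_I, ← exp_int_mul]
  congr 1
  ring

open Complex in
lemma jacobiTheta₂_half_term (n : ℤ) (τ : ℂ) :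
    jacobiTheta₂_term n (1 / 2) τ = (-1) ^ n * jacobiTheta₂_term n 0 τ := by
  rw [jacobiTheta₂_term, jacobiTheta₂_term, ← exp_pi_mul_I_mul_int, ← exp_add]
  congr 1
  ring

open Complex in
lemma jacobiTheta₂_half_eq (τ : ℂ) : jacobiTheta₂ (1 / 2) τ = jacobiTheta₂ 0 (τ + 1) := by
  rw [jacobiTheta₂, jacobiTheta₂]
  refine tsum_congr fun n => ?_
  rw [jacobiTheta₂_term, jacobiTheta₂_term, exp_eq_exp_iff_exists_int]
  obtain ⟨k, hk⟩ := Int.even_mul_succ_self n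
  refine ⟨n - k, ?_⟩
  have hk' : (n : ℂ) * (n + 1) = k + k := by exact_mod_cast hk
  push_cast
  linear_combination (-Real.pi * I) * hk'

open Complex in
/-- `θ₃(τ) θ₄(τ) = θ₄(2τ)²`. -/
lemma jacobiTheta₂_zero_mul_half {τ : ℂ} (hτ : 0 < τ.im) :
    jacobiTheta₂ 0 τ * jacobiTheta₂ (1 / 2) τ = jacobiTheta₂ (1 / 2) (2 * τ) ^ 2 := by
  have hτ2 : 0 < (2 * τ).im := by simpa using hτ
  have s0 := ((summable_jacobiTheta₂_term_iff 0 τ).mpr hτ).norm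
  have s1 := ((summable_jacobiTheta₂_term_iff (1 / 2) τ).mpr hτ).norm
  have s2 := ((summable_jacobiTheta₂_term_iff (1 / 2) (2 * τ)).mpr hτ2).norm
  -- The sign (-1)^m + (-1)^n kills pairs of opposite parity. The remaining pairs are (a+b, a-b),
  -- for which m²+n² = 2(a²+b²), hence the argument 2τ.
  have key : ∀ f : ℤ × ℤ → ℂ, (∀ m n : ℤ, f (m, n) =
      ((-1) ^ m + (-1) ^ n) * (jacobiTheta₂_term m 0 τ * jacobiTheta₂_term n 0 τ)) →
      ∑' x, f x = 2 * jacobiTheta₂ (1 / 2) (2 * τ) ^ 2 := by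
    intro f hf
    let g : ℤ × ℤ → ℤ × ℤ := fun x => (x.1 + x.2, x.1 - x.2)
    have hg : Function.Injective g := by
      rintro ⟨a, b⟩ ⟨c, d⟩ h
      simp only [g, Prod.mk.injEq] at h ⊢
      omega
    have hsupp : Function.support f ⊆ Set.range g := by
      rintro ⟨m, n⟩ hmn
      have : Even (m + n) := by
        by_contra hodd
        rw [Int.not_even_iff_odd] at hodd
        apply hmn
        rw [hf]
        rcases Int.even_or_odd m with hm | hm <;> rcases Int.even_or_odd n with hn | hn
        · exact absurd (hm.add hn) (Int.not_even_iff_odd.mpr hodd)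
        · rw [hm.neg_one_zpow, hn.neg_one_zpow]; ring
        · rw [hm.neg_one_zpow, hn.neg_one_zpow]; ring
        · exact absurd (hm.add_odd hn) (Int.not_even_iff_odd.mpr hodd)
      obtain ⟨s, hs⟩ := this
      exact ⟨(s, m - s), by simp only [g, Prod.mk.injEq]; omega⟩
    rw [← hg.tsum_eq hsupp, sq, jacobiTheta₂, tsum_mul_tsum_of_summable_norm s2 s2, ← tsum_mul_left]
    refine tsum_congr fun x => ?_
    obtain ⟨a, b⟩ := x
    have hab : ((-1 : ℂ)) ^ (a - b) = (-1) ^ (a + b) := by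
      rw [show a + b = a - b + 2 * b by ring, zpow_add₀ (by norm_num), zpow_mul]
      simp
    simp only [g, hf, hab]
    rw [jacobiTheta₂_half_term, jacobiTheta₂_half_term, zpow_add₀ (by norm_num)]
    have : jacobiTheta₂_term (a + b) 0 τ * jacobiTheta₂_term (a - b) 0 τ =
        jacobiTheta₂_term a 0 (2 * τ) * jacobiTheta₂_term b 0 (2 * τ) := by
      simp only [jacobiTheta₂_term, ← exp_add]
      congr 1
      push_cast
      ring
    rw [this]
    ring
  have h1 : jacobiTheta₂ 0 τ * jacobiTheta₂ (1 / 2) τ =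
      ∑' x : ℤ × ℤ, jacobiTheta₂_term x.1 0 τ * jacobiTheta₂_term x.2 (1 / 2) τ :=
    tsum_mul_tsum_of_summable_norm s0 s1
  have h2 : jacobiTheta₂ (1 / 2) τ * jacobiTheta₂ 0 τ =
      ∑' x : ℤ × ℤ, jacobiTheta₂_term x.1 (1 / 2) τ * jacobiTheta₂_term x.2 0 τ :=
    tsum_mul_tsum_of_summable_norm s1 s0
  -- The product is added to itself in the other order, so that the sign becomes symmetric in m and
  -- n.
  have h3 := key _ (fun m n => by
    simp only [jacobiTheta₂_half_term]
    ring) |>.symm.trans (Summable.tsum_add (summable_mul_of_summable_norm s1 s0)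
      (summable_mul_of_summable_norm s0 s1))
  rw [← h1, ← h2] at h3
  linear_combination (-1 / 2) * h3

lemma jacobiTheta₂_zero_ne_zero_of_one_le_im {τ : ℂ} (hτ : 1 ≤ τ.im) : jacobiTheta₂ 0 τ ≠ 0 := by
  intro h
  have h0 := norm_jacobiTheta_sub_one_le (zero_lt_one.trans_le hτ)
  rw [jacobiTheta_eq_jacobiTheta₂, h] at h0
  have h1 : Real.exp (-Real.pi * τ.im) < 1 / 3 := by
    have : Real.exp (-Real.pi * τ.im) ≤ Real.exp (-3) := by
      apply Real.exp_le_exp.mpr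
      nlinarith [Real.pi_gt_three]
    have h3 : (1 : ℝ) + 3 < Real.exp 3 := by
      have := Real.add_one_lt_exp (x := 3) (by norm_num)
      linarith
    have h4 : Real.exp (-3) < 1 / 3 := by
      rw [Real.exp_neg, inv_eq_one_div]
      apply one_div_lt_one_div_of_lt <;> linarith
    linarith
  have h2 : 2 / (1 - Real.exp (-Real.pi * τ.im)) * Real.exp (-Real.pi * τ.im) < 1 := by
    rw [div_mul_eq_mul_div, div_lt_one] <;> linarith
  simp at h0
  simp at h2
  linarith

/-- By the duplication identity a zero at σ is a zero at 2σ. Repeated doubling reaches height at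
least 1, where the series is dominated by its constant term. -/
lemma jacobiTheta₂_half_ne_zero {τ : ℂ} (hτ : 0 < τ.im) : jacobiTheta₂ (1 / 2) τ ≠ 0 := by
  have key : ∀ k : ℕ, ∀ σ : ℂ, 0 < σ.im → 1 ≤ 2 ^ k * σ.im → jacobiTheta₂ (1 / 2) σ ≠ 0 := by
    intro k
    induction k with
    | zero =>
      intro σ _ h
      rw [jacobiTheta₂_half_eq]
      exact jacobiTheta₂_zero_ne_zero_of_one_le_im (by simpa using h)
    | succ k ih =>
      intro σ h0 h hz
      have := jacobiTheta₂_zero_mul_half h0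
      rw [hz, mul_zero] at this
      refine ih (2 * σ) (by simpa using h0) ?_ (by simpa using this.symm)
      simp only [Complex.mul_im, Complex.re_ofNat, Complex.im_ofNat, zero_mul, add_zero]
      rw [pow_succ] at h
      linarith
  obtain ⟨k, hk⟩ := pow_unbounded_of_one_lt (1 / τ.im) (one_lt_two (α := ℝ))
  refine key k τ hτ ?_
  rw [div_lt_iff₀ hτ] at hk
  exact hk.le

lemma jacobiTheta₂_zero_ne_zero {τ : ℂ} (hτ : 0 < τ.im) : jacobiTheta₂ 0 τ ≠ 0 := by
  have := jacobiTheta₂_half_ne_zero (τ := τ - 1) (by simpa using hτ)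
  rwa [jacobiTheta₂_half_eq, sub_add_cancel] at this

open Complex in
lemma zwTheta_add_int_mul_period (z τ : ℂ) (k : ℤ) :
    zwTheta (z + k * τ) τ =
      (-1) ^ k * exp (-Real.pi * I * k ^ 2 * τ - 2 * Real.pi * I * k * z) * zwTheta z τ := by
  have step : ∀ (w : ℂ) (n : ℤ), zwTheta (w + ((n + 1 : ℤ) : ℂ) * τ) τ =
      -exp (-Real.pi * I * τ - 2 * Real.pi * I * (w + n * τ)) * zwTheta (w + n * τ) τ := by
    intro w n
    rw [← zwTheta_add_period]
    congr 1
    push_cast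
    ring
  have e : ∀ n : ℤ, -exp (-Real.pi * I * τ - 2 * Real.pi * I * (z + n * τ)) *
      ((-1) ^ n * exp (-Real.pi * I * n ^ 2 * τ - 2 * Real.pi * I * n * z)) =
      (-1) ^ (n + 1) * exp (-Real.pi * I * (n + 1 : ℤ) ^ 2 * τ - 2 * Real.pi * I * (n + 1 : ℤ) * z) := by
    intro n
    have h : exp (-Real.pi * I * (n + 1 : ℤ) ^ 2 * τ - 2 * Real.pi * I * (n + 1 : ℤ) * z) =
        exp (-Real.pi * I * τ - 2 * Real.pi * I * (z + n * τ)) *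
          exp (-Real.pi * I * n ^ 2 * τ - 2 * Real.pi * I * n * z) := by
      rw [← exp_add]
      congr 1
      push_cast
      ring
    rw [zpow_add_one₀ (by norm_num), h]
    ring
  induction k with
  | zero => simp
  | succ n ih => rw [step, ih, ← mul_assoc, e]
  | pred n ih =>
    have h := step z (-n - 1)
    have h' := e (-n - 1)
    rw [sub_add_cancel] at h h'
    rw [ih, ← h', mul_assoc] at h
    exact (mul_left_cancel₀ (neg_ne_zero.mpr (exp_ne_zero _)) h).symm

/-- `ϑ` does not vanish at the nonzero points of order two. -/
lemma zwTheta_half_ne_zero {τ : ℂ} (hτ : 0 < τ.im) {k l : ℤ} (hkl : ¬(Even k ∧ Even l)) :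
    zwTheta ((k / 2 : ℝ) * τ + (l / 2 : ℝ)) τ ≠ 0 := by
  have hpt : ∀ z : ℂ, jacobiTheta₂ (z + 1 / 2 + τ / 2) τ ≠ 0 → zwTheta z τ ≠ 0 := fun z hz => by
    rw [zwTheta_eq_jacobiTheta₂]
    exact mul_ne_zero (Complex.exp_ne_zero _) hz
  have h0 : τ ≠ 0 := by rintro rfl; simp at hτ
  have key : ∀ (z : ℂ) (i j : ℤ), zwTheta z τ ≠ 0 → zwTheta (z + j + i * τ) τ ≠ 0 := by
    intro z i j hz
    rw [zwTheta_add_int_mul_period, zwTheta_add_int]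
    exact mul_ne_zero (mul_ne_zero (zpow_ne_zero _ (by norm_num)) (Complex.exp_ne_zero _))
      (mul_ne_zero (zpow_ne_zero _ (by norm_num)) hz)
  have J : ∀ z, jacobiTheta₂ (z + τ) τ ≠ 0 ↔ jacobiTheta₂ z τ ≠ 0 := fun z => by
    rw [jacobiTheta₂_add_left']
    simp
  have hτ' : 0 < (-1 / τ).im := by
    rw [neg_div, one_div, Complex.neg_im, Complex.inv_im]
    have := Complex.normSq_pos.mpr h0
    rw [neg_div, neg_neg]
    positivity
  rcases Int.even_or_odd k with hk | hk <;> rcases Int.even_or_odd l with hl | hl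
  · exact absurd ⟨hk, hl⟩ hkl
  · obtain ⟨i, rfl⟩ := hk
    obtain ⟨j, rfl⟩ := hl
    have h1 : zwTheta (1 / 2) τ ≠ 0 := by
      apply hpt
      -- This is the θ₂ case: inversion carries it to θ₄ at -1/τ, whose nonvanishing is known.
      have h2 : jacobiTheta₂ (τ / 2) τ ≠ 0 := by
        rw [jacobiTheta₂_functional_equation]
        have h3 := jacobiTheta₂_half_ne_zero hτ'
        rw [show τ / 2 / τ = 1 / 2 by field_simp]
        have hs : (-Complex.I * τ) ^ (1 / 2 : ℂ) ≠ 0 := by simp [Complex.cpow_eq_zero_iff, h0]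
        exact mul_ne_zero (mul_ne_zero (one_div_ne_zero hs) (Complex.exp_ne_zero _)) h3
      rw [show (1 / 2 + 1 / 2 + τ / 2 : ℂ) = τ / 2 + 1 by ring, jacobiTheta₂_add_left]
      exact h2
    convert key _ i j h1 using 2
    push_cast
    ring
  · obtain ⟨i, rfl⟩ := hk
    obtain ⟨j, rfl⟩ := hl
    have h1 : zwTheta (τ / 2) τ ≠ 0 := by
      apply hpt
      rw [show (τ / 2 + 1 / 2 + τ / 2 : ℂ) = 1 / 2 + τ by ring, J]
      exact jacobiTheta₂_half_ne_zero hτ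
    convert key _ i j h1 using 2
    push_cast
    ring
  · obtain ⟨i, rfl⟩ := hk
    obtain ⟨j, rfl⟩ := hl
    have h1 : zwTheta (1 / 2 + τ / 2) τ ≠ 0 := by
      apply hpt
      rw [show (1 / 2 + τ / 2 + 1 / 2 + τ / 2 : ℂ) = 0 + 1 + τ by ring, J, jacobiTheta₂_add_left]
      exact jacobiTheta₂_zero_ne_zero hτ
    convert key _ i j h1 using 2
    push_cast
    ring

/-! ### The error function -/

lemma continuous_exp_neg_pi_mul_sq : Continuous fun w : ℝ => Real.exp (-Real.pi * w ^ 2) := by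
  fun_prop

lemma zwE_zero : zwE 0 = 0 := by simp [zwE]

lemma zwE_neg (x : ℝ) : zwE (-x) = -zwE x := by
  have h := intervalIntegral.integral_comp_neg (a := 0) (b := x)
    (fun w : ℝ => Real.exp (-Real.pi * w ^ 2))
  simp only [neg_sq, neg_zero] at h
  rw [zwE, zwE, h, intervalIntegral.integral_symm]
  ring

lemma hasDerivAt_zwE (x : ℝ) : HasDerivAt zwE (2 * Real.exp (-Real.pi * x ^ 2)) x :=
  ((continuous_exp_neg_pi_mul_sq.integral_hasStrictDerivAt 0 x).hasDerivAt).const_mul 2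

lemma one_sub_zwE_eq_integral_Ioi (x : ℝ) :
    1 - zwE x = 2 * ∫ w in Set.Ioi x, Real.exp (-Real.pi * w ^ 2) := by
  have hi := integrable_exp_neg_mul_sq Real.pi_pos
  have h := intervalIntegral.integral_interval_add_Ioi (a := 0) (b := x)
    hi.integrableOn hi.integrableOn
  rw [integral_gaussian_Ioi, div_self Real.pi_pos.ne', Real.sqrt_one] at h
  rw [zwE]
  linarith

lemma one_sub_zwE_nonneg (x : ℝ) : 0 ≤ 1 - zwE x := by
  rw [one_sub_zwE_eq_integral_Ioi]
  have : 0 ≤ ∫ w in Set.Ioi x, Real.exp (-Real.pi * w ^ 2) :=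
    MeasureTheory.integral_nonneg fun w => (Real.exp_pos _).le
  linarith

/-- Translate the tail integral to start at 0 and use (w+x)² ≥ w²+x² for w, x ≥ 0. -/
lemma one_sub_zwE_le {x : ℝ} (hx : 0 ≤ x) : 1 - zwE x ≤ Real.exp (-Real.pi * x ^ 2) := by
  have hi := integrable_exp_neg_mul_sq Real.pi_pos
  have himg : (fun w => w + x) '' Set.Ioi (0 : ℝ) = Set.Ioi x := by simp
  have h1 := MeasureTheory.integral_image_eq_integral_abs_deriv_smul (s := Set.Ioi (0 : ℝ))
    (f := fun w => w + x) (f' := fun _ => 1) measurableSet_Ioi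
    (fun w _ => ((hasDerivAt_id w).add_const x).hasDerivWithinAt)
    (fun a _ b _ h => by simpa using h) (fun w : ℝ => Real.exp (-Real.pi * w ^ 2))
  have h2 : ∫ w in Set.Ioi (0 : ℝ), |(1 : ℝ)| • Real.exp (-Real.pi * (w + x) ^ 2) ≤
      ∫ w in Set.Ioi (0 : ℝ), Real.exp (-Real.pi * x ^ 2) * Real.exp (-Real.pi * w ^ 2) := by
    refine MeasureTheory.setIntegral_mono_on ?_ (hi.integrableOn.const_mul _) measurableSet_Ioi ?_
    · have := (hi.comp_add_right x).integrableOn (s := Set.Ioi 0)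
      simpa using this
    · intro w hw
      rw [abs_one, one_smul, ← Real.exp_add, Real.exp_le_exp]
      have : 0 ≤ Real.pi * (w * x) := mul_nonneg Real.pi_pos.le (mul_nonneg (le_of_lt hw) hx)
      nlinarith
  rw [himg] at h1
  simp only [abs_one, one_smul] at h1 h2
  rw [one_sub_zwE_eq_integral_Ioi, h1]
  rw [MeasureTheory.integral_const_mul, integral_gaussian_Ioi, div_self Real.pi_pos.ne',
    Real.sqrt_one] at h2
  linarith

lemma abs_sign_sub_zwE_le (x : ℝ) : |Real.sign x - zwE x| ≤ Real.exp (-Real.pi * x ^ 2) := by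
  rcases lt_trichotomy x 0 with h | rfl | h
  · have h1 := one_sub_zwE_nonneg (-x)
    have h2 := one_sub_zwE_le (x := -x) (by linarith)
    rw [zwE_neg] at h1 h2
    rw [Real.sign_of_neg h, abs_le]
    rw [neg_sq] at h2
    have := Real.exp_pos (-Real.pi * x ^ 2)
    constructor <;> linarith
  · simp [zwE_zero]
  · rw [Real.sign_of_pos h, abs_of_nonneg (one_sub_zwE_nonneg x)]
    exact one_sub_zwE_le h.le

/-- Substitution t = πw² in the incomplete Gamma integral. -/
lemma one_sub_zwE_eq_upperGamma {x : ℝ} (hx : 0 < x) :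
    1 - zwE x = (Real.sqrt Real.pi)⁻¹ * upperGamma (1 / 2) (Real.pi * x ^ 2) := by
  have hp := Real.pi_pos
  have himg : (fun w => Real.pi * w ^ 2) '' Set.Ioi x = Set.Ioi (Real.pi * x ^ 2) := by
    ext t
    simp only [Set.mem_image, Set.mem_Ioi]
    constructor
    · rintro ⟨w, hw, rfl⟩
      gcongr
    · intro ht
      have ht0 : 0 < t := lt_of_le_of_lt (by positivity) ht
      refine ⟨Real.sqrt (t / Real.pi), ?_, ?_⟩
      · apply Real.lt_sqrt_of_sq_lt
        rw [lt_div_iff₀ hp]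
        linarith
      · rw [Real.sq_sqrt (by positivity)]
        field_simp
  have h1 := MeasureTheory.integral_image_eq_integral_abs_deriv_smul (s := Set.Ioi x)
    (f := fun w => Real.pi * w ^ 2) (f' := fun w => Real.pi * (2 * w)) measurableSet_Ioi
    (fun w _ => by
      have := ((hasDerivAt_pow 2 w).const_mul Real.pi).hasDerivWithinAt (s := Set.Ioi x)
      simpa using this)
    (fun a ha b hb h => by
      have ha' : 0 < a := hx.trans ha
      have hb' : 0 < b := hx.trans hb
      have h' : a ^ 2 = b ^ 2 := mul_left_cancel₀ hp.ne' h
      exact (sq_eq_sq₀ ha'.le hb'.le).mp h')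
    (fun t : ℝ => Real.exp (-t) * t ^ ((1 / 2 : ℝ) - 1))
  rw [upperGamma, ← himg, h1, one_sub_zwE_eq_integral_Ioi, ← MeasureTheory.integral_const_mul,
    ← MeasureTheory.integral_const_mul]
  refine MeasureTheory.setIntegral_congr_fun measurableSet_Ioi fun w hw => ?_
  have hw' : 0 < w := hx.trans hw
  have h2 : (Real.pi * w ^ 2) ^ ((1 / 2 : ℝ) - 1) = (Real.sqrt Real.pi * w)⁻¹ := by
    rw [show ((1 / 2 : ℝ) - 1) = -(1 / 2) by norm_num, Real.rpow_neg (by positivity),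
      ← Real.sqrt_eq_rpow, Real.sqrt_mul hp.le, Real.sqrt_sq hw'.le]
  have hs : Real.sqrt Real.pi ^ 2 = Real.pi := Real.sq_sqrt hp.le
  have hs0 : Real.sqrt Real.pi ≠ 0 := (Real.sqrt_pos.mpr hp).ne'
  simp only [h2, smul_eq_mul]
  rw [abs_of_pos (by positivity)]
  field_simp
  rw [hs]

/-- `sgn x - E(x) = sgn(x) π^{-1/2} Γ(1/2, π x²)`. -/
lemma sign_sub_zwE_eq_upperGamma {x : ℝ} :
    Real.sign x - zwE x =
      Real.sign x * ((Real.sqrt Real.pi)⁻¹ * upperGamma (1 / 2) (Real.pi * x ^ 2)) := by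
  rcases lt_trichotomy x 0 with h | rfl | h
  · have := one_sub_zwE_eq_upperGamma (x := -x) (by linarith)
    rw [zwE_neg, neg_sq] at this
    rw [Real.sign_of_neg h]
    linarith
  · simp [zwE_zero]
  · rw [Real.sign_of_pos h, one_mul]
    exact one_sub_zwE_eq_upperGamma h

/-! ### The terms of `R` -/

/-- The term of index `n = j + 1/2` in the series `R(u;τ)`. -/
def zwRTerm (j : ℤ) (u τ : ℂ) : ℂ :=
  ((Real.sign ((j : ℝ) + 1 / 2)
      - zwE (((j : ℝ) + 1 / 2 + u.im / τ.im) * Real.sqrt (2 * τ.im)) : ℝ) : ℂ) *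
    (-1 : ℂ) ^ j *
    Complex.exp (-Real.pi * Complex.I * ((j : ℂ) + 1 / 2) ^ 2 * τ
      - 2 * Real.pi * Complex.I * ((j : ℂ) + 1 / 2) * u)

lemma zwR_eq_tsum (u τ : ℂ) : zwR u τ = ∑' j : ℤ, zwRTerm j u τ := rfl

lemma sign_add_half (j : ℤ) : Real.sign ((j : ℝ) + 1 / 2) = if 0 ≤ j then 1 else -1 := by
  split_ifs with h
  · have : (0 : ℝ) ≤ j := by exact_mod_cast h
    exact Real.sign_of_pos (by linarith)
  · have : (j : ℝ) ≤ -1 := by exact_mod_cast (by omega : j ≤ -1)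
    exact Real.sign_of_neg (by linarith)

lemma norm_neg_one_zpow (j : ℤ) : ‖(-1 : ℂ) ^ j‖ = 1 := by
  rw [norm_zpow, norm_neg, norm_one, one_zpow]

lemma norm_exp_zwRTerm (j : ℤ) (u : ℂ) {τ : ℂ} (hτ : 0 < τ.im) :
    ‖Complex.exp (-Real.pi * Complex.I * ((j : ℂ) + 1 / 2) ^ 2 * τ
      - 2 * Real.pi * Complex.I * ((j : ℂ) + 1 / 2) * u)‖ =
    Real.exp (Real.pi * τ.im * (((j : ℝ) + 1 / 2) ^ 2 + 2 * ((j : ℝ) + 1 / 2) * (u.im / τ.im))) := by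
  rw [Complex.norm_exp]
  congr 1
  have e : (-Real.pi * Complex.I * ((j : ℂ) + 1 / 2) ^ 2 * τ
      - 2 * Real.pi * Complex.I * ((j : ℂ) + 1 / 2) * u) =
      ((-Real.pi * ((j : ℝ) + 1 / 2) ^ 2 : ℝ) : ℂ) * (Complex.I * τ)
        - ((2 * Real.pi * ((j : ℝ) + 1 / 2) : ℝ) : ℂ) * (Complex.I * u) := by
    push_cast
    ring
  rw [e, Complex.sub_re, Complex.re_ofReal_mul, Complex.re_ofReal_mul, Complex.I_mul_re,
    Complex.I_mul_re]
  field_simp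
  ring

/-- For |n| > |a| the signs of n and n+a agree and the tail bound for E applies. Otherwise |n+a| ≤
2K, and the factor e^{8πyK²} = e^{2πy(2K)²} makes up for the sign mismatch. Uniformity in a is
needed for differentiating R term by term. -/
lemma abs_sign_half_sub_zwE_le (j : ℤ) {a K y : ℝ} (hy : 0 < y) (ha : |a| ≤ K) :
    |Real.sign ((j : ℝ) + 1 / 2) - zwE (((j : ℝ) + 1 / 2 + a) * Real.sqrt (2 * y))| ≤
      3 * Real.exp (8 * Real.pi * y * K ^ 2) *
        Real.exp (-2 * Real.pi * y * ((j : ℝ) + 1 / 2 + a) ^ 2) := by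
  set n : ℝ := (j : ℝ) + 1 / 2 with hn
  have hr : 0 < Real.sqrt (2 * y) := Real.sqrt_pos.mpr (by linarith)
  have hr2 : Real.sqrt (2 * y) ^ 2 = 2 * y := Real.sq_sqrt (by linarith)
  have h1 := abs_sign_sub_zwE_le ((n + a) * Real.sqrt (2 * y))
  rw [mul_pow, hr2, show -Real.pi * ((n + a) ^ 2 * (2 * y)) = -2 * Real.pi * y * (n + a) ^ 2 by ring]
    at h1
  have hK : 1 ≤ Real.exp (8 * Real.pi * y * K ^ 2) :=
    Real.one_le_exp (by have := Real.pi_pos; positivity)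
  have he := Real.exp_pos (-2 * Real.pi * y * (n + a) ^ 2)
  have hsgn : |Real.sign n - Real.sign ((n + a) * Real.sqrt (2 * y))| ≤
      2 * Real.exp (8 * Real.pi * y * K ^ 2) * Real.exp (-2 * Real.pi * y * (n + a) ^ 2) := by
    by_cases hlt : |a| < |n|
    · have : Real.sign ((n + a) * Real.sqrt (2 * y)) = Real.sign n := by
        rcases lt_or_ge n 0 with h | h
        · rw [abs_of_neg h] at hlt
          rw [Real.sign_of_neg h, Real.sign_of_neg]
          have := (abs_lt.mp hlt).2
          exact mul_neg_of_neg_of_pos (by linarith) hr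
        · rw [abs_of_nonneg h] at hlt
          have h0 : 0 < n := lt_of_le_of_lt (abs_nonneg a) hlt
          rw [Real.sign_of_pos h0, Real.sign_of_pos]
          have := (abs_lt.mp hlt).1
          exact mul_pos (by linarith) hr
      rw [this, sub_self, abs_zero]
      positivity
    · have h2 : ∀ x : ℝ, |Real.sign x| ≤ 1 := fun x => by
        rcases Real.sign_apply_eq x with h | h | h <;> rw [h] <;> norm_num
      have h3 : |Real.sign n - Real.sign ((n + a) * Real.sqrt (2 * y))| ≤ 2 :=
        (abs_sub _ _).trans (by linarith [h2 n, h2 ((n + a) * Real.sqrt (2 * y))])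
      have h4 : (n + a) ^ 2 ≤ 4 * K ^ 2 := by
        have : |n + a| ≤ 2 * K := (abs_add_le n a).trans (by linarith)
        have := sq_le_sq' (by linarith [abs_le.mp this]) (abs_le.mp this).2
        linarith
      have h5 : 1 ≤ Real.exp (8 * Real.pi * y * K ^ 2) *
          Real.exp (-2 * Real.pi * y * (n + a) ^ 2) := by
        rw [← Real.exp_add]
        apply Real.one_le_exp
        have := mul_le_mul_of_nonneg_left h4 (show 0 ≤ 2 * Real.pi * y by
          have := Real.pi_pos; positivity)
        linarith
      calc _ ≤ (2 : ℝ) := h3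
        _ ≤ _ := by linarith
  have h6 := abs_add_le (Real.sign n - Real.sign ((n + a) * Real.sqrt (2 * y)))
    (Real.sign ((n + a) * Real.sqrt (2 * y)) - zwE ((n + a) * Real.sqrt (2 * y)))
  rw [sub_add_sub_cancel] at h6
  have h7 := le_mul_of_one_le_left he.le hK
  linarith

/-- The summable majorant of the terms of `R`. -/
def zwRBound (y K : ℝ) (j : ℤ) : ℝ :=
  Real.exp (-Real.pi * y * ((j : ℝ) + 1 / 2) ^ 2 + 2 * Real.pi * y * K * |(j : ℝ) + 1 / 2|)

lemma summable_abs_mul_zwRBound {y K : ℝ} (hy : 0 < y) (hK : 0 ≤ K) :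
    Summable fun j : ℤ => (|(j : ℝ) + 1 / 2| + 1) * zwRBound y K j := by
  have hp := Real.pi_pos
  have h0 := summable_pow_mul_jacobiTheta₂_term_bound (y / 2 + y * K) hy 0
  have h1 := summable_pow_mul_jacobiTheta₂_term_bound (y / 2 + y * K) hy 1
  refine Summable.of_nonneg_of_le (fun j => by unfold zwRBound; positivity) (fun j => ?_)
    ((h1.add (h0.mul_left 2)).mul_left (Real.exp (Real.pi * y * K)))
  have hj : |(j : ℝ) + 1 / 2| ≤ |(j : ℝ)| + 1 / 2 := by
    have := abs_add_le (j : ℝ) (1 / 2)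
    rwa [abs_of_pos (by norm_num : (0 : ℝ) < 1 / 2)] at this
  have hb : zwRBound y K j ≤ Real.exp (Real.pi * y * K) *
      Real.exp (-Real.pi * (y * (j : ℝ) ^ 2 - 2 * (y / 2 + y * K) * |(j : ℝ)|)) := by
    rw [zwRBound, ← Real.exp_add, Real.exp_le_exp]
    have e1 : -(j : ℝ) ≤ |(j : ℝ)| := neg_le_abs _
    have e2 := mul_le_mul_of_nonneg_left hj (show 0 ≤ 2 * Real.pi * y * K by positivity)
    have e3 := mul_le_mul_of_nonneg_left e1 (show 0 ≤ Real.pi * y by positivity)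
    have e4 : 0 ≤ Real.pi * y := by positivity
    nlinarith
  have hb0 : 0 ≤ zwRBound y K j := (Real.exp_pos _).le
  push_cast
  rw [pow_zero, pow_one, one_mul]
  calc _ ≤ (|(j : ℝ)| + 2) * (Real.exp (Real.pi * y * K) *
      Real.exp (-Real.pi * (y * (j : ℝ) ^ 2 - 2 * (y / 2 + y * K) * |(j : ℝ)|))) := mul_le_mul (by linarith) hb hb0 (by positivity)
    _ = _ := by ring

lemma summable_zwRBound {y K : ℝ} (hy : 0 < y) (hK : 0 ≤ K) : Summable (zwRBound y K) :=
  (summable_abs_mul_zwRBound hy hK).of_nonneg_of_le (fun _ => (Real.exp_pos _).le) fun j =>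
    le_mul_of_one_le_left (Real.exp_pos _).le (by linarith [abs_nonneg ((j : ℝ) + 1 / 2)])

/-- The Gaussian decay of the error factor overcomes the growth of e^{-πin²τ}: -2(n+a)² + n² + 2na =
-n² - 2na - 2a². -/
lemma exp_mul_exp_le_zwRBound {y K a : ℝ} (hy : 0 < y) (ha : |a| ≤ K) (j : ℤ) :
    Real.exp (-2 * Real.pi * y * ((j : ℝ) + 1 / 2 + a) ^ 2) *
      Real.exp (Real.pi * y * (((j : ℝ) + 1 / 2) ^ 2 + 2 * ((j : ℝ) + 1 / 2) * a)) ≤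
    zwRBound y K j := by
  rw [zwRBound, ← Real.exp_add, Real.exp_le_exp]
  set n : ℝ := (j : ℝ) + 1 / 2
  have h1 : -(n * a) ≤ K * |n| := by
    have := neg_le_abs (n * a)
    rw [abs_mul] at this
    nlinarith [abs_nonneg n]
  have hp : 0 < Real.pi * y := mul_pos Real.pi_pos hy
  nlinarith [sq_nonneg a]

lemma norm_zwRTerm_le (j : ℤ) {u τ : ℂ} (hτ : 0 < τ.im) {K : ℝ} (hu : |u.im / τ.im| ≤ K) :
    ‖zwRTerm j u τ‖ ≤ 3 * Real.exp (8 * Real.pi * τ.im * K ^ 2) * zwRBound τ.im K j := by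
  rw [zwRTerm, norm_mul, norm_mul, norm_neg_one_zpow, mul_one, norm_exp_zwRTerm j u hτ,
    Complex.norm_real, Real.norm_eq_abs]
  have h1 := abs_sign_half_sub_zwE_le j hτ hu
  have h2 := exp_mul_exp_le_zwRBound hτ hu j
  calc _ ≤ 3 * Real.exp (8 * Real.pi * τ.im * K ^ 2) *
        Real.exp (-2 * Real.pi * τ.im * ((j : ℝ) + 1 / 2 + u.im / τ.im) ^ 2) * _ := by
          gcongr
    _ ≤ _ := by
      rw [mul_assoc]
      gcongr

lemma summable_zwRTerm (u : ℂ) {τ : ℂ} (hτ : 0 < τ.im) : Summable fun j => zwRTerm j u τ :=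
  Summable.of_norm_bounded ((summable_zwRBound hτ (abs_nonneg (u.im / τ.im))).mul_left _)
    fun j => norm_zwRTerm_le j hτ le_rfl

lemma hasSum_zwRTerm (u : ℂ) {τ : ℂ} (hτ : 0 < τ.im) :
    HasSum (fun j => zwRTerm j u τ) (zwR u τ) :=
  (summable_zwRTerm u hτ).hasSum

/-! ### The Wirtinger derivative of `R` -/

/-- The derivative of `zwRTerm j u τ` with respect to the conjugate of `u`. -/
def zwRTermConj (j : ℤ) (u τ : ℂ) : ℂ :=
  -Complex.I * ((Real.exp (-2 * Real.pi * τ.im * ((j : ℝ) + 1 / 2 + u.im / τ.im) ^ 2) *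
      (Real.sqrt (2 * τ.im) / τ.im) : ℝ) : ℂ) * ((-1 : ℂ) ^ j *
    Complex.exp (-Real.pi * Complex.I * ((j : ℂ) + 1 / 2) ^ 2 * τ
      - 2 * Real.pi * Complex.I * ((j : ℂ) + 1 / 2) * u))

/-- The derivative of `R(u;τ)` with respect to the conjugate of `u`. -/
def zwRConj (u τ : ℂ) : ℂ :=
  ((Real.sqrt (2 * τ.im) / τ.im * Real.exp (-2 * Real.pi * τ.im * (u.im / τ.im) ^ 2) : ℝ) : ℂ) *
    starRingEnd ℂ (zwTheta u τ)

open Complex in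
-- The real derivative is split into its complex-linear and conjugate-linear parts. Only the error
-- function, through Im u, contributes to the latter.
lemma hasFDerivAt_zwRTerm (j : ℤ) (u : ℂ) {τ : ℂ} (hτ : 0 < τ.im) :
    HasFDerivAt (fun u => zwRTerm j u τ)
      ((-2 * Real.pi * I * ((j : ℂ) + 1 / 2) * zwRTerm j u τ - zwRTermConj j u τ) •
        (1 : ℂ →L[ℝ] ℂ) + zwRTermConj j u τ • (conjCLE : ℂ →L[ℝ] ℂ)) u := by
  have hr2 : Real.sqrt (2 * τ.im) ^ 2 = 2 * τ.im := Real.sq_sqrt (by linarith)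
  have him : HasFDerivAt (fun u : ℂ => ((j : ℝ) + 1 / 2 + u.im / τ.im) * Real.sqrt (2 * τ.im))
      ((Real.sqrt (2 * τ.im) / τ.im) • imCLM) u := by
    have h := (((imCLM.hasFDerivAt (x := u)).mul_const (τ.im)⁻¹).const_add
      ((j : ℝ) + 1 / 2)).mul_const (Real.sqrt (2 * τ.im))
    refine (h.congr_fderiv ?_)
    ext
    simp
    ring
  have hc := ((hasDerivAt_zwE _).comp_hasFDerivAt u him).const_sub (Real.sign ((j : ℝ) + 1 / 2))
  have hc' := ofRealCLM.hasFDerivAt.comp u hc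
  have hg : HasDerivAt (fun u : ℂ => (-1 : ℂ) ^ j *
      exp (-Real.pi * I * ((j : ℂ) + 1 / 2) ^ 2 * τ - 2 * Real.pi * I * ((j : ℂ) + 1 / 2) * u))
      ((-1 : ℂ) ^ j * (exp (-Real.pi * I * ((j : ℂ) + 1 / 2) ^ 2 * τ
        - 2 * Real.pi * I * ((j : ℂ) + 1 / 2) * u) * (-(2 * Real.pi * I * ((j : ℂ) + 1 / 2) * 1)))) u :=
    ((((hasDerivAt_id u).const_mul (2 * Real.pi * I * ((j : ℂ) + 1 / 2))).const_sub _).cexp).const_mul _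
  have h := hc'.mul hg.complexToReal_fderiv
  refine (h.congr_of_eventuallyEq (Eventually.of_forall fun v => ?_)).congr_fderiv ?_
  · simp [zwRTerm, mul_assoc]
  · have key : ∀ k : ℂ, (starRingEnd ℂ) k = k - 2 * I * (k.im : ℂ) := fun k => by
      apply Complex.ext <;> simp
      ring
    refine ContinuousLinearMap.ext fun k => ?_
    have e : -Real.pi * (((j : ℝ) + 1 / 2 + u.im / τ.im) * Real.sqrt (2 * τ.im)) ^ 2 =
        -2 * Real.pi * τ.im * ((j : ℝ) + 1 / 2 + u.im / τ.im) ^ 2 := by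
      rw [mul_pow, hr2]
      ring
    simp only [add_apply, smul_apply,
      one_apply_eq_self, ContinuousLinearEquiv.coe_coe, conjCLE_apply,
      ContinuousLinearMap.comp_apply, neg_apply,
      smul_eq_mul, key, e, Function.comp_apply, imCLM_apply, ofRealCLM_apply, zwRTerm, zwRTermConj]
    push_cast
    linear_combination (-2 * (-1 : ℂ) ^ j *
      exp (-Real.pi * I * ((j : ℂ) + 1 / 2) ^ 2 * τ - 2 * Real.pi * I * ((j : ℂ) + 1 / 2) * u) *
      exp (-2 * Real.pi * τ.im * ((j : ℂ) + 1 / 2 + u.im / τ.im) ^ 2) *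
      (Real.sqrt (2 * τ.im) : ℂ) / τ.im * k.im) * I_sq

lemma norm_zwRTermConj_le (j : ℤ) {u τ : ℂ} (hτ : 0 < τ.im) {K : ℝ} (hu : |u.im / τ.im| ≤ K) :
    ‖zwRTermConj j u τ‖ ≤ (Real.sqrt (2 * τ.im) / τ.im) * zwRBound τ.im K j := by
  have h2 := exp_mul_exp_le_zwRBound hτ hu j
  rw [zwRTermConj, norm_mul, norm_mul, norm_mul, norm_neg_one_zpow, one_mul, norm_neg,
    Complex.norm_I, one_mul, norm_exp_zwRTerm j u hτ, Complex.norm_real, Real.norm_eq_abs,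
    abs_of_nonneg (by positivity)]
  rw [mul_comm (Real.exp _) (Real.sqrt _ / _), mul_assoc]
  exact mul_le_mul_of_nonneg_left h2 (by positivity)

lemma neg_one_zpow_neg (j : ℤ) : (-1 : ℂ) ^ (-j) = (-1) ^ j := by
  rw [zpow_neg, ← inv_zpow, inv_neg, inv_one]

open Complex in
-- Completing the square in the Gaussian converts e^{-πin²τ-2πinu} into the conjugate of the
-- corresponding theta term, with a factor independent of n. Hence the sum over n is a multiple of
-- the conjugate of ϑ(u;τ).
lemma zwRTermConj_eq (j : ℤ) (u : ℂ) {τ : ℂ} (hτ : 0 < τ.im) :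
    zwRTermConj j u τ =
      ((Real.sqrt (2 * τ.im) / τ.im * Real.exp (-2 * Real.pi * τ.im * (u.im / τ.im) ^ 2) : ℝ) : ℂ) *
      starRingEnd ℂ (exp (Real.pi * I * ((j : ℂ) + 1 / 2) ^ 2 * τ
      + 2 * Real.pi * I * ((j : ℂ) + 1 / 2) * (u + 1 / 2))) := by
  have key : ∀ k : ℂ, (starRingEnd ℂ) k = k - 2 * I * (k.im : ℂ) := fun k => by
    apply Complex.ext <;> simp
    ring
  have h0 : (τ.im : ℂ) ≠ 0 := by exact_mod_cast hτ.ne'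
  have e1 : -I = exp (-Real.pi / 2 * I) := exp_neg_pi_div_two_mul_I.symm
  rw [zwRTermConj, ← neg_one_zpow_neg, ← exp_pi_mul_I_mul_int, e1, ← exp_conj]
  push_cast
  have e2 : ∀ a b c d e : ℂ, exp a * (exp b * c) * (exp d * exp e) = c * exp (a + b + d + e) := by
    intros; simp only [exp_add]; ring
  have e3 : ∀ a b c : ℂ, c * exp a * exp b = c * exp (a + b) := by
    intros; simp only [exp_add]; ring
  rw [e2, e3]
  congr 2
  simp only [map_add, map_mul, map_pow, conj_ofReal, conj_I, map_intCast, map_ofNat, map_div₀,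
    map_one, key τ, key u]
  field_simp
  linear_combination
    (-8 * u.im * τ.im * (2 * j + 1) - 2 * τ.im ^ 2 * (2 * j + 1) ^ 2 : ℂ) * I_sq

lemma hasSum_zwRTermConj (u : ℂ) {τ : ℂ} (hτ : 0 < τ.im) :
    HasSum (fun j => zwRTermConj j u τ) (zwRConj u τ) := by
  have h := ((Complex.conjCLE : ℂ →L[ℝ] ℂ).hasSum (hasSum_zwTheta u hτ)).mul_left
    ((Real.sqrt (2 * τ.im) / τ.im * Real.exp (-2 * Real.pi * τ.im * (u.im / τ.im) ^ 2) : ℝ) : ℂ)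
  simp only [zwRTermConj_eq _ u hτ]
  exact h

/-- Only the conjugate-linear coefficient is used later, so the complex-linear one is left unnamed.
-/
lemma exists_hasFDerivAt_zwR (u : ℂ) {τ : ℂ} (hτ : 0 < τ.im) :
    ∃ A : ℂ, HasFDerivAt (fun u => zwR u τ)
      (A • (1 : ℂ →L[ℝ] ℂ) + zwRConj u τ • (Complex.conjCLE : ℂ →L[ℝ] ℂ)) u := by
  set K : ℝ := (‖u‖ + 1) / τ.im with hK
  have hK0 : 0 ≤ K := by positivity
  have hball : ∀ v ∈ Metric.ball (0 : ℂ) (‖u‖ + 1), |v.im / τ.im| ≤ K := by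
    intro v hv
    rw [mem_ball_zero_iff] at hv
    rw [abs_div, abs_of_pos hτ, hK]
    gcongr
    exact (Complex.abs_im_le_norm v).trans hv.le
  have hu : u ∈ Metric.ball (0 : ℂ) (‖u‖ + 1) := by
    rw [mem_ball_zero_iff]
    linarith
  set C1 : ℝ := 3 * Real.exp (8 * Real.pi * τ.im * K ^ 2)
  set C2 : ℝ := Real.sqrt (2 * τ.im) / τ.im
  have hC2 : 0 ≤ C2 := by positivity
  have hC1 : 0 ≤ C1 := by positivity
  have hA : ∀ j : ℤ, ∀ v ∈ Metric.ball (0 : ℂ) (‖u‖ + 1),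
      ‖-2 * Real.pi * Complex.I * ((j : ℂ) + 1 / 2) * zwRTerm j v τ - zwRTermConj j v τ‖ ≤
        (2 * Real.pi * C1 + C2) * ((|(j : ℝ) + 1 / 2| + 1) * zwRBound τ.im K j) := by
    intro j v hv
    have h1 := norm_zwRTerm_le j hτ (hball v hv)
    have h2 := norm_zwRTermConj_le j hτ (hball v hv)
    have hb : 0 ≤ zwRBound τ.im K j := (Real.exp_pos _).le
    have hn : ‖(-2 * Real.pi * Complex.I * ((j : ℂ) + 1 / 2) : ℂ)‖ =
        2 * Real.pi * |(j : ℝ) + 1 / 2| := by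
      rw [show (-2 * Real.pi * Complex.I * ((j : ℂ) + 1 / 2) : ℂ) =
        ((-2 * Real.pi * ((j : ℝ) + 1 / 2) : ℝ) : ℂ) * Complex.I by push_cast; ring, norm_mul,
        Complex.norm_I, mul_one, Complex.norm_real, Real.norm_eq_abs, abs_mul, abs_mul,
        abs_of_pos Real.pi_pos]
      norm_num
    refine (norm_sub_le _ _).trans ?_
    rw [norm_mul, hn]
    have h3 := mul_le_mul_of_nonneg_left h1
      (show 0 ≤ 2 * Real.pi * |(j : ℝ) + 1 / 2| by have := Real.pi_pos; positivity)
    have h4 : 0 ≤ |(j : ℝ) + 1 / 2| := abs_nonneg _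
    have hp := Real.pi_pos
    have h5 : 0 ≤ 2 * Real.pi * C1 * zwRBound τ.im K j := by positivity
    have h6 : 0 ≤ C2 * zwRBound τ.im K j * |(j : ℝ) + 1 / 2| := by positivity
    linarith
  have hsumA : Summable fun j : ℤ =>
      -2 * Real.pi * Complex.I * ((j : ℂ) + 1 / 2) * zwRTerm j u τ - zwRTermConj j u τ :=
    Summable.of_norm_bounded ((summable_abs_mul_zwRBound hτ hK0).mul_left _) fun j => hA j u hu
  refine ⟨∑' j : ℤ, (-2 * Real.pi * Complex.I * ((j : ℂ) + 1 / 2) * zwRTerm j u τ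
    - zwRTermConj j u τ), ?_⟩
  have hd := hasFDerivAt_tsum_of_isPreconnected
    (((summable_abs_mul_zwRBound hτ hK0).mul_left (2 * Real.pi * C1 + C2)).add
      ((summable_zwRBound hτ hK0).mul_left C2))
    (s := Metric.ball (0 : ℂ) (‖u‖ + 1)) Metric.isOpen_ball
    (convex_ball _ _).isPreconnected (fun j v _ => hasFDerivAt_zwRTerm j v hτ)
    (fun j v hv => by
      refine (norm_add_le _ _).trans (add_le_add ?_ ?_)
      · refine (norm_smul_le _ _).trans ?_
        have : ‖(1 : ℂ →L[ℝ] ℂ)‖ ≤ 1 := ContinuousLinearMap.norm_id_le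
        exact (mul_le_of_le_one_right (norm_nonneg _) this).trans (hA j v hv)
      · refine (norm_smul_le _ _).trans ?_
        rw [Complex.conjCLE_norm, mul_one]
        exact norm_zwRTermConj_le j hτ (hball v hv))
    hu (summable_zwRTerm u hτ) hu
  have hs := (hsumA.hasSum.smul_const (1 : ℂ →L[ℝ] ℂ)).add
    ((hasSum_zwRTermConj u hτ).smul_const (Complex.conjCLE : ℂ →L[ℝ] ℂ))
  rw [hs.tsum_eq] at hd
  exact hd

/-! ### The behaviour of `R` under inversion -/

lemma im_neg_one_div (τ : ℂ) : (-1 / τ).im = τ.im / Complex.normSq τ := by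
  rw [neg_div, one_div, Complex.neg_im, Complex.inv_im, neg_div, neg_neg]

lemma im_neg_one_div_pos {τ : ℂ} (hτ : 0 < τ.im) : 0 < (-1 / τ).im := by
  have h0 : τ ≠ 0 := by rintro rfl; simp at hτ
  rw [im_neg_one_div]
  exact div_pos hτ (Complex.normSq_pos.mpr h0)

/-- The nonholomorphic parts of `R(u;τ)` and of its transform under `τ ↦ -1/τ` cancel. -/
lemma zwRConj_inversion (u : ℂ) {τ : ℂ} (hτ : 0 < τ.im) :
    Complex.exp (Real.pi * Complex.I * u ^ 2 / τ) / (-Complex.I * τ) ^ (1 / 2 : ℂ) *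
      (zwRConj (u / τ) (-1 / τ) * starRingEnd ℂ (1 / τ)) = -zwRConj u τ := by
  have h0 : τ ≠ 0 := by rintro rfl; simp at hτ
  have hN : 0 < Complex.normSq τ := Complex.normSq_pos.mpr h0
  set w : ℂ := (-Complex.I * τ) ^ (1 / 2 : ℂ) with hw
  have hw2 : w * w = -Complex.I * τ := by
    rw [hw, ← sq, ← Complex.cpow_nat_mul]
    norm_num
  have hw0 : w ≠ 0 := fun h => by
    rw [h, mul_zero] at hw2
    simp [h0] at hw2
  have hr : Real.sqrt (2 * (-1 / τ).im) / (-1 / τ).im = Real.sqrt (2 * τ.im) / τ.im * ‖τ‖ := by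
    rw [im_neg_one_div, Complex.normSq_eq_norm_sq, ← mul_div_assoc,
      Real.sqrt_div' _ (by positivity), Real.sqrt_sq (norm_nonneg _)]
    have : ‖τ‖ ≠ 0 := norm_ne_zero_iff.mpr h0
    field_simp
  have hE : Complex.exp (Real.pi * Complex.I * u ^ 2 / τ) *
      starRingEnd ℂ (Complex.exp (Real.pi * Complex.I * u ^ 2 / τ)) *
      ((Real.exp (-2 * Real.pi * (-1 / τ).im * ((u / τ).im / (-1 / τ).im) ^ 2) : ℝ) : ℂ) =
      ((Real.exp (-2 * Real.pi * τ.im * (u.im / τ.im) ^ 2) : ℝ) : ℂ) := by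
    rw [Complex.mul_conj, Complex.normSq_eq_norm_sq, Complex.norm_exp, ← Complex.ofReal_mul,
      ← Real.exp_nat_mul, ← Real.exp_add]
    congr 2
    rw [show Real.pi * Complex.I * u ^ 2 / τ = (Real.pi : ℂ) * (Complex.I * (u ^ 2 / τ)) by ring,
      Complex.re_ofReal_mul, Complex.I_mul_re, im_neg_one_div, Complex.div_im, Complex.div_im, sq u,
      Complex.mul_re, Complex.mul_im]
    have hN' : Complex.normSq τ ≠ 0 := hN.ne'
    have hy : τ.im ≠ 0 := hτ.ne'
    push_cast
    field_simp
    rw [Complex.normSq_apply]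
    ring
  -- From w² = -iτ follow w·w̄ = ‖τ‖ and w̄² = iτ̄. They reconcile the factor ‖τ‖ caused by the new
  -- height with the square roots from theta inversion.
  have hcw : starRingEnd ℂ w * (‖τ‖ : ℂ) = Complex.I * starRingEnd ℂ τ * w := by
    have h1 : w * starRingEnd ℂ w = (‖τ‖ : ℂ) := by
      have : ‖w‖ * ‖w‖ = ‖τ‖ := by
        rw [← norm_mul, hw2, norm_mul, norm_neg, Complex.norm_I, one_mul]
      rw [Complex.mul_conj, Complex.normSq_eq_norm_sq, sq, this]
    have h2 : starRingEnd ℂ w * starRingEnd ℂ w = Complex.I * starRingEnd ℂ τ := by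
      rw [← map_mul, hw2]
      simp
    rw [← h1]
    linear_combination w * h2
  have hct : starRingEnd ℂ τ ≠ 0 := by simpa using h0
  rw [zwRConj, zwRConj, hr, zwTheta_inversion u hτ, ← hw]
  simp only [map_mul, map_neg, Complex.conj_I, neg_neg, map_div₀, map_one, Complex.ofReal_mul]
  rw [← hE]
  field_simp
  linear_combination
    (Complex.I * (Real.sqrt (2 * τ.im) / τ.im : ℝ) * starRingEnd ℂ (zwTheta u τ)) * hcw +
    ((Real.sqrt (2 * τ.im) / τ.im : ℝ) * starRingEnd ℂ (zwTheta u τ) * starRingEnd ℂ τ * w) *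
      Complex.I_sq

/-- `R(u;τ) + (-iτ)^{-1/2} e^{πiu²/τ} R(u/τ;-1/τ)`. -/
def zwRInvSum (u τ : ℂ) : ℂ :=
  zwR u τ + Complex.exp (Real.pi * Complex.I * u ^ 2 / τ) / (-Complex.I * τ) ^ (1 / 2 : ℂ) *
    zwR (u / τ) (-1 / τ)

/-- By `zwRConj_inversion` the conjugate-linear parts cancel, so the real derivative is complex
linear. Holomorphy alone suffices for the inversion law; the value of this function (a Mordell
integral) is never computed. -/
lemma differentiable_zwRInvSum {τ : ℂ} (hτ : 0 < τ.im) :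
    Differentiable ℂ fun u => zwRInvSum u τ := by
  intro u
  obtain ⟨A, hA⟩ := exists_hasFDerivAt_zwR u hτ
  obtain ⟨A', hA'⟩ := exists_hasFDerivAt_zwR (u / τ) (im_neg_one_div_pos hτ)
  have hdiv : HasFDerivAt (fun u : ℂ => u / τ) ((1 / τ) • (1 : ℂ →L[ℝ] ℂ)) u :=
    ((hasDerivAt_id u).div_const τ).complexToReal_fderiv
  have hE : DifferentiableAt ℂ (fun u : ℂ => Complex.exp (Real.pi * Complex.I * u ^ 2 / τ) /
      (-Complex.I * τ) ^ (1 / 2 : ℂ)) u := by fun_prop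
  have h := hA.add (hE.hasDerivAt.complexToReal_fderiv.mul (hA'.comp u hdiv))
  set E := fun u : ℂ => Complex.exp (Real.pi * Complex.I * u ^ 2 / τ) /
      (-Complex.I * τ) ^ (1 / 2 : ℂ) with hEdef
  have hcancel : E u * (zwRConj (u / τ) (-1 / τ) * starRingEnd ℂ (1 / τ)) = -zwRConj u τ :=
    zwRConj_inversion u hτ
  refine (hasFDerivAt_of_restrictScalars ℝ (f' := (A + E u * (A' * (1 / τ)) +
    zwR (u / τ) (-1 / τ) * deriv E u) • (1 : ℂ →L[ℂ] ℂ)) h ?_).differentiableAt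
  refine ContinuousLinearMap.ext fun k => ?_
  simp only [ContinuousLinearMap.coe_restrictScalars', add_apply, smul_apply, one_apply_eq_self,
    ContinuousLinearEquiv.coe_coe, Complex.conjCLE_apply, ContinuousLinearMap.comp_apply,
    smul_eq_mul, Function.comp_apply, map_mul]
  linear_combination -(starRingEnd ℂ k) * hcancel

/-! ### Elliptic transformations -/

open Complex in
lemma zwR_add_one (u τ : ℂ) : zwR (u + 1) τ = -zwR u τ := by
  rw [zwR_eq_tsum, zwR_eq_tsum, ← tsum_neg]
  refine tsum_congr fun j => ?_
  rw [zwRTerm, zwRTerm, ← mul_neg, ← neg_one_mul (exp _), ← exp_pi_mul_I, ← exp_add, add_im, one_im,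
    add_zero]
  congr 1
  rw [exp_eq_exp_iff_exists_int]
  refine ⟨-j - 1, ?_⟩
  push_cast
  ring

open Complex in
lemma zwR_modular_add_one (u τ : ℂ) : zwR u (τ + 1) = exp (-Real.pi * I / 4) * zwR u τ := by
  rw [zwR_eq_tsum, zwR_eq_tsum, ← tsum_mul_left]
  refine tsum_congr fun j => ?_
  rw [zwRTerm, zwRTerm, mul_left_comm, ← exp_add, add_im, one_im, add_zero]
  congr 1
  rw [exp_eq_exp_iff_exists_int]
  obtain ⟨k, hk⟩ := Int.even_mul_succ_self j
  refine ⟨-k, ?_⟩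
  have hk' : (j : ℂ) * (j + 1) = k + k := by exact_mod_cast hk
  push_cast
  linear_combination (-Real.pi * I) * hk'

open Complex in
-- Adding τ to u amounts to shifting n by one, except that sgn(n) does not shift along. The signs of
-- n and n+1 differ only at n = -1/2, that is j = -1, which produces the inhomogeneous term.
lemma zwR_add_period (u : ℂ) {τ : ℂ} (hτ : 0 < τ.im) :
    zwR (u + τ) τ = -exp (2 * Real.pi * I * u + Real.pi * I * τ) * zwR u τ +
      2 * exp (Real.pi * I * u + 3 * Real.pi * I * τ / 4) := by
  have h1 : HasSum (fun j : ℤ => zwRTerm (j + 1) u τ) (zwR u τ) :=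
    (Equiv.addRight (1 : ℤ)).hasSum_iff.mpr (hasSum_zwRTerm u hτ)
  have h2 := hasSum_ite_eq (-1 : ℤ) (2 * exp (Real.pi * I * u + 3 * Real.pi * I * τ / 4))
  have h3 := (h1.mul_left (-exp (2 * Real.pi * I * u + Real.pi * I * τ))).add h2
  rw [← h3.tsum_eq, zwR_eq_tsum]
  refine tsum_congr fun j => ?_
  have him : (u + τ).im / τ.im = u.im / τ.im + 1 := by
    rw [add_im]
    field_simp
  have hE : exp (-Real.pi * I * ((j : ℂ) + 1 / 2) ^ 2 * τ
      - 2 * Real.pi * I * ((j : ℂ) + 1 / 2) * (u + τ)) =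
      exp (2 * Real.pi * I * u + Real.pi * I * τ) * exp (-Real.pi * I * (((j + 1 : ℤ) : ℂ) + 1 / 2) ^ 2 * τ
      - 2 * Real.pi * I * (((j + 1 : ℤ) : ℂ) + 1 / 2) * u) := by
    rw [← exp_add]
    congr 1
    push_cast
    ring
  have hx : ((j + 1 : ℤ) : ℝ) + 1 / 2 + u.im / τ.im = (j : ℝ) + 1 / 2 + (u.im / τ.im + 1) := by
    push_cast
    ring
  rw [zwRTerm, zwRTerm, him, hE, sign_add_half, sign_add_half, hx, zpow_add_one₀ (by norm_num)]
  split_ifs with ha hb hc hc hb hc hc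
  · omega
  · ring
  · omega
  · omega
  · subst hc
    norm_num
    have : exp (Real.pi * I * u + 3 * Real.pi * I * τ / 4) = exp (2 * Real.pi * I * u + Real.pi * I * τ) *
        exp (-(Real.pi * I * (2⁻¹ : ℂ) ^ 2 * τ) - 2 * Real.pi * I * 2⁻¹ * u) := by
      rw [← exp_add]
      congr 1
      ring
    rw [this]
    norm_num
    ring
  · omega
  · omega
  · ring

/-- `u ∉ ℤ + τℤ`. -/
def OffLattice (u τ : ℂ) : Prop :=
  ∀ n : ℤ, Complex.exp (2 * Real.pi * Complex.I * n * τ + 2 * Real.pi * Complex.I * u) ≠ 1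

/-- The Appell sum, that is `ϑ(v;τ) μ(u,v;τ)`. -/
def zwAppell (u v τ : ℂ) : ℂ :=
  Complex.exp (Real.pi * Complex.I * u) *
    ∑' n : ℤ, (-1 : ℂ) ^ n *
        Complex.exp (Real.pi * Complex.I * n * (n + 1) * τ + 2 * Real.pi * Complex.I * n * v) /
      (1 - Complex.exp (2 * Real.pi * Complex.I * n * τ + 2 * Real.pi * Complex.I * u))

/-- `ϑ(v;τ) μ̃(u,v;τ)`. -/
def zwNum (u v τ : ℂ) : ℂ :=
  zwAppell u v τ + Complex.I / 2 * (zwTheta v τ * zwR (u - v) τ)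

lemma zwMuTilde_eq_zwNum_div (u : ℂ) {v τ : ℂ} (hv : zwTheta v τ ≠ 0) :
    zwMuTilde u v τ = zwNum u v τ / zwTheta v τ := by
  have h : zwMu u v τ = zwAppell u v τ / zwTheta v τ := by
    rw [zwMu, zwAppell, div_mul_eq_mul_div]
  rw [zwMuTilde, zwNum, h]
  field_simp

/-! ### Convergence and quasi-periodicity of the Appell sum. -/

lemma norm_exp_lattice (n : ℤ) (p r : ℝ) (τ : ℂ) :
    ‖Complex.exp (2 * Real.pi * Complex.I * n * τ + 2 * Real.pi * Complex.I * (p * τ + r))‖ =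
      Real.exp (-2 * Real.pi * (n + p) * τ.im) := by
  rw [Complex.norm_exp]
  congr 1
  rw [show 2 * Real.pi * Complex.I * n * τ + 2 * Real.pi * Complex.I * (p * τ + r) =
    ((2 * Real.pi * (n + p) : ℝ) : ℂ) * (Complex.I * τ) + ((2 * Real.pi * r : ℝ) : ℂ) * Complex.I by
      push_cast; ring, Complex.add_re, Complex.re_ofReal_mul, Complex.re_ofReal_mul, Complex.I_mul_re,
      Complex.I_re]
  ring

lemma exists_real_coords (u : ℂ) {τ : ℂ} (hτ : 0 < τ.im) : ∃ p r : ℝ, u = p * τ + r := by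
  refine ⟨u.im / τ.im, u.re - u.im / τ.im * τ.re, ?_⟩
  apply Complex.ext
  · simp
  · simp
    field_simp

/-- If |n+p| ≥ 1 the exponential has modulus bounded away from 1, and only finitely many n remain. A
vanishing denominator can occur only among those, where the inverse is 0 by convention and does no
harm. -/
lemma exists_bound_inv_one_sub_exp (u : ℂ) {τ : ℂ} (hτ : 0 < τ.im) : ∃ C : ℝ, ∀ n : ℤ,
    ‖(1 - Complex.exp (2 * Real.pi * Complex.I * n * τ + 2 * Real.pi * Complex.I * u))⁻¹‖ ≤ C := by
  obtain ⟨p, r, rfl⟩ := exists_real_coords u hτ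
  set f : ℤ → ℝ := fun n => ‖(1 - Complex.exp (2 * Real.pi * Complex.I * n * τ +
    2 * Real.pi * Complex.I * (p * τ + r)))⁻¹‖ with hf
  have hfin : {n : ℤ | |(n : ℝ) + p| < 1}.Finite := by
    refine (Set.finite_Icc (⌊-p - 1⌋) (⌈1 - p⌉)).subset fun n hn => ?_
    have h := abs_lt.mp (show |(n : ℝ) + p| < 1 from hn)
    constructor
    · exact Int.cast_le (R := ℝ).mp ((Int.floor_le _).trans (by linarith [h.1]))
    · exact Int.cast_le (R := ℝ).mp (le_trans (by linarith [h.2]) (Int.le_ceil _))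
  obtain ⟨C, hC⟩ := (hfin.image f).bddAbove
  have hp := Real.pi_pos
  set δ : ℝ := 1 - Real.exp (-2 * Real.pi * τ.im)
  have hδ : 0 < δ := by
    have : Real.exp (-2 * Real.pi * τ.im) < 1 := Real.exp_lt_one_iff.mpr (by
      have : 0 < Real.pi * τ.im := by positivity
      linarith)
    linarith
  refine ⟨max C δ⁻¹, fun n => ?_⟩
  by_cases hn : |(n : ℝ) + p| < 1
  · exact (hC ⟨n, hn, rfl⟩).trans (le_max_left _ _)
  · refine le_trans ?_ (le_max_right _ _)
    rw [norm_inv]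
    apply inv_anti₀ hδ
    have h1 := norm_exp_lattice n p r τ
    set X := Complex.exp (2 * Real.pi * Complex.I * n * τ + 2 * Real.pi * Complex.I * (p * τ + r))
    have hpy : 0 < Real.pi * τ.im := by positivity
    rcases le_abs.mp (not_lt.mp hn) with h | h
    · have h2 : ‖X‖ ≤ Real.exp (-2 * Real.pi * τ.im) := by
        rw [h1, Real.exp_le_exp]
        nlinarith
      have h3 := norm_sub_norm_le 1 X
      rw [norm_one] at h3
      linarith
    · have h2 : Real.exp (2 * Real.pi * τ.im) ≤ ‖X‖ := by
        rw [h1, Real.exp_le_exp]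
        nlinarith
      have h3 := norm_sub_norm_le X 1
      rw [norm_one, norm_sub_rev] at h3
      have h4 := Real.add_one_le_exp (2 * Real.pi * τ.im)
      have h5 := Real.add_one_le_exp (-2 * Real.pi * τ.im)
      have h6 : δ ≤ 2 * Real.pi * τ.im := by
        simp only [δ]
        linarith
      linarith

open Complex in
lemma exp_appell_eq_jacobiTheta₂_term (n : ℤ) (v τ : ℂ) :
    exp (Real.pi * I * n * (n + 1) * τ + 2 * Real.pi * I * n * v) =
      jacobiTheta₂_term n (v + τ / 2) τ := by
  rw [jacobiTheta₂_term]
  congr 1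
  ring

lemma summable_zwAppell (u v : ℂ) {τ : ℂ} (hτ : 0 < τ.im) : Summable fun n : ℤ => (-1 : ℂ) ^ n *
    Complex.exp (Real.pi * Complex.I * n * (n + 1) * τ + 2 * Real.pi * Complex.I * n * v) /
      (1 - Complex.exp (2 * Real.pi * Complex.I * n * τ + 2 * Real.pi * Complex.I * u)) := by
  obtain ⟨C, hC⟩ := exists_bound_inv_one_sub_exp u hτ
  refine Summable.of_norm_bounded
    (((summable_jacobiTheta₂_term_iff (v + τ / 2) τ).mpr hτ).norm.mul_right C) fun n => ?_
  rw [div_eq_mul_inv, norm_mul, norm_mul, norm_neg_one_zpow, one_mul,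
    exp_appell_eq_jacobiTheta₂_term]
  exact mul_le_mul_of_nonneg_left (hC n) (norm_nonneg _)

lemma differentiable_zwAppell (u : ℂ) {τ : ℂ} (hτ : 0 < τ.im) :
    Differentiable ℂ fun v => zwAppell u v τ := by
  intro v₀
  obtain ⟨C, hC⟩ := exists_bound_inv_one_sub_exp u hτ
  have hC0 : 0 ≤ C := (norm_nonneg _).trans (hC 0)
  refine DifferentiableAt.const_mul ?_ _
  have hs := (summable_pow_mul_jacobiTheta₂_term_bound (‖v₀‖ + 1 + τ.im) hτ 0).mul_right C
  refine (DifferentiableOn.differentiableAt (s := Metric.ball (0 : ℂ) (‖v₀‖ + 1))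
    (Complex.differentiableOn_tsum_of_summable_norm hs (fun n => ?_) Metric.isOpen_ball ?_)
    (Metric.isOpen_ball.mem_nhds ?_))
  · exact Differentiable.differentiableOn (by fun_prop)
  · intro n v hv
    rw [mem_ball_zero_iff] at hv
    rw [div_eq_mul_inv, norm_mul, norm_mul, norm_neg_one_zpow, one_mul,
      exp_appell_eq_jacobiTheta₂_term, pow_zero, one_mul]
    refine mul_le_mul (norm_jacobiTheta₂_term_le hτ ?_ le_rfl n) (hC n) (norm_nonneg _)
      (Real.exp_pos _).le
    rw [show (v + τ / 2).im = v.im + τ.im / 2 by simp]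
    refine (abs_add_le _ _).trans ?_
    rw [abs_of_pos (half_pos hτ)]
    have := Complex.abs_im_le_norm v
    linarith
  · rw [mem_ball_zero_iff]
    linarith

open Complex in
-- The Appell sum without its denominators. It appears as the defect whenever a shift by τ lets a
-- numerator cancel the denominator.
lemma hasSum_zwAppell_theta (v : ℂ) {τ : ℂ} (hτ : 0 < τ.im) :
    HasSum (fun n : ℤ => (-1 : ℂ) ^ n *
      exp (Real.pi * I * n * (n + 1) * τ + 2 * Real.pi * I * n * v))
      (-I * exp (-Real.pi * I * τ / 4 - Real.pi * I * v) * zwTheta v τ) := by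
  refine ((hasSum_zwTheta v hτ).mul_left _).congr_fun fun n => ?_
  have hI : (-I : ℂ) = exp (-Real.pi / 2 * I) := exp_neg_pi_div_two_mul_I.symm
  rw [← exp_pi_mul_I_mul_int, hI, ← exp_add, ← exp_add, ← exp_add]
  congr 1
  ring

open Complex in
lemma zwAppell_add_one_right (u v τ : ℂ) : zwAppell u (v + 1) τ = zwAppell u v τ := by
  rw [zwAppell, zwAppell]
  congr 1
  refine tsum_congr fun n => ?_
  congr 2
  rw [exp_eq_exp_iff_exists_int]
  exact ⟨n, by ring⟩

open Complex in
-- With X = e^{2πinτ+2πiu}, the shift multiplies the n-th term by e^{-2πiu}X, and X/(1-X) = 1/(1-X)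
-- - 1.
lemma zwAppell_add_period_right {u v τ : ℂ} (hτ : 0 < τ.im) (hu : OffLattice u τ) :
    zwAppell u (v + τ) τ = exp (-2 * Real.pi * I * u) * zwAppell u v τ +
      I * exp (-Real.pi * I * u - Real.pi * I * τ / 4 - Real.pi * I * v) * zwTheta v τ := by
  have h := (((summable_zwAppell u v hτ).hasSum.sub (hasSum_zwAppell_theta v hτ)).mul_left
    (exp (-2 * Real.pi * I * u))).tsum_eq
  have e : ∑' n : ℤ, (-1 : ℂ) ^ n *
      exp (Real.pi * I * n * (n + 1) * τ + 2 * Real.pi * I * n * (v + τ)) /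
      (1 - exp (2 * Real.pi * I * n * τ + 2 * Real.pi * I * u)) =
      ∑' n : ℤ, exp (-2 * Real.pi * I * u) * ((-1 : ℂ) ^ n *
      exp (Real.pi * I * n * (n + 1) * τ + 2 * Real.pi * I * n * v) /
      (1 - exp (2 * Real.pi * I * n * τ + 2 * Real.pi * I * u)) - (-1 : ℂ) ^ n *
      exp (Real.pi * I * n * (n + 1) * τ + 2 * Real.pi * I * n * v)) := by
    refine tsum_congr fun n => ?_
    have hn : 1 - exp (2 * Real.pi * I * n * τ + 2 * Real.pi * I * u) ≠ 0 :=
      sub_ne_zero.mpr (hu n).symm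
    have h1 : exp (Real.pi * I * n * (n + 1) * τ + 2 * Real.pi * I * n * (v + τ)) =
        exp (-2 * Real.pi * I * u) * (exp (2 * Real.pi * I * n * τ + 2 * Real.pi * I * u) *
        exp (Real.pi * I * n * (n + 1) * τ + 2 * Real.pi * I * n * v)) := by
      rw [← exp_add, ← exp_add]
      congr 1
      ring
    rw [h1]
    generalize exp (2 * Real.pi * I * n * τ + 2 * Real.pi * I * u) = X at hn
    field_simp
    ring
  have h2 : exp (-Real.pi * I * u - Real.pi * I * τ / 4 - Real.pi * I * v) =
      exp (Real.pi * I * u) * (exp (-2 * Real.pi * I * u) * exp (-Real.pi * I * τ / 4 - Real.pi * I * v)) := by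
    rw [← exp_add, ← exp_add]
    congr 1
    ring
  rw [zwAppell, zwAppell, e, h, h2]
  ring

open Complex in
lemma zwAppell_add_one_left (u v τ : ℂ) : zwAppell (u + 1) v τ = -zwAppell u v τ := by
  rw [zwAppell, zwAppell, ← neg_mul]
  congr 1
  · rw [← neg_one_mul (exp _), ← exp_pi_mul_I, ← exp_add]
    congr 1
    ring
  · refine tsum_congr fun n => ?_
    congr 2
    rw [exp_eq_exp_iff_exists_int]
    exact ⟨1, by push_cast; ring⟩

open Complex in
-- The shift moves the denominator to index n+1. The numerators of indices n and n+1 differ by a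
-- factor proportional to X, so 1/(1-X) = 1 + X/(1-X) splits off a theta series.
lemma zwAppell_add_period_left {u v τ : ℂ} (hτ : 0 < τ.im) (hu : OffLattice u τ) :
    zwAppell (u + τ) v τ = -exp (2 * Real.pi * I * (u - v) + Real.pi * I * τ) * zwAppell u v τ -
      I * exp (Real.pi * I * u + 3 * Real.pi * I * τ / 4 - Real.pi * I * v) * zwTheta v τ := by
  have h1 := (Equiv.addRight (1 : ℤ)).hasSum_iff.mpr (summable_zwAppell u v hτ).hasSum
  have h := ((hasSum_zwAppell_theta v hτ).sub (h1.mul_left (exp (2 * Real.pi * I * (u - v))))).tsum_eq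
  have e : ∀ n : ℤ, (-1 : ℂ) ^ n *
      exp (Real.pi * I * n * (n + 1) * τ + 2 * Real.pi * I * n * v) /
      (1 - exp (2 * Real.pi * I * n * τ + 2 * Real.pi * I * (u + τ))) =
      (-1 : ℂ) ^ n * exp (Real.pi * I * n * (n + 1) * τ + 2 * Real.pi * I * n * v) -
      exp (2 * Real.pi * I * (u - v)) * ((-1 : ℂ) ^ (n + 1) *
      exp (Real.pi * I * (n + 1 : ℤ) * ((n + 1 : ℤ) + 1) * τ + 2 * Real.pi * I * (n + 1 : ℤ) * v) /
      (1 - exp (2 * Real.pi * I * (n + 1 : ℤ) * τ + 2 * Real.pi * I * u))) := by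
    intro n
    have hn : 1 - exp (2 * Real.pi * I * (n + 1 : ℤ) * τ + 2 * Real.pi * I * u) ≠ 0 :=
      sub_ne_zero.mpr (hu (n + 1)).symm
    have h2 : exp (2 * Real.pi * I * n * τ + 2 * Real.pi * I * (u + τ)) =
        exp (2 * Real.pi * I * (n + 1 : ℤ) * τ + 2 * Real.pi * I * u) := by
      congr 1
      push_cast
      ring
    have h3 : exp (2 * Real.pi * I * (u - v)) * exp (Real.pi * I * (n + 1 : ℤ) * ((n + 1 : ℤ) + 1) * τ +
        2 * Real.pi * I * (n + 1 : ℤ) * v) =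
        exp (Real.pi * I * n * (n + 1) * τ + 2 * Real.pi * I * n * v) *
          exp (2 * Real.pi * I * (n + 1 : ℤ) * τ + 2 * Real.pi * I * u) := by
      rw [← exp_add, ← exp_add]
      congr 1
      push_cast
      ring
    rw [h2, mul_div_assoc', mul_left_comm, h3, zpow_add_one₀ (by norm_num)]
    generalize exp (2 * Real.pi * I * (n + 1 : ℤ) * τ + 2 * Real.pi * I * u) = X at hn
    field_simp
    ring
  have h2 : exp (Real.pi * I * (u + τ)) * exp (-Real.pi * I * τ / 4 - Real.pi * I * v) =
      exp (Real.pi * I * u + 3 * Real.pi * I * τ / 4 - Real.pi * I * v) := by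
    rw [← exp_add]
    congr 1
    ring
  have h3 : exp (Real.pi * I * (u + τ)) * exp (2 * Real.pi * I * (u - v)) =
      exp (2 * Real.pi * I * (u - v) + Real.pi * I * τ) * exp (Real.pi * I * u) := by
    rw [← exp_add, ← exp_add]
    congr 1
    ring
  rw [zwAppell, zwAppell, (tsum_congr e).trans h, ← h2, mul_sub, ← mul_assoc _ (exp _) (tsum _), h3]
  ring

/-! ### Quasi-periodicity of the completed numerator. -/

lemma zwNum_add_one_right (u v τ : ℂ) : zwNum u (v + 1) τ = zwNum u v τ := by
  have := zwR_add_one (u - (v + 1)) τ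
  rw [show u - (v + 1) + 1 = u - v by ring] at this
  rw [zwNum, zwNum, zwAppell_add_one_right, zwTheta_add_one, this]
  ring

open Complex in
-- The theta defect of the Appell sum cancels the inhomogeneous term of R; this is the purpose of
-- the completion.
lemma zwNum_add_period_right {u v τ : ℂ} (hτ : 0 < τ.im) (hu : OffLattice u τ) :
    zwNum u (v + τ) τ = exp (-2 * Real.pi * I * u) * zwNum u v τ := by
  have h := zwR_add_period (u - (v + τ)) hτ
  rw [show u - (v + τ) + τ = u - v by ring] at h
  have e1 : exp (-Real.pi * I * τ - 2 * Real.pi * I * v) =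
      exp (-2 * Real.pi * I * u) * exp (2 * Real.pi * I * (u - (v + τ)) + Real.pi * I * τ) := by
    rw [← exp_add]
    congr 1
    ring
  have e2 : exp (-Real.pi * I * u - Real.pi * I * τ / 4 - Real.pi * I * v) =
      exp (-2 * Real.pi * I * u) * exp (Real.pi * I * (u - (v + τ)) + 3 * Real.pi * I * τ / 4) := by
    rw [← exp_add]
    congr 1
    ring
  rw [zwNum, zwNum, zwAppell_add_period_right hτ hu, zwTheta_add_period, e1, e2, h]
  ring

open Complex in
lemma zwNum_add_period_left {u v τ : ℂ} (hτ : 0 < τ.im) (hu : OffLattice u τ) :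
    zwNum (u + τ) v τ = -exp (2 * Real.pi * I * (u - v) + Real.pi * I * τ) * zwNum u v τ := by
  have e : exp (Real.pi * I * u + 3 * Real.pi * I * τ / 4 - Real.pi * I * v) =
      exp (Real.pi * I * (u - v) + 3 * Real.pi * I * τ / 4) := by
    congr 1
    ring
  rw [zwNum, zwNum, zwAppell_add_period_left hτ hu, show u + τ - v = u - v + τ by ring,
    zwR_add_period _ hτ, e]
  ring

open Complex in
lemma zwAppell_modular_add_one (u v τ : ℂ) : zwAppell u v (τ + 1) = zwAppell u v τ := by
  rw [zwAppell, zwAppell]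
  congr 1
  refine tsum_congr fun n => ?_
  have h1 : exp (Real.pi * I * n * (n + 1) * (τ + 1) + 2 * Real.pi * I * n * v) =
      exp (Real.pi * I * n * (n + 1) * τ + 2 * Real.pi * I * n * v) := by
    rw [exp_eq_exp_iff_exists_int]
    obtain ⟨k, hk⟩ := Int.even_mul_succ_self n
    refine ⟨k, ?_⟩
    have hk' : (n : ℂ) * (n + 1) = k + k := by exact_mod_cast hk
    linear_combination (Real.pi * I) * hk'
  have h2 : exp (2 * Real.pi * I * n * (τ + 1) + 2 * Real.pi * I * u) =
      exp (2 * Real.pi * I * n * τ + 2 * Real.pi * I * u) := by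
    rw [exp_eq_exp_iff_exists_int]
    exact ⟨n, by ring⟩
  rw [h1, h2]

open Complex in
lemma zwNum_modular_add_one (u v τ : ℂ) : zwNum u v (τ + 1) = zwNum u v τ := by
  have h : exp (Real.pi * I / 4) * exp (-Real.pi * I / 4) = 1 := by
    rw [← exp_add, ← exp_zero]
    congr 1
    ring
  rw [zwNum, zwNum, zwAppell_modular_add_one, zwTheta_modular_add_one, zwR_modular_add_one]
  linear_combination (I / 2 * (zwTheta v τ * zwR (u - v) τ)) * h

/-! ### Inversion -/

lemma offLattice_iff {p r : ℝ} {τ : ℂ} (hτ : 0 < τ.im) :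
    OffLattice (p * τ + r) τ ↔ ¬∃ k l : ℤ, p = k ∧ r = l := by
  have hpi := Complex.two_pi_I_ne_zero
  constructor
  · rintro h ⟨k, l, rfl, rfl⟩
    apply h (-k)
    rw [Complex.exp_eq_one_iff]
    exact ⟨l, by push_cast; ring⟩
  · intro h n hn
    rw [Complex.exp_eq_one_iff] at hn
    obtain ⟨l, hl⟩ := hn
    apply h
    have h1 : ((n + p : ℝ) : ℂ) * τ + (r : ℂ) = ((l : ℝ) : ℂ) := by
      apply mul_left_cancel₀ hpi
      push_cast
      linear_combination hl
    have h2 := congrArg Complex.im h1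
    have h3 := congrArg Complex.re h1
    simp only [Complex.add_im, Complex.im_ofReal_mul, Complex.ofReal_im, add_zero] at h2
    have h4 : n + p = 0 := by
      rcases mul_eq_zero.mp h2 with h | h
      · exact h
      · exact absurd h hτ.ne'
    rw [h4] at h3
    simp at h3
    exact ⟨-n, l, by push_cast; linarith, h3⟩

lemma fract_lattice_point (v : ℂ) {τ : ℂ} (hτ : 0 < τ.im) :
    ∃ (k l : ℤ) (s t : ℝ), s ∈ Set.Icc (0 : ℝ) 1 ∧ t ∈ Set.Icc (0 : ℝ) 1 ∧
      v = s * τ + t + k * τ + l := by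
  obtain ⟨s, t, rfl⟩ := exists_real_coords v hτ
  refine ⟨⌊s⌋, ⌊t⌋, Int.fract s, Int.fract t, ⟨Int.fract_nonneg _, (Int.fract_lt_one _).le⟩,
    ⟨Int.fract_nonneg _, (Int.fract_lt_one _).le⟩, ?_⟩
  have h1 : (s : ℂ) = Int.fract s + ⌊s⌋ := by exact_mod_cast (Int.fract_add_floor s).symm
  have h2 : (t : ℂ) = Int.fract t + ⌊t⌋ := by exact_mod_cast (Int.fract_add_floor t).symm
  linear_combination τ * h1 + h2

open Complex in
/-- An entire function with multipliers `1` and `e^{-2πiu}` vanishes unless `u` lies in the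
lattice. -/
lemma eq_zero_of_multipliers {Q : ℂ → ℂ} {u τ : ℂ} (hτ : 0 < τ.im) (hu : OffLattice u τ)
    (hQ : Differentiable ℂ Q) (h1 : ∀ v, Q (v + 1) = Q v)
    (h2 : ∀ v, Q (v + τ) = exp (-2 * Real.pi * I * u) * Q v) (v : ℂ) : Q v = 0 := by
  obtain ⟨p, r, rfl⟩ := exists_real_coords u hτ
  -- For u = pτ+r with p, r real, this factor changes the multipliers to e^{2πip} and e^{-2πir},
  -- both of modulus 1. Hence |G| is doubly periodic, and G is bounded.
  set G : ℂ → ℂ := fun v => exp (2 * Real.pi * I * p * v) * Q v with hG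
  have hGd : Differentiable ℂ G := by fun_prop
  have g1 : ∀ v, G (v + 1) = exp (2 * Real.pi * I * p) * G v := fun v => by
    simp only [hG, h1]
    rw [← mul_assoc, ← exp_add]
    congr 2
    ring
  have g2 : ∀ v, G (v + τ) = exp (-2 * Real.pi * I * r) * G v := fun v => by
    simp only [hG, h2]
    rw [← mul_assoc, ← mul_assoc, ← exp_add, ← exp_add]
    congr 2
    ring
  have n1 : ∀ v, ‖G (v + 1)‖ = ‖G v‖ := fun v => by
    rw [g1, norm_mul, show 2 * Real.pi * I * p = ((2 * Real.pi * p : ℝ) : ℂ) * I by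
      push_cast; ring, norm_exp_ofReal_mul_I, one_mul]
  have n2 : ∀ v, ‖G (v + τ)‖ = ‖G v‖ := fun v => by
    rw [g2, norm_mul, show -2 * Real.pi * I * r = ((-2 * Real.pi * r : ℝ) : ℂ) * I by
      push_cast; ring, norm_exp_ofReal_mul_I, one_mul]
  have n1' : ∀ (l : ℤ) v, ‖G (v + l)‖ = ‖G v‖ := fun l v => by
    have hp : Function.Periodic (fun v => ‖G v‖) (1 : ℂ) := n1
    have := hp.int_mul l v
    simpa using this
  have n2' : ∀ (l : ℤ) v, ‖G (v + l * τ)‖ = ‖G v‖ := fun l v => by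
    have hp : Function.Periodic (fun v => ‖G v‖) τ := n2
    exact hp.int_mul l v
  have hK : IsCompact ((fun x : ℝ × ℝ => G (x.1 * τ + x.2)) '' (Set.Icc 0 1 ×ˢ Set.Icc 0 1)) := by
    refine (isCompact_Icc.prod isCompact_Icc).image ?_
    exact hGd.continuous.comp (by fun_prop)
  obtain ⟨C, hC⟩ := hK.isBounded.exists_norm_le
  have hb : Bornology.IsBounded (Set.range G) := by
    rw [isBounded_iff_forall_norm_le]
    refine ⟨C, ?_⟩
    rintro _ ⟨v, rfl⟩
    obtain ⟨k, l, s, t, hs, ht, rfl⟩ := fract_lattice_point v hτ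
    rw [n1', n2']
    exact hC _ ⟨(s, t), ⟨hs, ht⟩, rfl⟩
  -- By Liouville G is constant. A nonzero constant would force both multipliers to be 1, so p and r
  -- would be integers.
  have hconst := fun v w => hGd.apply_eq_apply_of_bounded hb v w
  by_contra hne
  have hGv : G v ≠ 0 := mul_ne_zero (exp_ne_zero _) hne
  have e1 : exp (2 * Real.pi * I * p) = 1 := by
    have := g1 v
    rw [hconst (v + 1) v] at this
    exact (mul_eq_right₀ hGv).mp this.symm
  have e2 : exp (-2 * Real.pi * I * r) = 1 := by
    have := g2 v
    rw [hconst (v + τ) v] at this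
    exact (mul_eq_right₀ hGv).mp this.symm
  rw [exp_eq_one_iff] at e1 e2
  obtain ⟨k, hk⟩ := e1
  obtain ⟨l, hl⟩ := e2
  refine (offLattice_iff hτ).mp hu ⟨k, -l, ?_, ?_⟩
  · have : (p : ℂ) = (k : ℂ) := mul_left_cancel₀ two_pi_I_ne_zero (by linear_combination hk)
    exact_mod_cast this
  · have : (r : ℂ) = -(l : ℂ) := mul_left_cancel₀ two_pi_I_ne_zero (by linear_combination -hl)
    exact_mod_cast this

open Complex in
-- With u fixed, the difference of the two sides is an entire function of v with multipliers 1 and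
-- e^{-2πiu}, hence zero.
lemma zwNum_inversion {u : ℂ} (v : ℂ) {τ : ℂ} (hτ : 0 < τ.im) (hu : OffLattice u τ) :
    zwNum (u / τ) (v / τ) (-1 / τ) =
      τ * exp (-Real.pi * I * (u ^ 2 - 2 * u * v) / τ) * zwNum u v τ := by
  have h0 : τ ≠ 0 := by rintro rfl; simp at hτ
  have hτ' := im_neg_one_div_pos hτ
  have hu' : OffLattice (u / τ) (-1 / τ) := by
    obtain ⟨p, r, rfl⟩ := exists_real_coords u hτ
    rw [show (p * τ + r) / τ = ((-r : ℝ) : ℂ) * (-1 / τ) + p by push_cast; field_simp; ring,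
      offLattice_iff hτ']
    rw [offLattice_iff hτ] at hu
    rintro ⟨k, l, hk, hl⟩
    exact hu ⟨l, -k, hl, by push_cast; linarith⟩
  set w : ℂ := (-I * τ) ^ (1 / 2 : ℂ) with hw
  have hw2 : w * w = -I * τ := by
    rw [hw, ← sq, ← cpow_nat_mul]
    norm_num
  have hw0 : w ≠ 0 := fun h => by
    rw [h, mul_zero] at hw2
    simp [h0] at hw2
  set Q : ℂ → ℂ := fun v => zwNum u v τ - 1 / τ * exp (Real.pi * I * (u ^ 2 - 2 * u * v) / τ) *
    zwNum (u / τ) (v / τ) (-1 / τ) with hQ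
  -- Theta inversion lets the two R terms combine into `zwRInvSum`, so that every summand is entire
  -- in v.
  have hQ' : Q = fun v => zwAppell u v τ + I / 2 * (zwTheta v τ * zwRInvSum (u - v) τ) -
      1 / τ * exp (Real.pi * I * (u ^ 2 - 2 * u * v) / τ) * zwAppell (u / τ) (v / τ) (-1 / τ) := by
    funext v
    have e : exp (Real.pi * I * (u - v) ^ 2 / τ) =
        exp (Real.pi * I * (u ^ 2 - 2 * u * v) / τ) * exp (Real.pi * I * v ^ 2 / τ) := by
      rw [← exp_add]
      congr 1
      ring
    simp only [hQ, zwNum, zwRInvSum]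
    rw [zwTheta_inversion v hτ, ← hw, e, ← sub_div]
    generalize exp (Real.pi * I * (u ^ 2 - 2 * u * v) / τ) = E₁
    generalize exp (Real.pi * I * v ^ 2 / τ) = E₂
    generalize zwR ((u - v) / τ) (-1 / τ) = R'
    generalize zwAppell (u / τ) (v / τ) (-1 / τ) = A'
    field_simp
    linear_combination (E₁ * E₂ * R' * zwTheta v τ * I ^ 2) * hw2 -
      (E₁ * E₂ * R' * zwTheta v τ * τ * I) * I_sq
  have hdiff : Differentiable ℂ Q := by
    rw [hQ']
    have d1 := differentiable_zwAppell u hτ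
    have d2 := differentiable_zwTheta hτ
    have d3 : Differentiable ℂ fun v => zwRInvSum (u - v) τ :=
      (differentiable_zwRInvSum hτ).comp (by fun_prop)
    have d4 : Differentiable ℂ fun v => zwAppell (u / τ) (v / τ) (-1 / τ) :=
      (differentiable_zwAppell (u / τ) hτ').comp (by fun_prop)
    fun_prop
  have hper := eq_zero_of_multipliers hτ hu hdiff (fun v => ?_) (fun v => ?_) v
  · simp only [hQ] at hper
    have e : exp (-Real.pi * I * (u ^ 2 - 2 * u * v) / τ) * exp (Real.pi * I * (u ^ 2 - 2 * u * v) / τ)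
        = 1 := by
      rw [← exp_add, ← exp_zero]
      congr 1
      ring
    rw [sub_eq_zero.mp hper]
    generalize exp (-Real.pi * I * (u ^ 2 - 2 * u * v) / τ) = E₁ at e
    generalize exp (Real.pi * I * (u ^ 2 - 2 * u * v) / τ) = E₂ at e
    generalize zwNum (u / τ) (v / τ) (-1 / τ) = A'
    field_simp
    linear_combination -A' * e
  · have h := zwNum_add_period_right (v := (v + 1) / τ) hτ' hu'
    rw [show (v + 1) / τ + -1 / τ = v / τ by ring] at h
    have e : exp (Real.pi * I * (u ^ 2 - 2 * u * (v + 1)) / τ) =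
        exp (Real.pi * I * (u ^ 2 - 2 * u * v) / τ) * exp (-2 * Real.pi * I * (u / τ)) := by
      rw [← exp_add]
      congr 1
      ring
    simp only [hQ]
    rw [zwNum_add_one_right, h, e]
    ring
  · have e : exp (Real.pi * I * (u ^ 2 - 2 * u * (v + τ)) / τ) =
        exp (-2 * Real.pi * I * u) * exp (Real.pi * I * (u ^ 2 - 2 * u * v) / τ) := by
      rw [← exp_add]
      congr 1
      field_simp
      ring
    simp only [hQ]
    rw [zwNum_add_period_right hτ hu, e, show (v + τ) / τ = v / τ + 1 by field_simp,
      zwNum_add_one_right]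
    ring

/-! ### The functions `μ̃` at points with fixed real coordinates -/

/-- `μ̃(pτ+r, sτ+t; τ)`, normalised so that `SL₂(ℤ)` acts without exponential factors. -/
def zwF (p r s t : ℝ) (τ : ℂ) : ℂ :=
  Complex.exp (-Real.pi * Complex.I * (p - s) * ((p - s) * τ + (r - t))) *
    zwMuTilde (p * τ + r) (s * τ + t) τ

/-- `(p, r) ∉ ℤ²`. -/
def NonIntegral (p r : ℝ) : Prop := ¬∃ k l : ℤ, p = k ∧ r = l

/-- `(s, t) ∈ (½ℤ)² ∖ ℤ²`. -/
def IsHalfPoint (s t : ℝ) : Prop := NonIntegral s t ∧ ∃ k l : ℤ, s = k / 2 ∧ t = l / 2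

lemma zwTheta_ne_zero_of_isHalfPoint {s t : ℝ} (h : IsHalfPoint s t) {τ : ℂ} (hτ : 0 < τ.im) :
    zwTheta (s * τ + t) τ ≠ 0 := by
  obtain ⟨hn, k, l, rfl, rfl⟩ := h
  refine zwTheta_half_ne_zero hτ ?_
  rintro ⟨⟨i, rfl⟩, ⟨j, rfl⟩⟩
  exact hn ⟨i, j, by push_cast; ring, by push_cast; ring⟩

lemma zwF_eq {p r s t : ℝ} (h : IsHalfPoint s t) {τ : ℂ} (hτ : 0 < τ.im) :
    zwF p r s t τ = Complex.exp (-Real.pi * Complex.I * (p - s) * ((p - s) * τ + (r - t))) *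
      (zwNum (p * τ + r) (s * τ + t) τ / zwTheta (s * τ + t) τ) := by
  rw [zwF, zwMuTilde_eq_zwNum_div _ (zwTheta_ne_zero_of_isHalfPoint h hτ)]

lemma NonIntegral.add_int_left {p r : ℝ} (h : NonIntegral p r) (k : ℤ) : NonIntegral (p + k) r := by
  rintro ⟨i, j, hi, hj⟩
  exact h ⟨i - k, j, by push_cast; linarith, hj⟩

lemma IsHalfPoint.add_int_left {s t : ℝ} (h : IsHalfPoint s t) (k : ℤ) : IsHalfPoint (s + k) t := by
  obtain ⟨hn, i, j, rfl, rfl⟩ := h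
  exact ⟨hn.add_int_left k, i + 2 * k, j, by push_cast; ring, rfl⟩

open Complex in
lemma zwF_add_one_fst {p r s t : ℝ} (hp : NonIntegral p r) (hs : IsHalfPoint s t) {τ : ℂ}
    (hτ : 0 < τ.im) : zwF (p + 1) r s t τ = -exp (Real.pi * I * (r - t)) * zwF p r s t τ := by
  have hu : OffLattice (p * τ + r) τ := (offLattice_iff hτ).mpr hp
  have e : exp (-Real.pi * I * ((p + 1 : ℝ) - s) * (((p + 1 : ℝ) - s) * τ + (r - t))) *
      exp (2 * Real.pi * I * (p * τ + r - (s * τ + t)) + Real.pi * I * τ) =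
      exp (Real.pi * I * (r - t)) * exp (-Real.pi * I * (p - s) * ((p - s) * τ + (r - t))) := by
    rw [← exp_add, ← exp_add]
    congr 1
    push_cast
    ring
  rw [zwF_eq hs hτ, zwF_eq hs hτ, show ((p + 1 : ℝ) : ℂ) * τ + r = p * τ + r + τ by push_cast; ring,
    zwNum_add_period_left hτ hu]
  linear_combination -(zwNum (p * τ + r) (s * τ + t) τ / zwTheta (s * τ + t) τ) * e

open Complex in
lemma zwF_add_one_snd {p r s t : ℝ} (hp : NonIntegral p r) (hs : IsHalfPoint s t) {τ : ℂ}
    (hτ : 0 < τ.im) : zwF p r (s + 1) t τ = -exp (-Real.pi * I * (r - t)) * zwF p r s t τ := by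
  have hu : OffLattice (p * τ + r) τ := (offLattice_iff hτ).mpr hp
  have e : exp (-Real.pi * I * (p - (s + 1 : ℝ)) * ((p - (s + 1 : ℝ)) * τ + (r - t))) *
      exp (-2 * Real.pi * I * (p * τ + r)) =
      exp (-Real.pi * I * (r - t)) * exp (-Real.pi * I * (p - s) * ((p - s) * τ + (r - t))) *
        exp (-Real.pi * I * τ - 2 * Real.pi * I * (s * τ + t)) := by
    rw [← exp_add, ← exp_add, ← exp_add]
    congr 1
    push_cast
    ring
  have hs' : IsHalfPoint (s + 1) t := by simpa using hs.add_int_left 1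
  have hθ := zwTheta_ne_zero_of_isHalfPoint hs hτ
  rw [zwF_eq hs' hτ, zwF_eq hs hτ, show ((s + 1 : ℝ) : ℂ) * τ + t = s * τ + t + τ by push_cast; ring,
    zwNum_add_period_right hτ hu, zwTheta_add_period]
  have alg : ∀ E' e₁ N X θ c E : ℂ, X ≠ 0 → θ ≠ 0 → E' * e₁ = c * E * X →
      E' * (e₁ * N / (-X * θ)) = -c * (E * (N / θ)) := by
    intro E' e₁ N X θ c E hX hθ h
    field_simp
    linear_combination -N * h
  exact alg _ _ _ _ _ _ _ (exp_ne_zero _) hθ e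

/-- The normalising exponential absorbs the τ-dependence of the elliptic factors, so the constant is
uniform in τ. This permits reducing p and s modulo 1 without changing orders. -/
lemma exists_zwF_add_int {p r s t : ℝ} (hp : NonIntegral p r) (hs : IsHalfPoint s t) (k l : ℤ) :
    ∃ ζ : ℂ, ζ ≠ 0 ∧ ∀ τ : ℂ, 0 < τ.im → zwF (p + k) r (s + l) t τ = ζ * zwF p r s t τ := by
  have h1 : ∀ (k : ℤ) (τ : ℂ), 0 < τ.im → zwF (p + k) r s t τ =
      (-Complex.exp (Real.pi * Complex.I * (r - t))) ^ k * zwF p r s t τ := by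
    intro k τ hτ
    have hne : -Complex.exp (Real.pi * Complex.I * (r - t)) ≠ 0 := neg_ne_zero.mpr (Complex.exp_ne_zero _)
    induction k with
    | zero => simp
    | succ n ih =>
      have h := zwF_add_one_fst (hp.add_int_left n) hs hτ
      rw [ih, add_assoc] at h
      push_cast at h ⊢
      rw [h, zpow_add_one₀ hne]
      ring
    | pred n ih =>
      have h := zwF_add_one_fst (hp.add_int_left (-n - 1)) hs hτ
      rw [add_assoc, show (((-n - 1 : ℤ) : ℝ) + 1) = ((-n : ℤ) : ℝ) by push_cast; ring, ih] at h
      rw [zpow_sub_one₀ hne, mul_right_comm, h]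
      field_simp
  have h2 : ∀ (p' : ℝ), NonIntegral p' r → ∀ (l : ℤ) (τ : ℂ), 0 < τ.im → zwF p' r (s + l) t τ =
      (-Complex.exp (-Real.pi * Complex.I * (r - t))) ^ l * zwF p' r s t τ := by
    intro p' hp' l τ hτ
    have hne : -Complex.exp (-Real.pi * Complex.I * (r - t)) ≠ 0 :=
      neg_ne_zero.mpr (Complex.exp_ne_zero _)
    induction l with
    | zero => simp
    | succ n ih =>
      have h := zwF_add_one_snd hp' (hs.add_int_left n) hτ
      rw [ih, add_assoc] at h
      push_cast at h ⊢
      rw [h, zpow_add_one₀ hne]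
      ring
    | pred n ih =>
      have h := zwF_add_one_snd hp' (hs.add_int_left (-n - 1)) hτ
      rw [add_assoc, show (((-n - 1 : ℤ) : ℝ) + 1) = ((-n : ℤ) : ℝ) by push_cast; ring, ih] at h
      rw [zpow_sub_one₀ hne, mul_right_comm, h]
      field_simp
  refine ⟨_, mul_ne_zero (zpow_ne_zero l (neg_ne_zero.mpr (Complex.exp_ne_zero
    (-Real.pi * Complex.I * (r - t))))) (zpow_ne_zero k (neg_ne_zero.mpr (Complex.exp_ne_zero
    (Real.pi * Complex.I * (r - t))))), fun τ hτ => ?_⟩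
  rw [h2 _ (hp.add_int_left k) l τ hτ, h1 k τ hτ]
  ring

open Complex in
lemma zwF_modular_add_one {p r s t : ℝ} (hs : IsHalfPoint s t) (hs' : IsHalfPoint s (s + t)) {τ : ℂ}
    (hτ : 0 < τ.im) :
    zwF p r s t (τ + 1) = exp (-Real.pi * I / 4) * zwF p (p + r) s (s + t) τ := by
  have hτ1 : 0 < (τ + 1).im := by simpa using hτ
  have e : exp (-Real.pi * I / 4) * exp (Real.pi * I / 4) = 1 := by
    rw [← exp_add, ← exp_zero]
    congr 1
    ring
  have e2 : exp (-Real.pi * I * (p - s) * ((p - s) * (τ + 1) + (r - t))) =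
      exp (-Real.pi * I * (p - s) * ((p - s) * τ + ((p + r : ℝ) - (s + t : ℝ)))) := by
    congr 1
    push_cast
    ring
  have hθ := zwTheta_ne_zero_of_isHalfPoint hs' hτ
  rw [zwF_eq hs hτ1, zwF_eq hs' hτ,
    show (p : ℂ) * (τ + 1) + r = p * τ + (p + r : ℝ) by push_cast; ring,
    show (s : ℂ) * (τ + 1) + t = s * τ + (s + t : ℝ) by push_cast; ring, zwNum_modular_add_one,
    zwTheta_modular_add_one, e2]
  have hE := exp_ne_zero (Real.pi * I / 4)
  rw [mul_div_assoc', mul_div_assoc', mul_div_assoc', div_eq_div_iff (mul_ne_zero hE hθ) hθ]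
  linear_combination (-exp (-Real.pi * I * (p - s) * ((p - s) * τ + ((p + r : ℝ) - (s + t : ℝ)))) *
    zwNum (p * τ + (p + r : ℝ)) (s * τ + (s + t : ℝ)) τ * zwTheta (s * τ + (s + t : ℝ)) τ) * e

open Complex in
-- The numerator has weight 1 and ϑ weight 1/2; the exponentials from both inversion laws recombine
-- into the normalising factor for the new coordinates.
lemma zwF_inversion {p r s t : ℝ} (hp : NonIntegral r (-p)) (hs : IsHalfPoint s t)
    (hs' : IsHalfPoint t (-s)) {τ : ℂ} (hτ : 0 < τ.im) :
    zwF p r s t (-1 / τ) = I * τ / (-I * τ) ^ (1 / 2 : ℂ) * zwF r (-p) t (-s) τ := by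
  have h0 : τ ≠ 0 := by rintro rfl; simp at hτ
  have hτ' := im_neg_one_div_pos hτ
  have hu : OffLattice (r * τ + (-p : ℝ)) τ := (offLattice_iff hτ).mpr hp
  have hw : (-I * τ) ^ (1 / 2 : ℂ) ≠ 0 := by simp [cpow_eq_zero_iff, h0]
  have hθ := zwTheta_ne_zero_of_isHalfPoint hs' hτ
  have e : exp (-Real.pi * I * (p - s) * ((p - s) * (-1 / τ) + (r - t))) *
      exp (-Real.pi * I * ((r * τ + (-p : ℝ)) ^ 2 - 2 * (r * τ + (-p : ℝ)) * (t * τ + (-s : ℝ))) / τ) =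
      exp (-Real.pi * I * (r - t) * ((r - t) * τ + ((-p : ℝ) - (-s : ℝ)))) *
        exp (Real.pi * I * (t * τ + (-s : ℝ)) ^ 2 / τ) := by
    rw [← exp_add, ← exp_add]
    congr 1
    push_cast
    field_simp
    ring
  rw [zwF_eq hs hτ', zwF_eq hs' hτ,
    show (p : ℂ) * (-1 / τ) + r = (r * τ + (-p : ℝ)) / τ by push_cast; field_simp; ring,
    show (s : ℂ) * (-1 / τ) + t = (t * τ + (-s : ℝ)) / τ by push_cast; field_simp; ring,
    zwNum_inversion _ hτ hu, zwTheta_inversion _ hτ]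
  have alg : ∀ E' e₁ N X θ w E : ℂ, X ≠ 0 → θ ≠ 0 → w ≠ 0 → E' * e₁ = E * X →
      E' * (τ * e₁ * N / (-I * w * X * θ)) = I * τ / w * (E * (N / θ)) := by
    intro E' e₁ N X θ w E hX hθ hw h
    have hI := I_ne_zero
    field_simp
    linear_combination -N * h - N * E * X * I_sq
  exact alg _ _ _ _ _ _ _ (exp_ne_zero _) hθ hw e

/-! ### The action of `SL₂(ℤ)` -/

/-- The first coordinate of the row vector `(p, r) A`. -/
def rowFst (A : SL(2, ℤ)) (p r : ℝ) : ℝ := p * (A 0 0 : ℤ) + r * (A 1 0 : ℤ)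

/-- The second coordinate of the row vector `(p, r) A`. -/
def rowSnd (A : SL(2, ℤ)) (p r : ℝ) : ℝ := p * (A 0 1 : ℤ) + r * (A 1 1 : ℤ)

lemma rowFst_mul (A B : SL(2, ℤ)) (p r : ℝ) :
    rowFst (A * B) p r = rowFst B (rowFst A p r) (rowSnd A p r) := by
  simp only [rowFst, rowSnd, Matrix.SpecialLinearGroup.coe_mul, Matrix.mul_apply, Fin.sum_univ_two]
  push_cast
  ring

lemma rowSnd_mul (A B : SL(2, ℤ)) (p r : ℝ) :
    rowSnd (A * B) p r = rowSnd B (rowFst A p r) (rowSnd A p r) := by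
  simp only [rowFst, rowSnd, Matrix.SpecialLinearGroup.coe_mul, Matrix.mul_apply, Fin.sum_univ_two]
  push_cast
  ring

lemma rowFst_one (p r : ℝ) : rowFst 1 p r = p := by simp [rowFst]

lemma rowSnd_one (p r : ℝ) : rowSnd 1 p r = r := by simp [rowSnd]

lemma NonIntegral.row {p r : ℝ} (h : NonIntegral p r) (A : SL(2, ℤ)) :
    NonIntegral (rowFst A p r) (rowSnd A p r) := by
  rintro ⟨k, l, hk, hl⟩
  have h1 := rowFst_mul A A⁻¹ p r
  have h2 := rowSnd_mul A A⁻¹ p r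
  rw [mul_inv_cancel, rowFst_one, hk, hl] at h1
  rw [mul_inv_cancel, rowSnd_one, hk, hl] at h2
  refine h ⟨k * A⁻¹ 0 0 + l * A⁻¹ 1 0, k * A⁻¹ 0 1 + l * A⁻¹ 1 1, ?_, ?_⟩
  · rw [h1, rowFst]; push_cast; rfl
  · rw [h2, rowSnd]; push_cast; rfl

lemma IsHalfPoint.row {s t : ℝ} (h : IsHalfPoint s t) (A : SL(2, ℤ)) :
    IsHalfPoint (rowFst A s t) (rowSnd A s t) := by
  refine ⟨h.1.row A, ?_⟩
  obtain ⟨-, k, l, rfl, rfl⟩ := h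
  refine ⟨k * A 0 0 + l * A 1 0, k * A 0 1 + l * A 1 1, ?_, ?_⟩
  · rw [rowFst]; push_cast; ring
  · rw [rowSnd]; push_cast; ring

/-- `γτ + δ`. -/
def autFactor (A : SL(2, ℤ)) (τ : ℍ) : ℂ := ((A 1 0 : ℤ) : ℂ) * (τ : ℂ) + ((A 1 1 : ℤ) : ℂ)

lemma coe_smul_eq (A : SL(2, ℤ)) (τ : ℍ) :
    ((A • τ : ℍ) : ℂ) = (((A 0 0 : ℤ) : ℂ) * τ + ((A 0 1 : ℤ) : ℂ)) / autFactor A τ := by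
  rw [autFactor, UpperHalfPlane.coe_specialLinearGroup_apply]
  simp

lemma autFactor_ne_zero (A : SL(2, ℤ)) (τ : ℍ) : autFactor A τ ≠ 0 := by
  intro h
  have h1 := congrArg Complex.im h
  have h2 := congrArg Complex.re h
  simp [autFactor, τ.im_ne_zero] at h1
  simp [autFactor, h1] at h2
  have h3 := A.det_coe
  rw [Matrix.det_fin_two, h1, h2] at h3
  simp at h3

lemma autFactor_mul (A B : SL(2, ℤ)) (τ : ℍ) :
    autFactor (A * B) τ = autFactor A (B • τ) * autFactor B τ := by
  have h := autFactor_ne_zero B τ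
  rw [autFactor, autFactor, coe_smul_eq, add_mul, mul_div_assoc', div_mul_cancel₀ _ h, autFactor]
  simp only [Matrix.SpecialLinearGroup.coe_mul, Matrix.mul_apply, Fin.sum_univ_two]
  push_cast
  ring

lemma continuous_autFactor (A : SL(2, ℤ)) : Continuous (autFactor A) := by
  unfold autFactor
  fun_prop

lemma continuous_smul_upperHalfPlane (A : SL(2, ℤ)) : Continuous fun τ : ℍ => A • τ := by
  rw [UpperHalfPlane.isEmbedding_coe.continuous_iff]
  have : (UpperHalfPlane.coe ∘ fun τ : ℍ => A • τ) = fun τ : ℍ =>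
      (((A 0 0 : ℤ) : ℂ) * τ + ((A 0 1 : ℤ) : ℂ)) / autFactor A τ := funext fun τ => coe_smul_eq A τ
  rw [this]
  exact Continuous.div (by fun_prop) (continuous_autFactor A) (autFactor_ne_zero A)

/-- There is a continuous square root `φ` of a multiple of `γτ + δ` with
`F_{(p,r),(s,t)}(Aτ) = φ(τ) F_{(p,r)A,(s,t)A}(τ)`. -/
def ZwFTransforms (A : SL(2, ℤ)) : Prop :=
  ∃ φ : ℍ → ℂ, Continuous φ ∧ (∃ χ : ℂ, χ ≠ 0 ∧ ∀ τ, φ τ ^ 2 = χ * autFactor A τ) ∧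
    ∀ p r s t : ℝ, NonIntegral p r → IsHalfPoint s t → ∀ τ : ℍ,
      zwF p r s t ((A • τ : ℍ) : ℂ) =
        φ τ * zwF (rowFst A p r) (rowSnd A p r) (rowFst A s t) (rowSnd A s t) τ

lemma ZwFTransforms.mul {A B : SL(2, ℤ)} (hA : ZwFTransforms A) (hB : ZwFTransforms B) :
    ZwFTransforms (A * B) := by
  obtain ⟨φ, hφ, ⟨χ, hχ, hφ2⟩, h⟩ := hA
  obtain ⟨ψ, hψ, ⟨η, hη, hψ2⟩, h'⟩ := hB
  refine ⟨fun τ => φ (B • τ) * ψ τ, (hφ.comp (continuous_smul_upperHalfPlane B)).mul hψ,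
    ⟨χ * η, mul_ne_zero hχ hη, fun τ => ?_⟩, fun p r s t hp hs τ => ?_⟩
  · rw [mul_pow, hφ2, hψ2, autFactor_mul]
    ring
  · rw [mul_smul, h p r s t hp hs, h' _ _ _ _ (hp.row A) (hs.row A), rowFst_mul, rowSnd_mul,
      rowFst_mul, rowSnd_mul, mul_assoc]

lemma ZwFTransforms.inv {A : SL(2, ℤ)} (hA : ZwFTransforms A) : ZwFTransforms A⁻¹ := by
  obtain ⟨φ, hφ, ⟨χ, hχ, hφ2⟩, h⟩ := hA
  have hne : ∀ τ, φ τ ≠ 0 := fun τ h0 => by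
    have := hφ2 τ
    rw [h0] at this
    exact mul_ne_zero hχ (autFactor_ne_zero A τ) (by rw [← this]; ring)
  refine ⟨fun τ => (φ (A⁻¹ • τ))⁻¹, (hφ.comp (continuous_smul_upperHalfPlane A⁻¹)).inv₀ fun τ => hne _,
    ⟨χ⁻¹, inv_ne_zero hχ, fun τ => ?_⟩, fun p r s t hp hs τ => ?_⟩
  · have h1 := autFactor_mul A A⁻¹ τ
    rw [mul_inv_cancel] at h1
    have h2 : autFactor 1 τ = 1 := by simp [autFactor]
    rw [inv_pow, hφ2, mul_inv]
    congr 1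
    rw [h2] at h1
    exact inv_eq_of_mul_eq_one_right h1.symm
  · have h1 := h _ _ _ _ (hp.row A⁻¹) (hs.row A⁻¹) (A⁻¹ • τ)
    rw [← rowFst_mul, ← rowSnd_mul, ← rowFst_mul, ← rowSnd_mul, inv_mul_cancel, rowFst_one,
      rowSnd_one, rowFst_one, rowSnd_one, smul_inv_smul] at h1
    rw [h1, inv_mul_cancel_left₀ (hne _)]

lemma zwFTransforms_one : ZwFTransforms 1 :=
  ⟨fun _ => 1, continuous_const, ⟨1, one_ne_zero, fun τ => by simp [autFactor]⟩,
    fun p r s t _ _ τ => by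
      simp only [rowFst_one, rowSnd_one, one_smul, one_mul]⟩

lemma zwFTransforms_T : ZwFTransforms ModularGroup.T := by
  have hc : ∀ p r : ℝ, rowFst ModularGroup.T p r = p ∧ rowSnd ModularGroup.T p r = p + r :=
    fun p r => by simp [rowFst, rowSnd, ModularGroup.T]
  refine ⟨fun _ => Complex.exp (-Real.pi * Complex.I / 4), continuous_const,
    ⟨Complex.exp (-Real.pi * Complex.I / 4) ^ 2, pow_ne_zero _ (Complex.exp_ne_zero _), fun τ => by
      simp [autFactor, ModularGroup.T]⟩, fun p r s t _ hs τ => ?_⟩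
  have hs' := hs.row ModularGroup.T
  rw [(hc s t).1, (hc s t).2] at hs'
  have hτ : ((ModularGroup.T • τ : ℍ) : ℂ) = τ + 1 := by
    rw [coe_smul_eq]
    simp [autFactor, ModularGroup.T]
  rw [(hc p r).1, (hc p r).2, (hc s t).1, (hc s t).2, hτ, zwF_modular_add_one hs hs' τ.im_pos]

lemma zwFTransforms_S : ZwFTransforms ModularGroup.S := by
  have hc : ∀ p r : ℝ, rowFst ModularGroup.S p r = r ∧ rowSnd ModularGroup.S p r = -p :=
    fun p r => by simp [rowFst, rowSnd, ModularGroup.S]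
  refine ⟨fun τ => Complex.I * τ / (-Complex.I * τ) ^ (1 / 2 : ℂ), ?_,
    ⟨-Complex.I, by simp, fun τ => ?_⟩, fun p r s t hp hs τ => ?_⟩
  · refine Continuous.div (by fun_prop) ?_ fun τ => by simp [Complex.cpow_eq_zero_iff, τ.ne_zero]
    refine Continuous.cpow (by fun_prop) continuous_const fun τ => ?_
    left
    simpa using τ.im_pos
  · have hw2 : ((-Complex.I * τ) ^ (1 / 2 : ℂ)) ^ 2 = -Complex.I * τ := by
      rw [← Complex.cpow_nat_mul]
      norm_num
    rw [div_pow, hw2]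
    have := τ.ne_zero
    simp only [autFactor, ModularGroup.S]
    have hI := Complex.I_ne_zero
    simp
    field_simp
  · have hs' := hs.row ModularGroup.S
    have hp' := hp.row ModularGroup.S
    rw [(hc s t).1, (hc s t).2] at hs'
    rw [(hc p r).1, (hc p r).2] at hp'
    have hτ : ((ModularGroup.S • τ : ℍ) : ℂ) = -1 / τ := by
      rw [coe_smul_eq]
      simp [autFactor, ModularGroup.S]
    rw [(hc p r).1, (hc p r).2, (hc s t).1, (hc s t).2, hτ, zwF_inversion hp' hs hs' τ.im_pos]

/-- S and T generate SL₂(ℤ). Recording only the continuity and the square of the factor makes the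
property stable under products and inverses, with no bookkeeping of roots of unity. -/
lemma zwFTransforms (A : SL(2, ℤ)) : ZwFTransforms A := by
  have hA : A ∈ Subgroup.closure {ModularGroup.S, ModularGroup.T} := by
    rw [SpecialLinearGroup.SL2Z_generators]
    trivial
  induction hA using Subgroup.closure_induction with
  | mem B hB =>
    rcases hB with rfl | rfl
    · exact zwFTransforms_S
    · exact zwFTransforms_T
  | one => exact zwFTransforms_one
  | mul B C _ _ hB hC => exact hB.mul hC
  | inv B _ hB => exact hB.inv

/-! ### Splitting off the holomorphic part -/

/-- The exponential factor in the term of index `n = j + 1/2` of `R(dτ+e;τ)`, normalised. -/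
def zwFExp (d e : ℝ) (j : ℤ) (τ : ℂ) : ℂ :=
  (-1 : ℂ) ^ j * Complex.exp (-Real.pi * Complex.I * ((j : ℂ) + 1 / 2 + d) ^ 2 * τ -
    Real.pi * Complex.I * (2 * ((j : ℂ) + 1 / 2) + d) * e)

/-- The nonholomorphic terms of `μ̃`. -/
def zwFNonTerm (d e : ℝ) (j : ℤ) (τ : ℂ) : ℂ :=
  Complex.I / 2 * (((Real.sign ((j : ℝ) + 1 / 2 + d) -
    zwE (((j : ℝ) + 1 / 2 + d) * Real.sqrt (2 * τ.im)) : ℝ) : ℂ) * zwFExp d e j τ)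

/-- The contribution of `R` to the holomorphic part of `μ̃`. -/
def zwFCorr (d e : ℝ) (τ : ℂ) : ℂ :=
  Complex.I / 2 * (((1 - Real.sign (1 / 2 + d) : ℝ) : ℂ) * zwFExp d e 0 τ +
    ((-1 - Real.sign (-1 / 2 + d) : ℝ) : ℂ) * zwFExp d e (-1) τ)

/-- The holomorphic part of `zwF`. -/
def zwFHol (p r s t : ℝ) (τ : ℂ) : ℂ :=
  Complex.exp (-Real.pi * Complex.I * (p - s) * ((p - s) * τ + (r - t))) *
    (zwAppell (p * τ + r) (s * τ + t) τ / zwTheta (s * τ + t) τ) + zwFCorr (p - s) (r - t) τ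

lemma exp_mul_zwRTerm (d e : ℝ) (j : ℤ) {τ : ℂ} (hτ : 0 < τ.im) :
    Complex.exp (-Real.pi * Complex.I * d * (d * τ + e)) * zwRTerm j (d * τ + e) τ =
      ((Real.sign ((j : ℝ) + 1 / 2) - zwE (((j : ℝ) + 1 / 2 + d) * Real.sqrt (2 * τ.im)) : ℝ) : ℂ) *
        zwFExp d e j τ := by
  have him : ((d : ℂ) * τ + e).im / τ.im = d := by
    simp
    field_simp
  have hE : Complex.exp (-Real.pi * Complex.I * d * (d * τ + e)) *
      Complex.exp (-Real.pi * Complex.I * ((j : ℂ) + 1 / 2) ^ 2 * τ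
        - 2 * Real.pi * Complex.I * ((j : ℂ) + 1 / 2) * (d * τ + e)) =
      Complex.exp (-Real.pi * Complex.I * ((j : ℂ) + 1 / 2 + d) ^ 2 * τ -
        Real.pi * Complex.I * (2 * ((j : ℂ) + 1 / 2) + d) * e) := by
    rw [← Complex.exp_add]
    congr 1
    ring
  rw [zwRTerm, him, zwFExp, ← hE]
  ring

/-- As |d| < 1, the signs of n and n+d agree unless n = ±1/2, so only j = 0 and j = -1 contribute.
-/
lemma hasSum_zwFCorr {d : ℝ} (hd : |d| < 1) (e : ℝ) (τ : ℂ) :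
    HasSum (fun j : ℤ => Complex.I / 2 * (((Real.sign ((j : ℝ) + 1 / 2) -
      Real.sign ((j : ℝ) + 1 / 2 + d) : ℝ) : ℂ) * zwFExp d e j τ)) (zwFCorr d e τ) := by
  have h : HasSum (fun j : ℤ => Complex.I / 2 * (((Real.sign ((j : ℝ) + 1 / 2) -
      Real.sign ((j : ℝ) + 1 / 2 + d) : ℝ) : ℂ) * zwFExp d e j τ)) _ :=
      hasSum_sum_of_ne_finset_zero (s := {0, -1}) (fun j hj => by
    simp only [Finset.mem_insert, Finset.mem_singleton, not_or] at hj
    have hd' := abs_lt.mp hd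
    rcases lt_or_ge j 0 with h | h
    · have : (j : ℝ) ≤ -2 := by exact_mod_cast (by omega : j ≤ -2)
      rw [Real.sign_of_neg (by linarith), Real.sign_of_neg (by linarith)]
      simp
    · have : (1 : ℝ) ≤ j := by exact_mod_cast (by omega : 1 ≤ j)
      rw [Real.sign_of_pos (by linarith), Real.sign_of_pos (by linarith)]
      simp)
  convert h using 1
  rw [Finset.sum_pair (by norm_num), zwFCorr, sign_add_half, sign_add_half, ← mul_add]
  norm_num

/-- Replacing sgn(n) by sgn(n+d) in R moves the finite correction `zwFCorr` to the holomorphic part.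
Each remaining term is an incomplete Gamma function times an exponential. -/
lemma hasSum_zwFNonTerm {p r s t : ℝ} (hd : |p - s| < 1) (h : IsHalfPoint s t) {τ : ℂ}
    (hτ : 0 < τ.im) : HasSum (fun j : ℤ => zwFNonTerm (p - s) (r - t) j τ)
      (zwF p r s t τ - zwFHol p r s t τ) := by
  have h1 := ((hasSum_zwRTerm (((p - s : ℝ) : ℂ) * τ + ((r - t : ℝ) : ℂ)) hτ).mul_left
    (Complex.exp (-Real.pi * Complex.I * ((p - s : ℝ) : ℂ) *
      (((p - s : ℝ) : ℂ) * τ + ((r - t : ℝ) : ℂ))))).mul_left (Complex.I / 2)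
  have h2 := h1.sub (hasSum_zwFCorr hd (r - t) τ)
  have hv : zwF p r s t τ - zwFHol p r s t τ = Complex.I / 2 *
      (Complex.exp (-Real.pi * Complex.I * ((p - s : ℝ) : ℂ) *
        (((p - s : ℝ) : ℂ) * τ + ((r - t : ℝ) : ℂ))) *
          zwR (((p - s : ℝ) : ℂ) * τ + ((r - t : ℝ) : ℂ)) τ) - zwFCorr (p - s) (r - t) τ := by
    have hθ := zwTheta_ne_zero_of_isHalfPoint h hτ
    rw [zwF_eq h hτ, zwFHol, zwNum, show (p : ℂ) * τ + r - (s * τ + t) =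
      ((p - s : ℝ) : ℂ) * τ + ((r - t : ℝ) : ℂ) by push_cast; ring, add_div, mul_div_assoc (_ / 2),
      mul_div_cancel_left₀ _ hθ]
    push_cast
    ring
  rw [hv]
  refine h2.congr_fun fun j => ?_
  rw [exp_mul_zwRTerm _ _ _ hτ, zwFNonTerm, ← mul_sub, ← sub_mul, ← Complex.ofReal_sub,
    sub_sub_sub_cancel_left]

/-! ### The holomorphic part near the cusp -/

open Complex in
lemma norm_exp_appell (n : ℤ) (s t : ℝ) (τ : ℂ) :
    ‖exp (Real.pi * I * n * (n + 1) * τ + 2 * Real.pi * I * n * (s * τ + t))‖ =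
      Real.exp (-2 * Real.pi * τ.im * (n * (n + 1) / 2 + n * s)) := by
  rw [norm_exp]
  congr 1
  rw [show Real.pi * I * n * (n + 1) * τ + 2 * Real.pi * I * n * (s * τ + t) =
    ((2 * Real.pi * (n * (n + 1) / 2 + n * s) : ℝ) : ℂ) * (I * τ) +
      ((2 * Real.pi * n * t : ℝ) : ℂ) * I by push_cast; ring, add_re, re_ofReal_mul, re_ofReal_mul,
      I_mul_re, I_re]
  ring

/-- The least exponent in the expansion of the Appell sum, up to the factor `e^{πiu}`. -/
def appellOrd (p s : ℝ) : ℝ := min 0 (1 - s - p)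

lemma norm_inv_one_sub_le_of_norm_le {X : ℂ} {b : ℝ} (hb : b < 1) (h : ‖X‖ ≤ b) :
    ‖(1 - X)⁻¹‖ ≤ (1 - b)⁻¹ := by
  rw [norm_inv]
  apply inv_anti₀ (by linarith)
  have := norm_sub_norm_le 1 X
  rw [norm_one] at this
  linarith

open Complex in
-- For n ≥ 0 the denominator is bounded away from 0 and the numerator has exponent n(n+1)/2+ns ≥ 0.
-- For n < 0 the denominator is dominated by its exponential, which adds -n-p; the least exponent,
-- at n = -1, is 1-s-p.
lemma exists_norm_appell_term_le {p r s : ℝ} (t : ℝ) (hp0 : 0 ≤ p) (hp1 : p < 1) (hs0 : 0 ≤ s)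
    (hs1 : s < 1) (hpr : NonIntegral p r) {y₀ : ℝ} (hy₀ : 0 < y₀) :
    ∃ C : ℝ, ∀ n : ℤ, ∀ τ : ℂ, y₀ ≤ τ.im →
      ‖(-1 : ℂ) ^ n * exp (Real.pi * I * n * (n + 1) * τ + 2 * Real.pi * I * n * (s * τ + t)) /
        (1 - exp (2 * Real.pi * I * n * τ + 2 * Real.pi * I * (p * τ + r)))‖ ≤
      C * Real.exp (-2 * Real.pi * τ.im * appellOrd p s) *
        Real.exp (-Real.pi * y₀ * (|(n : ℝ)| - 1)) := by
  have hpi := Real.pi_pos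
  have hexp_lt : ∀ a : ℝ, 0 < a → Real.exp (-2 * Real.pi * a * y₀) < 1 := fun a ha =>
    Real.exp_lt_one_iff.mpr (by have : 0 < Real.pi * a * y₀ := by positivity
                                linarith)
  -- The index n = 0 is separate because for p = 0 the exponential does not decay; the denominator
  -- is then independent of τ.
  obtain ⟨C₀, hC₀⟩ : ∃ C₀ : ℝ, ∀ τ : ℂ, y₀ ≤ τ.im →
      ‖(1 - exp (2 * Real.pi * I * (0 : ℤ) * τ + 2 * Real.pi * I * (p * τ + r)))⁻¹‖ ≤ C₀ := by
    rcases hp0.eq_or_lt with rfl | hp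
    · refine ⟨‖(1 - exp (2 * Real.pi * I * r))⁻¹‖, fun τ _ => ?_⟩
      simp
    · refine ⟨(1 - Real.exp (-2 * Real.pi * p * y₀))⁻¹, fun τ hτ => ?_⟩
      refine norm_inv_one_sub_le_of_norm_le (hexp_lt p hp) ?_
      rw [norm_exp_lattice, Real.exp_le_exp]
      have := mul_le_mul_of_nonneg_left hτ (show 0 ≤ 2 * Real.pi * p by positivity)
      push_cast
      linarith
  set C₁ : ℝ := (1 - Real.exp (-2 * Real.pi * 1 * y₀))⁻¹
  set C₂ : ℝ := (1 - Real.exp (-2 * Real.pi * (1 - p) * y₀))⁻¹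
  set C : ℝ := max C₀ (max C₁ C₂) with hC
  have hC1 : 0 < C₁ := inv_pos.mpr (by linarith [hexp_lt 1 one_pos])
  have hC0 : 0 ≤ C := hC1.le.trans ((le_max_left _ _).trans (le_max_right _ _))
  have hinv : ∀ n : ℤ, ∀ τ : ℂ, y₀ ≤ τ.im →
      ‖(1 - exp (2 * Real.pi * I * n * τ + 2 * Real.pi * I * (p * τ + r)))⁻¹‖ ≤
        C * Real.exp (-2 * Real.pi * τ.im * (if n < 0 then -n - p else 0)) := by
    intro n τ hτ
    have hy : 0 < τ.im := hy₀.trans_le hτ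
    rcases lt_trichotomy n 0 with hn | rfl | hn
    · rw [if_pos hn]
      have hX := norm_exp_lattice n p r τ
      set X := exp (2 * Real.pi * I * n * τ + 2 * Real.pi * I * (p * τ + r))
      have hX0 : X ≠ 0 := exp_ne_zero _
      have hn1 : (n : ℝ) ≤ -1 := by exact_mod_cast (by omega : n ≤ -1)
      have e1 : (1 - X)⁻¹ = -(X⁻¹ * (1 - X⁻¹)⁻¹) := by
        rw [← mul_inv, mul_sub, mul_inv_cancel₀ hX0, mul_one, ← inv_neg, neg_sub]
      have e2 : ‖X⁻¹‖ = Real.exp (-2 * Real.pi * τ.im * (-n - p)) := by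
        rw [norm_inv, hX, ← Real.exp_neg]
        congr 1
        ring
      rw [e1, norm_neg, norm_mul, e2, mul_comm]
      refine mul_le_mul_of_nonneg_right ?_ (Real.exp_pos _).le
      refine le_trans (norm_inv_one_sub_le_of_norm_le (hexp_lt (1 - p) (by linarith)) ?_)
        ((le_max_right _ _).trans (le_max_right _ _))
      rw [e2, Real.exp_le_exp]
      have h1 : (1 - p) * y₀ ≤ (-n - p) * τ.im :=
        mul_le_mul (by linarith) hτ hy₀.le (by linarith)
      nlinarith
    · rw [if_neg (lt_irrefl _), mul_zero, Real.exp_zero, mul_one]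
      exact (hC₀ τ hτ).trans (le_max_left _ _)
    · rw [if_neg hn.not_gt, mul_zero, Real.exp_zero, mul_one]
      refine le_trans (norm_inv_one_sub_le_of_norm_le (hexp_lt 1 one_pos) ?_)
        ((le_max_left _ _).trans (le_max_right _ _))
      rw [norm_exp_lattice, Real.exp_le_exp]
      have hn1 : (1 : ℝ) ≤ n := by exact_mod_cast hn
      have h1 : 1 * y₀ ≤ (n + p) * τ.im := mul_le_mul (by linarith) hτ hy₀.le (by linarith)
      nlinarith
  refine ⟨C, fun n τ hτ => ?_⟩
  have hy : 0 < τ.im := hy₀.trans_le hτ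
  rw [div_eq_mul_inv, norm_mul, norm_mul, norm_neg_one_zpow, one_mul, norm_exp_appell]
  refine (mul_le_mul_of_nonneg_left (hinv n τ hτ) (Real.exp_pos _).le).trans ?_
  rw [mul_left_comm, mul_assoc C]
  refine mul_le_mul_of_nonneg_left ?_ hC0
  rw [← Real.exp_add, ← Real.exp_add, Real.exp_le_exp]
  set w : ℝ := (n : ℝ) * (n + 1) / 2 + n * s + (if n < 0 then -(n : ℝ) - p else 0) with hw
  -- The excess of the n-th exponent over the minimum grows at least linearly in |n|, which supplies
  -- the summable factor.
  have hkey : 0 ≤ w - appellOrd p s ∧ |(n : ℝ)| - 1 ≤ 2 * (w - appellOrd p s) := by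
    by_cases hn : n < 0
    · have hn1 : (n : ℝ) ≤ -1 := by exact_mod_cast (by omega : n ≤ -1)
      have hm : appellOrd p s ≤ 1 - s - p := min_le_right _ _
      rw [hw, if_pos hn, abs_of_neg (by linarith)]
      constructor <;> nlinarith [mul_nonneg (show 0 ≤ -1 - (n : ℝ) by linarith)
        (show 0 ≤ 1 - s by linarith), mul_nonneg (show 0 ≤ -1 - (n : ℝ) by linarith)
        (show 0 ≤ -(n : ℝ) by linarith)]
    · have hn1 : (0 : ℝ) ≤ n := by exact_mod_cast not_lt.mp hn
      have hm : appellOrd p s ≤ 0 := min_le_left _ _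
      rw [hw, if_neg hn, abs_of_nonneg hn1]
      have : 0 ≤ (n : ℝ) * s := mul_nonneg hn1 hs0
      constructor <;> nlinarith
  have h3 : y₀ * (|(n : ℝ)| - 1) ≤ 2 * (τ.im * (w - appellOrd p s)) := by
    have := mul_le_mul_of_nonneg_right hτ hkey.1
    have := mul_le_mul_of_nonneg_left hkey.2 hy₀.le
    linarith
  have h4 := mul_le_mul_of_nonneg_left h3 hpi.le
  have h5 : τ.im * w = τ.im * ((n : ℝ) * (n + 1) / 2 + n * s) +
      τ.im * (if n < 0 then -(n : ℝ) - p else 0) := by rw [hw]; ring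
  linear_combination h4 + (-2 * Real.pi) * h5

lemma summable_exp_neg_mul_abs {a : ℝ} (ha : 0 < a) :
    Summable fun n : ℤ => Real.exp (-a * (|(n : ℝ)| - 1)) := by
  have hg : Summable fun n : ℕ => Real.exp a * Real.exp (-a) ^ n :=
    (summable_geometric_of_lt_one (Real.exp_pos _).le
      (Real.exp_lt_one_iff.mpr (by linarith))).mul_left _
  have e : ∀ n : ℕ, Real.exp (-a * (|(n : ℝ)| - 1)) = Real.exp a * Real.exp (-a) ^ n := fun n => by
    rw [← Real.exp_nat_mul, ← Real.exp_add, Nat.abs_cast]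
    congr 1
    ring
  refine Summable.of_nat_of_neg ?_ ?_
  · simpa only [Int.cast_natCast, e] using hg
  · simpa only [Int.cast_neg, Int.cast_natCast, abs_neg, e] using hg

lemma differentiableOn_zwAppell_cusp {p r s : ℝ} (t : ℝ) (hp0 : 0 ≤ p) (hp1 : p < 1) (hs0 : 0 ≤ s)
    (hs1 : s < 1) (hpr : NonIntegral p r) :
    DifferentiableOn ℂ (fun τ => zwAppell (p * τ + r) (s * τ + t) τ) {τ : ℂ | 0 < τ.im} := by
  intro τ₀ hτ₀
  have hτ₀' : 0 < τ₀.im := hτ₀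
  apply DifferentiableAt.differentiableWithinAt
  refine DifferentiableAt.mul (by fun_prop) ?_
  obtain ⟨C, hC⟩ := exists_norm_appell_term_le t hp0 hp1 hs0 hs1 hpr (half_pos hτ₀')
  set U : Set ℂ := {τ : ℂ | τ₀.im / 2 < τ.im ∧ τ.im < 2 * τ₀.im} with hU
  have hUo : IsOpen U :=
    (isOpen_lt continuous_const Complex.continuous_im).inter
      (isOpen_lt Complex.continuous_im continuous_const)
  set M : ℝ := Real.exp (2 * Real.pi * (2 * τ₀.im) * |appellOrd p s|)
  refine DifferentiableOn.differentiableAt (s := U) (Complex.differentiableOn_tsum_of_summable_norm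
    ((summable_exp_neg_mul_abs (a := Real.pi * (τ₀.im / 2)) (by positivity)).mul_left (|C| * M))
    (fun n => ?_) hUo fun n τ hτ => ?_) (hUo.mem_nhds ⟨by linarith, by linarith⟩)
  · intro τ hτ
    have hτ' : 0 < τ.im := by linarith [hτ.1]
    apply DifferentiableAt.differentiableWithinAt
    refine DifferentiableAt.div (by fun_prop) (by fun_prop) ?_
    exact sub_ne_zero.mpr (((offLattice_iff hτ').mpr hpr) n).symm
  · refine (hC n τ hτ.1.le).trans ?_
    rw [neg_mul Real.pi]
    refine mul_le_mul_of_nonneg_right ?_ (Real.exp_pos _).le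
    refine mul_le_mul (le_abs_self C) (Real.exp_le_exp.mpr ?_) (Real.exp_pos _).le (abs_nonneg C)
    have h1 : -appellOrd p s ≤ |appellOrd p s| := neg_le_abs _
    have h2 : 0 ≤ Real.pi * τ.im := mul_nonneg Real.pi_pos.le (by linarith [hτ.1])
    have h3 := mul_le_mul_of_nonneg_left h1 h2
    have h4 : Real.pi * τ.im * |appellOrd p s| ≤ Real.pi * (2 * τ₀.im) * |appellOrd p s| :=
      mul_le_mul_of_nonneg_right (mul_le_mul_of_nonneg_left hτ.2.le Real.pi_pos.le) (abs_nonneg _)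
    linarith

lemma exists_norm_zwAppell_cusp_le {p r s : ℝ} (t : ℝ) (hp0 : 0 ≤ p) (hp1 : p < 1) (hs0 : 0 ≤ s)
    (hs1 : s < 1) (hpr : NonIntegral p r) :
    ∃ C : ℝ, ∀ τ : ℂ, 1 ≤ τ.im → ‖zwAppell (p * τ + r) (s * τ + t) τ‖ ≤
      C * Real.exp (-2 * Real.pi * τ.im * (p / 2 + appellOrd p s)) := by
  obtain ⟨C, hC⟩ := exists_norm_appell_term_le t hp0 hp1 hs0 hs1 hpr one_pos
  have hs := summable_exp_neg_mul_abs (a := Real.pi * 1) (by simpa using Real.pi_pos)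
  refine ⟨C * ∑' n : ℤ, Real.exp (-(Real.pi * 1) * (|(n : ℝ)| - 1)), fun τ hτ => ?_⟩
  have h1 := tsum_of_norm_bounded ((hs.mul_left
    (C * Real.exp (-2 * Real.pi * τ.im * appellOrd p s))).hasSum) (fun n => by
      have := hC n τ hτ
      rwa [neg_mul Real.pi] at this)
  have h2 : ‖Complex.exp (Real.pi * Complex.I * (p * τ + r))‖ =
      Real.exp (-2 * Real.pi * τ.im * (p / 2)) := by
    rw [Complex.norm_exp]
    congr 1
    rw [show Real.pi * Complex.I * (p * τ + r) =
      ((Real.pi * p : ℝ) : ℂ) * (Complex.I * τ) + ((Real.pi * r : ℝ) : ℂ) * Complex.I by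
        push_cast; ring, Complex.add_re, Complex.re_ofReal_mul, Complex.re_ofReal_mul,
        Complex.I_mul_re, Complex.I_re]
    ring
  rw [zwAppell, norm_mul, h2, mul_add (-2 * Real.pi * τ.im), Real.exp_add]
  refine (mul_le_mul_of_nonneg_left h1 (Real.exp_pos _).le).trans (le_of_eq ?_)
  rw [tsum_mul_left]
  ring

/-! ### The theta function near the cusp -/

lemma IsHalfPoint.cases {s t : ℝ} (h : IsHalfPoint s t) (hs0 : 0 ≤ s) (hs1 : s < 1) :
    (s = 0 ∧ ∃ i : ℤ, t = i + 1 / 2) ∨ (s = 1 / 2 ∧ ((∃ i : ℤ, t = i) ∨ ∃ i : ℤ, t = i + 1 / 2)) := by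
  obtain ⟨hn, k, l, rfl, rfl⟩ := h
  have hk0 : 0 ≤ k := by
    have : (0 : ℝ) ≤ k := by linarith
    exact_mod_cast this
  have hk1 : k < 2 := by
    have : (k : ℝ) < 2 := by linarith
    exact_mod_cast this
  have hl : (∃ i : ℤ, (l : ℝ) / 2 = i) ∨ ∃ i : ℤ, (l : ℝ) / 2 = i + 1 / 2 := by
    rcases Int.even_or_odd' l with ⟨i, rfl | rfl⟩
    · exact Or.inl ⟨i, by push_cast; ring⟩
    · exact Or.inr ⟨i, by push_cast; ring⟩
  interval_cases k
  · left
    refine ⟨by norm_num, hl.resolve_left ?_⟩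
    rintro ⟨i, hi⟩
    exact hn ⟨0, i, by norm_num, hi⟩
  · right
    exact ⟨by norm_num, hl⟩

lemma half_le_norm_jacobiTheta₂_zero {τ : ℂ} (hτ : 1 ≤ τ.im) : 1 / 2 ≤ ‖jacobiTheta₂ 0 τ‖ := by
  have h0 := norm_jacobiTheta_sub_one_le (zero_lt_one.trans_le hτ)
  rw [jacobiTheta_eq_jacobiTheta₂] at h0
  have h1 : Real.exp (-Real.pi * τ.im) < 1 / 5 := by
    have : Real.exp (-Real.pi * τ.im) ≤ Real.exp (-3) := by
      apply Real.exp_le_exp.mpr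
      nlinarith [Real.pi_gt_three]
    have h3 : (5 : ℝ) < Real.exp 3 := by
      have := Real.quadratic_le_exp_of_nonneg (x := 3) (by norm_num)
      linarith
    have h4 : Real.exp (-3) < 1 / 5 := by
      rw [Real.exp_neg, inv_eq_one_div]
      apply one_div_lt_one_div_of_lt <;> linarith
    linarith
  have h2 : 2 / (1 - Real.exp (-Real.pi * τ.im)) * Real.exp (-Real.pi * τ.im) ≤ 1 / 2 := by
    rw [div_mul_eq_mul_div, div_le_iff₀] <;> linarith
  have h3 := norm_sub_norm_le 1 (jacobiTheta₂ 0 τ)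
  rw [norm_one, norm_sub_rev] at h3
  linarith

lemma jacobiTheta₂_add_int (z τ : ℂ) (n : ℤ) : jacobiTheta₂ (z + n) τ = jacobiTheta₂ z τ := by
  have hp : Function.Periodic (fun z => jacobiTheta₂ z τ) (1 : ℂ) := fun z => jacobiTheta₂_add_left z τ
  simpa using hp.int_mul n z

/-- The terms have modulus e^{-πn(n+1)y}, so n = 0 and n = -1 tie, and both equal 1. This settles s
= 0, where ϑ has two leading terms that reinforce each other. -/
lemma tendsto_jacobiTheta₂_half_period :
    Tendsto (fun τ : ℂ => jacobiTheta₂ (τ / 2) τ) (comap Complex.im atTop) (nhds 2) := by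
  have hpi := Real.pi_pos
  have hnorm : ∀ (n : ℤ) (τ : ℂ), ‖jacobiTheta₂_term n (τ / 2) τ‖ =
      Real.exp (-(Real.pi * ((n : ℝ) * (n + 1))) * τ.im) := fun n τ => by
    rw [jacobiTheta₂_term, Complex.norm_exp]
    congr 1
    rw [show 2 * Real.pi * Complex.I * n * (τ / 2) + Real.pi * Complex.I * n ^ 2 * τ =
      ((Real.pi * ((n : ℝ) * (n + 1)) : ℝ) : ℂ) * (Complex.I * τ) by push_cast; ring,
      Complex.re_ofReal_mul, Complex.I_mul_re]
    ring
  have hnn : ∀ n : ℤ, |(n : ℝ)| - 1 ≤ (n : ℝ) * (n + 1) ∧ 0 ≤ (n : ℝ) * (n + 1) := fun n => by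
    rcases lt_or_ge n 0 with h | h
    · have : (n : ℝ) ≤ -1 := by exact_mod_cast (by omega : n ≤ -1)
      rw [abs_of_neg (by linarith)]
      constructor <;> nlinarith
    · have : (0 : ℝ) ≤ n := by exact_mod_cast h
      rw [abs_of_nonneg this]
      constructor <;> nlinarith
  have h := tendsto_tsum_of_dominated_convergence (𝓕 := comap Complex.im atTop)
    (f := fun (τ : ℂ) (n : ℤ) => jacobiTheta₂_term n (τ / 2) τ)
    (g := fun n : ℤ => if n = 0 ∨ n = -1 then (1 : ℂ) else 0)
    (summable_exp_neg_mul_abs hpi) (fun n => ?_) ?_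
  · have hg : ∑' n : ℤ, (if n = 0 ∨ n = -1 then (1 : ℂ) else 0) = 2 := by
      rw [tsum_eq_sum (s := {0, -1}) (fun n hn => by
        simp only [Finset.mem_insert, Finset.mem_singleton] at hn
        rw [if_neg hn]), Finset.sum_pair (by norm_num)]
      norm_num
    rw [hg] at h
    exact h
  · by_cases hn : n = 0 ∨ n = -1
    · rw [if_pos hn]
      refine tendsto_const_nhds.congr fun τ => ?_
      rw [jacobiTheta₂_term, eq_comm, ← Complex.exp_zero]
      congr 1
      rcases hn with rfl | rfl
      · simp
      · push_cast
        ring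
    · rw [if_neg hn, tendsto_zero_iff_norm_tendsto_zero]
      simp only [hnorm]
      have hpos : 0 < (n : ℝ) * (n + 1) := by
        have : 0 < n * (n + 1) := by
          rcases lt_or_ge n 0 with h | h
          · exact mul_pos_of_neg_of_neg h (by omega)
          · exact mul_pos (by omega) (by omega)
        exact_mod_cast this
      refine Real.tendsto_exp_atBot.comp ?_
      exact (tendsto_comap (f := Complex.im)).const_mul_atTop_of_neg
        (neg_lt_zero.mpr (mul_pos hpi hpos))
  · have h1 : ∀ᶠ τ : ℂ in comap Complex.im atTop, 1 ≤ τ.im :=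
      tendsto_comap.eventually (eventually_ge_atTop 1)
    filter_upwards [h1] with τ hτ n
    rw [hnorm, Real.exp_le_exp]
    have h2 := (hnn n).1
    have h3 := mul_le_mul_of_nonneg_left hτ (hnn n).2
    have h4 := mul_le_mul_of_nonneg_left (h2.trans (by linarith : _ ≤ (n : ℝ) * (n + 1) * τ.im)) hpi.le
    linarith

/-- The exponent n²/2+ns is least at n = -1/2, with value 1/8-s/2; it is attained only there for s =
1/2, and also at n = 1/2 for s = 0. -/
lemma exists_le_norm_zwTheta_cusp {s t : ℝ} (h : IsHalfPoint s t) (hs0 : 0 ≤ s) (hs1 : s < 1) :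
    ∃ c Y : ℝ, 0 < c ∧ ∀ τ : ℂ, Y ≤ τ.im →
      c * Real.exp (-2 * Real.pi * τ.im * (1 / 8 - s / 2)) ≤ ‖zwTheta (s * τ + t) τ‖ := by
  rcases h.cases hs0 hs1 with ⟨rfl, i, rfl⟩ | ⟨rfl, ht⟩
  · have h1 : ∀ᶠ τ : ℂ in comap Complex.im atTop, 1 ≤ ‖jacobiTheta₂ (τ / 2) τ‖ :=
      (tendsto_jacobiTheta₂_half_period.norm.eventually_const_le (by norm_num))
    rw [eventually_comap, eventually_atTop] at h1
    obtain ⟨Y, hY⟩ := h1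
    refine ⟨1, Y, one_pos, fun τ hτ => ?_⟩
    have hn := hY _ hτ τ rfl
    rw [zwTheta_eq_jacobiTheta₂, norm_mul,
      show ((0 : ℝ) : ℂ) * τ + ((i + 1 / 2 : ℝ) : ℂ) + 1 / 2 + τ / 2 = τ / 2 + ((i + 1 : ℤ) : ℂ) by
        push_cast; ring, jacobiTheta₂_add_int, one_mul, Complex.norm_exp]
    refine le_trans (le_of_eq ?_) (le_mul_of_one_le_right (Real.exp_pos _).le hn)
    congr 1
    rw [show Real.pi * Complex.I * τ / 4 + Real.pi * Complex.I * (((0 : ℝ) : ℂ) * τ +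
      ((i + 1 / 2 : ℝ) : ℂ) + 1 / 2) = ((Real.pi / 4 : ℝ) : ℂ) * (Complex.I * τ) +
      ((Real.pi * (i + 1) : ℝ) : ℂ) * Complex.I by push_cast; ring, Complex.add_re,
      Complex.re_ofReal_mul, Complex.re_ofReal_mul, Complex.I_mul_re, Complex.I_re]
    ring
  · refine ⟨1 / 2, 1, by norm_num, fun τ hτ => ?_⟩
    have hJ : 1 / 2 ≤ ‖jacobiTheta₂ (t + 1 / 2) τ‖ := by
      rcases ht with ⟨i, rfl⟩ | ⟨i, rfl⟩
      · rw [show (((i : ℤ) : ℝ) : ℂ) + 1 / 2 = 1 / 2 + (i : ℂ) by push_cast; ring,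
          jacobiTheta₂_add_int, jacobiTheta₂_half_eq]
        exact half_le_norm_jacobiTheta₂_zero (by simpa using hτ)
      · rw [show ((i + 1 / 2 : ℝ) : ℂ) + 1 / 2 = 0 + ((i + 1 : ℤ) : ℂ) by push_cast; ring,
          jacobiTheta₂_add_int]
        exact half_le_norm_jacobiTheta₂_zero hτ
    rw [zwTheta_eq_jacobiTheta₂,
      show ((1 / 2 : ℝ) : ℂ) * τ + t + 1 / 2 + τ / 2 = t + 1 / 2 + τ by push_cast; ring,
      jacobiTheta₂_add_left', ← mul_assoc, ← Complex.exp_add, norm_mul, mul_comm (1 / 2 : ℝ),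
      Complex.norm_exp]
    refine mul_le_mul (le_of_eq ?_) hJ (by norm_num) (Real.exp_pos _).le
    congr 1
    rw [show Real.pi * Complex.I * τ / 4 + Real.pi * Complex.I * (((1 / 2 : ℝ) : ℂ) * τ + t + 1 / 2) +
      -Real.pi * Complex.I * (τ + 2 * (t + 1 / 2)) = ((-Real.pi / 4 : ℝ) : ℂ) * (Complex.I * τ) +
      ((-Real.pi * (t + 1 / 2) : ℝ) : ℂ) * Complex.I by push_cast; ring, Complex.add_re,
      Complex.re_ofReal_mul, Complex.re_ofReal_mul, Complex.I_mul_re, Complex.I_re]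
    ring

lemma differentiableOn_zwTheta_cusp (s t : ℝ) :
    DifferentiableOn ℂ (fun τ => zwTheta (s * τ + t) τ) {τ : ℂ | 0 < τ.im} := by
  intro τ hτ
  have e : (fun τ : ℂ => zwTheta (s * τ + t) τ) = fun τ : ℂ => Complex.exp (Real.pi * Complex.I * τ / 4 +
      Real.pi * Complex.I * (s * τ + t + 1 / 2)) * jacobiTheta₂ (s * τ + t + 1 / 2 + τ / 2) τ :=
    funext fun τ => zwTheta_eq_jacobiTheta₂ _ _
  rw [e]
  have h1 : HasFDerivAt (fun τ : ℂ => ((s * τ + t + 1 / 2 + τ / 2 : ℂ), τ))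
      (fderiv ℂ (fun τ : ℂ => ((s * τ + t + 1 / 2 + τ / 2 : ℂ), τ)) τ) τ :=
    DifferentiableAt.hasFDerivAt (by fun_prop)
  have h2 : HasFDerivAt (fun z : ℂ × ℂ => jacobiTheta₂ z.1 z.2)
      (jacobiTheta₂_fderiv (s * τ + t + 1 / 2 + τ / 2) τ) (s * τ + t + 1 / 2 + τ / 2, τ) :=
    hasFDerivAt_jacobiTheta₂ _ hτ
  have h3 : DifferentiableAt ℂ (fun τ : ℂ => jacobiTheta₂ (s * τ + t + 1 / 2 + τ / 2) τ) τ :=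
    HasFDerivAt.differentiableAt (HasFDerivAt.comp
      (f := fun τ : ℂ => ((s * τ + t + 1 / 2 + τ / 2 : ℂ), τ))
      (g := fun z : ℂ × ℂ => jacobiTheta₂ z.1 z.2) τ h2 h1)
  have h4 : DifferentiableAt ℂ (fun τ : ℂ => Complex.exp (Real.pi * Complex.I * τ / 4 +
      Real.pi * Complex.I * (s * τ + t + 1 / 2))) τ := by fun_prop
  exact (h4.mul h3).differentiableWithinAt

/-! ### Properties of the holomorphic part -/

lemma differentiable_zwFCorr (d e : ℝ) : Differentiable ℂ (zwFCorr d e) := by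
  unfold zwFCorr zwFExp
  fun_prop

lemma differentiableOn_zwFHol {p r s t : ℝ} (hp0 : 0 ≤ p) (hp1 : p < 1) (hs0 : 0 ≤ s)
    (hs1 : s < 1) (hpr : NonIntegral p r) (hst : IsHalfPoint s t) :
    DifferentiableOn ℂ (zwFHol p r s t) {τ : ℂ | 0 < τ.im} := by
  refine DifferentiableOn.add (DifferentiableOn.mul ?_ ((differentiableOn_zwAppell_cusp t hp0 hp1 hs0 hs1
    hpr).div (differentiableOn_zwTheta_cusp s t) fun τ hτ =>
      zwTheta_ne_zero_of_isHalfPoint hst hτ)) (differentiable_zwFCorr _ _).differentiableOn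
  exact Differentiable.differentiableOn (by fun_prop)

/-- Explains ν: p/2 comes from the prefactor e^{πiu}, `appellOrd` from the Appell series, and
1/8-s/2 is the order of ϑ in the denominator. -/
lemma nuOrd_eq (p s : ℝ) : nuOrd p s = p / 2 + appellOrd p s - 1 / 8 + s / 2 := by
  rw [nuOrd, appellOrd]
  split_ifs with h
  · rw [min_eq_left (by linarith)]
    ring
  · rw [min_eq_right (by linarith)]
    ring

lemma norm_zwFExp (d e : ℝ) (j : ℤ) (τ : ℂ) :
    ‖zwFExp d e j τ‖ = Real.exp (Real.pi * τ.im * ((j : ℝ) + 1 / 2 + d) ^ 2) := by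
  rw [zwFExp, norm_mul, norm_neg_one_zpow, one_mul, Complex.norm_exp]
  congr 1
  rw [show -Real.pi * Complex.I * ((j : ℂ) + 1 / 2 + d) ^ 2 * τ -
    Real.pi * Complex.I * (2 * ((j : ℂ) + 1 / 2) + d) * e =
    ((-Real.pi * ((j : ℝ) + 1 / 2 + d) ^ 2 : ℝ) : ℂ) * (Complex.I * τ) +
      ((-Real.pi * (2 * ((j : ℝ) + 1 / 2) + d) * e : ℝ) : ℂ) * Complex.I by push_cast; ring,
      Complex.add_re, Complex.re_ofReal_mul, Complex.re_ofReal_mul, Complex.I_mul_re, Complex.I_re]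
  ring

/-- With d = p-s, the case d = ±1/2 gives terms of exponent 0 = -d²/2+1/8, allowed by the minimum in
`kOrd`. The case d > 1/2 forces s = 0, and -(d-1/2)²/2 equals -d²/2+ν(p,0). Since s ≤ 1/2, d < -1/2
never occurs. -/
lemma norm_zwFCorr_le {p s : ℝ} (e : ℝ) (hp0 : 0 ≤ p) (hp1 : p < 1) (hs : s = 0 ∨ s = 1 / 2) {τ : ℂ}
    (hτ : 0 < τ.im) : ‖zwFCorr (p - s) e τ‖ ≤
      2 * Real.exp (-2 * Real.pi * τ.im * (-(p - s) ^ 2 / 2 + kOrd p s)) := by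
  have hs0 : 0 ≤ s := by rcases hs with rfl | rfl <;> norm_num
  have hs1 : s ≤ 1 / 2 := by rcases hs with rfl | rfl <;> norm_num
  have hpy : 0 < Real.pi * τ.im := mul_pos Real.pi_pos hτ
  have hfp : Int.fract p = p := Int.fract_eq_self.mpr ⟨hp0, hp1⟩
  have hfs : Int.fract s = s := Int.fract_eq_self.mpr ⟨hs0, by linarith⟩
  have hk18 : p - s = 1 / 2 ∨ p - s = -(1 / 2) → kOrd p s ≤ 1 / 8 := fun h => by
    rw [kOrd, hfp, hfs, if_pos h]
    exact min_le_left _ _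
  have hB : p - s = 1 / 2 ∨ p - s = -(1 / 2) →
      1 ≤ Real.exp (-2 * Real.pi * τ.im * (-(p - s) ^ 2 / 2 + kOrd p s)) := fun h => by
    apply Real.one_le_exp
    have h1 := hk18 h
    have h2 : (p - s) ^ 2 = 1 / 4 := by rcases h with h | h <;> rw [h] <;> norm_num
    rw [h2]
    nlinarith
  have h1 : ‖((1 - Real.sign (1 / 2 + (p - s)) : ℝ) : ℂ) * zwFExp (p - s) e 0 τ‖ ≤
      2 * Real.exp (-2 * Real.pi * τ.im * (-(p - s) ^ 2 / 2 + kOrd p s)) := by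
    rcases (show -(1 / 2) ≤ p - s by linarith).eq_or_lt with h | h
    · have := hB (Or.inr h.symm)
      -- Here n+d = 0 and `Real.sign 0 = 0`, so the coefficient is 1 rather than 2.
      have hn : ‖((1 - Real.sign (1 / 2 + (p - s)) : ℝ) : ℂ) * zwFExp (p - s) e 0 τ‖ = 1 := by
        rw [norm_mul, norm_zwFExp, ← h, Complex.norm_real]
        norm_num
      rw [hn]
      linarith
    · rw [Real.sign_of_pos (by linarith), sub_self, Complex.ofReal_zero, zero_mul, norm_zero]
      positivity
  have h2 : ‖((-1 - Real.sign (-1 / 2 + (p - s)) : ℝ) : ℂ) * zwFExp (p - s) e (-1) τ‖ ≤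
      2 * Real.exp (-2 * Real.pi * τ.im * (-(p - s) ^ 2 / 2 + kOrd p s)) := by
    rcases lt_trichotomy (p - s) (1 / 2) with h | h | h
    · rw [Real.sign_of_neg (by linarith), sub_self, Complex.ofReal_zero, zero_mul, norm_zero]
      positivity
    · have := hB (Or.inl h)
      have hn : ‖((-1 - Real.sign (-1 / 2 + (p - s)) : ℝ) : ℂ) * zwFExp (p - s) e (-1) τ‖ = 1 := by
        rw [norm_mul, norm_zwFExp, h, Complex.norm_real]
        norm_num
      rw [hn]
      linarith
    · have hs' : s = 0 := by
        rcases hs with rfl | rfl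
        · rfl
        · linarith
      subst hs'
      rw [norm_mul, norm_zwFExp, Real.sign_of_pos (by linarith), Complex.norm_real]
      norm_num
      have hk : kOrd p 0 = p / 2 - 1 / 8 := by
        rw [sub_zero] at h
        rw [kOrd, hfp, hfs, if_neg (by rintro (h' | h') <;> linarith), nuOrd,
          if_pos (by linarith)]
        ring
      rw [hk]
      nlinarith
  rw [zwFCorr, norm_mul, norm_div, Complex.norm_I, Complex.norm_ofNat]
  have h3 := (norm_add_le _ _).trans (add_le_add h1 h2)
  linarith

lemma exists_norm_zwFHol_le {p r s t : ℝ} (hp0 : 0 ≤ p) (hp1 : p < 1) (hs0 : 0 ≤ s)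
    (hs1 : s < 1) (hpr : NonIntegral p r) (hst : IsHalfPoint s t) :
    ∃ C Y : ℝ, ∀ τ : ℂ, Y ≤ τ.im → ‖zwFHol p r s t τ‖ ≤
      C * Real.exp (-2 * Real.pi * τ.im * (-(p - s) ^ 2 / 2 + kOrd p s)) := by
  obtain ⟨C, hC⟩ := exists_norm_zwAppell_cusp_le t hp0 hp1 hs0 hs1 hpr
  obtain ⟨c, Y, hc, hY⟩ := exists_le_norm_zwTheta_cusp hst hs0 hs1
  have hs : s = 0 ∨ s = 1 / 2 := (hst.cases hs0 hs1).imp And.left And.left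
  have hfp : Int.fract p = p := Int.fract_eq_self.mpr ⟨hp0, hp1⟩
  have hfs : Int.fract s = s := Int.fract_eq_self.mpr ⟨hs0, hs1⟩
  have hk : kOrd p s ≤ nuOrd p s := by
    rw [kOrd, hfp, hfs]
    split_ifs
    · exact min_le_right _ _
    · exact le_rfl
  rw [nuOrd_eq] at hk
  refine ⟨|C| / c + 2, max Y 1, fun τ hτ => ?_⟩
  have hτY := (le_max_left _ _).trans hτ
  have hτ1 := (le_max_right _ _).trans hτ
  have hτ0 : 0 < τ.im := by linarith
  have hpy : 0 < Real.pi * τ.im := mul_pos Real.pi_pos hτ0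
  rw [add_mul]
  refine (norm_add_le _ _).trans (add_le_add ?_ (norm_zwFCorr_le _ hp0 hp1 hs hτ0))
  have hE : ‖Complex.exp (-Real.pi * Complex.I * (p - s) * ((p - s) * τ + (r - t)))‖ =
      Real.exp (Real.pi * τ.im * (p - s) ^ 2) := by
    rw [Complex.norm_exp]
    congr 1
    rw [show -Real.pi * Complex.I * (p - s) * ((p - s) * τ + (r - t)) =
      ((-Real.pi * (p - s) ^ 2 : ℝ) : ℂ) * (Complex.I * τ) +
      ((-Real.pi * (p - s) * (r - t) : ℝ) : ℂ) * Complex.I by push_cast; ring,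
      Complex.add_re, Complex.re_ofReal_mul, Complex.re_ofReal_mul, Complex.I_mul_re, Complex.I_re]
    ring
  rw [norm_mul, norm_div, hE]
  have h1 : ‖zwAppell (p * τ + r) (s * τ + t) τ‖ ≤
      |C| * Real.exp (-2 * Real.pi * τ.im * (p / 2 + appellOrd p s)) :=
    (hC τ hτ1).trans (mul_le_mul_of_nonneg_right (le_abs_self C) (Real.exp_pos _).le)
  have h2 : ‖zwAppell (p * τ + r) (s * τ + t) τ‖ / ‖zwTheta (s * τ + t) τ‖ ≤
      |C| * Real.exp (-2 * Real.pi * τ.im * (p / 2 + appellOrd p s)) /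
        (c * Real.exp (-2 * Real.pi * τ.im * (1 / 8 - s / 2))) :=
    div_le_div₀ (by positivity) h1 (by positivity) (hY τ hτY)
  refine (mul_le_mul_of_nonneg_left h2 (Real.exp_pos _).le).trans ?_
  rw [mul_div_mul_comm, ← Real.exp_sub, mul_left_comm, ← Real.exp_add]
  refine mul_le_mul_of_nonneg_left (Real.exp_le_exp.mpr ?_) (by positivity)
  nlinarith

/-! ### Periodicity of the holomorphic part -/

lemma zwAppell_add_int_right (u v τ : ℂ) (n : ℤ) : zwAppell u (v + n) τ = zwAppell u v τ := by
  have hp : Function.Periodic (fun v => zwAppell u v τ) (1 : ℂ) := fun v => zwAppell_add_one_right u v τ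
  simpa using hp.int_mul n v

lemma zwAppell_add_even_left (u v τ : ℂ) (n : ℤ) :
    zwAppell (u + ((2 * n : ℤ) : ℂ)) v τ = zwAppell u v τ := by
  have hp : Function.Periodic (fun u => zwAppell u v τ) (2 : ℂ) := fun u => by
    simp only
    rw [show u + 2 = u + 1 + 1 by ring, zwAppell_add_one_left, zwAppell_add_one_left, neg_neg]
  have := hp.int_mul n u
  rw [show ((2 * n : ℤ) : ℂ) = n * 2 by push_cast; ring]
  exact this

lemma zwAppell_modular_add_nat (u v τ : ℂ) (n : ℕ) : zwAppell u v (τ + n) = zwAppell u v τ := by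
  induction n with
  | zero => simp
  | succ n ih => rw [Nat.cast_succ, ← add_assoc, zwAppell_modular_add_one, ih]

lemma zwTheta_modular_add_nat (v τ : ℂ) (n : ℕ) :
    zwTheta v (τ + n) = Complex.exp (n * (Real.pi * Complex.I / 4)) * zwTheta v τ := by
  induction n with
  | zero => simp
  | succ n ih =>
    rw [Nat.cast_succ, ← add_assoc, zwTheta_modular_add_one, ih, ← mul_assoc, ← Complex.exp_add]
    congr 2
    ring

lemma zwFExp_add_period {c : ℕ} {d : ℝ} {D : ℤ} (hd : 2 * c * d = D) (e : ℝ) (j : ℤ) (τ : ℂ) :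
    zwFExp d e j (τ + (8 * c ^ 2 : ℕ)) = zwFExp d e j τ := by
  rw [zwFExp, zwFExp]
  congr 1
  rw [Complex.exp_eq_exp_iff_exists_int]
  have hd' : (2 * c * d : ℂ) = D := by exact_mod_cast hd
  refine ⟨-(c * (2 * j + 1) + D) ^ 2, ?_⟩
  push_cast
  rw [← hd']
  ring

/-- The factor 4c² clears the squares of denominators dividing 2c, since half-squares are exponents
of e^{2πiτ}, up to a further 2. The 8 also makes the eighth root of unity of ϑ under τ ↦ τ+1
trivial. -/
lemma zwFHol_add_period {c : ℕ} {p s : ℝ} {P S : ℤ} (hp : 2 * c * p = P) (hs : 2 * c * s = S)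
    (r t : ℝ) (τ : ℂ) : zwFHol p r s t (τ + (8 * c ^ 2 : ℕ)) = zwFHol p r s t τ := by
  have hp' : (2 * c * p : ℂ) = P := by exact_mod_cast hp
  have hs' : (2 * c * s : ℂ) = S := by exact_mod_cast hs
  have hd : 2 * c * (p - s) = ((P - S : ℤ) : ℝ) := by
    push_cast
    linarith
  have h1 : zwFCorr (p - s) (r - t) (τ + (8 * c ^ 2 : ℕ)) = zwFCorr (p - s) (r - t) τ := by
    rw [zwFCorr, zwFCorr, zwFExp_add_period hd, zwFExp_add_period hd]
  have h2 : Complex.exp (-Real.pi * Complex.I * (p - s) * ((p - s) * (τ + (8 * c ^ 2 : ℕ)) + (r - t))) =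
      Complex.exp (-Real.pi * Complex.I * (p - s) * ((p - s) * τ + (r - t))) := by
    rw [Complex.exp_eq_exp_iff_exists_int]
    refine ⟨-(P - S) ^ 2, ?_⟩
    push_cast
    rw [← hp', ← hs']
    ring
  have h3 : (p : ℂ) * (τ + (8 * c ^ 2 : ℕ)) + r = p * τ + r + ((2 * (2 * c * P) : ℤ) : ℂ) := by
    push_cast
    rw [← hp']
    ring
  have h4 : (s : ℂ) * (τ + (8 * c ^ 2 : ℕ)) + t = s * τ + t + ((2 * (2 * c * S) : ℤ) : ℂ) := by
    push_cast
    rw [← hs']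
    ring
  have h5 : Complex.exp ((8 * c ^ 2 : ℕ) * (Real.pi * Complex.I / 4)) = 1 := by
    rw [Complex.exp_eq_one_iff]
    exact ⟨c ^ 2, by push_cast; ring⟩
  rw [zwFHol, zwFHol, h1, h2, h3, h4, zwAppell_modular_add_nat, zwTheta_modular_add_nat, h5, one_mul,
    zwAppell_add_even_left, zwAppell_add_int_right, zwTheta_add_int, zpow_mul]
  norm_num

/-! ### Expansions of periodic holomorphic functions -/

/-- Dividing by e^{2πik₀τ/P} gives a function bounded at i∞, which has a power series expansion in
e^{2πiτ/P}; the indices are then shifted back by k₀. -/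
lemma exists_hasSum_of_periodic_of_bound {H : ℂ → ℂ} {P : ℕ} (hP : 0 < P) {k₀ : ℤ} {C Y : ℝ}
    (hH : DifferentiableOn ℂ H {τ : ℂ | 0 < τ.im}) (hper : ∀ τ : ℂ, 0 < τ.im → H (τ + P) = H τ)
    (hbd : ∀ τ : ℂ, Y ≤ τ.im → ‖H τ‖ ≤ C * Real.exp (-2 * Real.pi * τ.im * (k₀ / P))) :
    ∃ a : ℤ → ℂ, (∀ n < k₀, a n = 0) ∧ ∀ τ : ℍ, HasSum
      (fun n : ℤ => a n * Complex.exp (2 * Real.pi * Complex.I * n * (τ : ℂ) / P)) (H τ) := by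
  have hP0 : (P : ℂ) ≠ 0 := by exact_mod_cast hP.ne'
  set E : ℂ → ℂ := fun τ => Complex.exp (-2 * Real.pi * Complex.I * k₀ * τ / P) with hE
  set f : ℍ → ℂ := fun τ => H τ * E τ with hf
  have hfc : ∀ z : ℂ, 0 < z.im → (f ∘ UpperHalfPlane.ofComplex) z = H z * E z := fun z hz => by
    simp only [Function.comp_apply, hf, UpperHalfPlane.ofComplex_apply_of_im_pos hz]
  have hEper : ∀ z, E (z + P) = E z := fun z => by
    simp only [hE]
    rw [show -2 * Real.pi * Complex.I * k₀ * (z + P) / P = -2 * Real.pi * Complex.I * k₀ * z / P +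
      (-k₀ : ℤ) * (2 * Real.pi * Complex.I) by field_simp; push_cast; ring]
    exact (Complex.exp_periodic.int_mul _ _)
  have hfper : Function.Periodic (f ∘ UpperHalfPlane.ofComplex) ((P : ℝ) : ℂ) := fun z => by
    by_cases hz : 0 < z.im
    · rw [hfc _ hz, hfc _ (by simpa using hz), Complex.ofReal_natCast, hper z hz, hEper]
    -- Outside the upper half plane `ofComplex` takes a fixed default value, so periodicity is
    -- trivial there.
    · have hz' : z.im ≤ 0 := not_lt.mp hz
      have hz'' : (z + ((P : ℝ) : ℂ)).im ≤ 0 := by simpa using hz'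
      simp only [Function.comp_apply, UpperHalfPlane.ofComplex_apply_of_im_nonpos hz',
        UpperHalfPlane.ofComplex_apply_of_im_nonpos hz'']
  have hfdiff : DifferentiableOn ℂ (f ∘ UpperHalfPlane.ofComplex) {z : ℂ | 0 < z.im} := by
    refine DifferentiableOn.congr (f := fun z => H z * E z) (hH.mul ?_) hfc
    simp only [hE]
    fun_prop
  have hfhol := UpperHalfPlane.mdifferentiable_iff.mpr hfdiff
  have hfbdd : UpperHalfPlane.IsBoundedAtImInfty f := by
    rw [UpperHalfPlane.isBoundedAtImInfty_iff]
    refine ⟨C, Y, fun τ hτ => ?_⟩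
    have h1 := hbd τ hτ
    have h2 : ‖E τ‖ = Real.exp (2 * Real.pi * τ.im * (k₀ / P)) := by
      simp only [hE]
      rw [Complex.norm_exp]
      congr 1
      rw [show -2 * Real.pi * Complex.I * k₀ * (τ : ℂ) / P =
        ((-2 * Real.pi * k₀ / P : ℝ) : ℂ) * (Complex.I * τ) by push_cast; ring,
        Complex.re_ofReal_mul, Complex.I_mul_re, UpperHalfPlane.coe_im]
      ring
    simp only [hf]
    rw [norm_mul, h2]
    refine (mul_le_mul_of_nonneg_right h1 (Real.exp_pos _).le).trans (le_of_eq ?_)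
    rw [mul_assoc, ← Real.exp_add, UpperHalfPlane.coe_im]
    ring_nf
    simp
  have hPr : (0 : ℝ) < P := by exact_mod_cast hP
  set c : ℕ → ℂ := fun n => (UpperHalfPlane.qExpansion (P : ℝ) f).coeff n
  have key : ∀ τ : ℍ, HasSum (fun n : ℕ => c n *
      Complex.exp (2 * Real.pi * Complex.I * ((n + k₀ : ℤ) : ℂ) * (τ : ℂ) / P)) (H τ) := fun τ => by
    have h1 := (UpperHalfPlane.hasSum_qExpansion hPr hfper hfhol hfbdd τ).mul_right
      (Complex.exp (2 * Real.pi * Complex.I * k₀ * τ / P))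
    have h2 : f τ * Complex.exp (2 * Real.pi * Complex.I * k₀ * τ / P) = H τ := by
      simp only [hf, hE]
      rw [mul_assoc, ← Complex.exp_add, show -2 * Real.pi * Complex.I * k₀ * (τ : ℂ) / P +
        2 * Real.pi * Complex.I * k₀ * τ / P = 0 by ring, Complex.exp_zero, mul_one]
    rw [h2] at h1
    refine h1.congr_fun fun n => ?_
    rw [smul_eq_mul, Function.Periodic.qParam, ← Complex.exp_nat_mul,
      mul_assoc ((UpperHalfPlane.qExpansion (P : ℝ) f).coeff n), ← Complex.exp_add]
    congr 2
    push_cast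
    ring
  have hinj : Function.Injective fun n : ℕ => (n : ℤ) + k₀ := fun m n h => by
    simpa using h
  refine ⟨fun l => if k₀ ≤ l then c (l - k₀).toNat else 0, fun n hn => if_neg (by omega), fun τ => ?_⟩
  rw [← hinj.hasSum_iff]
  · convert key τ using 2 with n
    simp
  · intro l hl
    have : ¬ k₀ ≤ l := fun h => hl ⟨(l - k₀).toNat, by simp [h]⟩
    simp [this]

/-! ### Expansions of the nonholomorphic part -/

/-- Collects the terms with the same exponent, as n+d and -(n+d) may both occur. Exponent 0 must
carry no coefficient, since the nonholomorphic part is indexed from 1. -/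
lemma hasSum_fiberwise_mul {F β : ℤ → ℂ} {T : ℕ → ℂ} {k : ℤ → ℕ} {S : ℂ} (hF : HasSum F S)
    (hβ : ∀ j, k j = 0 → β j = 0) (h : ∀ j, F j = β j * T (k j)) :
    HasSum (fun n : ℕ => (∑' j : k ⁻¹' {n + 1}, β j) * T (n + 1)) S := by
  have h1 := hF.tsum_fiberwise k
  have h2 : ∀ n : ℕ, ∑' j : k ⁻¹' {n}, F j = (∑' j : k ⁻¹' {n}, β j) * T n := fun n => by
    rw [← tsum_mul_right]
    refine tsum_congr fun j => ?_
    have hj : k j = n := j.2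
    rw [h, hj]
  have h0 : (∑' j : k ⁻¹' {0}, β j) = 0 := by
    have h : ∀ j : k ⁻¹' {0}, β j = 0 := fun j => hβ j j.2
    simp [h]
  simp only [h2] at h1
  have h3 := (hasSum_nat_add_iff' 1).mpr h1
  simpa [h0] using h3

lemma upperGamma_half_eq_of_sign {x y : ℝ} (hy : 0 < y) :
    Real.sign x - zwE (x * Real.sqrt (2 * y)) =
      Real.sign x * ((Real.sqrt Real.pi)⁻¹ * upperGamma (1 / 2) (2 * Real.pi * x ^ 2 * y)) := by
  have hs : 0 < Real.sqrt (2 * y) := Real.sqrt_pos.mpr (by linarith)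
  have hsign : Real.sign (x * Real.sqrt (2 * y)) = Real.sign x := by
    rcases lt_trichotomy x 0 with h | rfl | h
    · rw [Real.sign_of_neg h, Real.sign_of_neg (mul_neg_of_neg_of_pos h hs)]
    · simp
    · rw [Real.sign_of_pos h, Real.sign_of_pos (mul_pos h hs)]
  have h := sign_sub_zwE_eq_upperGamma (x := x * Real.sqrt (2 * y))
  rw [hsign, mul_pow, Real.sq_sqrt (by linarith)] at h
  rw [h]
  congr 3
  ring

/-- The coefficient of the `j`-th nonholomorphic term of `zwF` at `(g² τ + e) / m`. -/
def zwFNonCoeff (d e : ℝ) (e' : ℤ) (m : ℕ) (j : ℤ) : ℂ :=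
  Complex.I / 2 * ((Real.sign ((j : ℝ) + 1 / 2 + d) * (Real.sqrt Real.pi)⁻¹ : ℝ) : ℂ) *
    zwFExp d e j (e' / m)

/-- With z = 2c(n+d) integral, the exponent (n+d)²/2 scaled by g²/m becomes z²g²/(8c²m), an
admissible index over N = 8c²m. -/
lemma zwFNonTerm_eq {d e : ℝ} {e' : ℤ} {c m g : ℕ} (hc : 0 < c) (hm : 0 < m) (hg : 0 < g) {j z : ℤ}
    (hz : 2 * c * ((j : ℝ) + 1 / 2 + d) = z) {τ : ℂ} (hτ : 0 < τ.im) :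
    zwFNonTerm d e j (((g : ℂ) ^ 2 * τ + e') / m) = zwFNonCoeff d e e' m j *
      ((upperGamma (1 / 2) (4 * Real.pi * ((z ^ 2 * (g : ℤ) ^ 2).toNat : ℕ) * τ.im / (8 * c ^ 2 * m : ℕ)) : ℂ) *
      Complex.exp (-2 * Real.pi * Complex.I * ((z ^ 2 * (g : ℤ) ^ 2).toNat : ℕ) * τ / (8 * c ^ 2 * m : ℕ))) := by
  have hcr : (0 : ℝ) < c := by exact_mod_cast hc
  have hmr : (0 : ℝ) < m := by exact_mod_cast hm
  have hgr : (0 : ℝ) < g := by exact_mod_cast hg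
  have hx : (j : ℝ) + 1 / 2 + d = z / (2 * c) := by
    field_simp
    linarith
  have hk : (((z ^ 2 * (g : ℤ) ^ 2).toNat : ℕ) : ℤ) = z ^ 2 * (g : ℤ) ^ 2 :=
    Int.toNat_of_nonneg (by positivity)
  have hkr : (((z ^ 2 * (g : ℤ) ^ 2).toNat : ℕ) : ℝ) = z ^ 2 * g ^ 2 := by exact_mod_cast hk
  have hkc : (((z ^ 2 * (g : ℤ) ^ 2).toNat : ℕ) : ℂ) = z ^ 2 * g ^ 2 := by exact_mod_cast hk
  have him : (((g : ℂ) ^ 2 * τ + e') / m).im = g ^ 2 * τ.im / m := by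
    rw [Complex.div_natCast_im, Complex.add_im, Complex.intCast_im, add_zero,
      show (g : ℂ) ^ 2 * τ = ((g ^ 2 : ℝ) : ℂ) * τ by push_cast; ring, Complex.im_ofReal_mul]
  have hxc : (j : ℂ) + 1 / 2 + d = z / (2 * c) := by
    have h := congrArg (fun r : ℝ => (r : ℂ)) hx
    push_cast at h
    exact h
  have hcc : (c : ℂ) ≠ 0 := by exact_mod_cast hc.ne'
  have hmc : (m : ℂ) ≠ 0 := by exact_mod_cast hm.ne'
  have hE : zwFExp d e j (((g : ℂ) ^ 2 * τ + e') / m) = zwFExp d e j (e' / m) *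
      Complex.exp (-2 * Real.pi * Complex.I * ((z ^ 2 * (g : ℤ) ^ 2).toNat : ℕ) * τ / (8 * c ^ 2 * m : ℕ)) := by
    rw [zwFExp, zwFExp, mul_assoc ((-1 : ℂ) ^ j), ← Complex.exp_add, hxc, hkc]
    congr 2
    push_cast
    field_simp
    ring
  have hG : 2 * Real.pi * ((j : ℝ) + 1 / 2 + d) ^ 2 * ((g : ℝ) ^ 2 * τ.im / m) =
      4 * Real.pi * ((z ^ 2 * (g : ℤ) ^ 2).toNat : ℕ) * τ.im / (8 * c ^ 2 * m : ℕ) := by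
    rw [hx, hkr]
    push_cast
    field_simp
    ring
  rw [zwFNonTerm, him, upperGamma_half_eq_of_sign (by positivity), hG, hE, zwFNonCoeff]
  push_cast
  ring

/-- The growth exponent is a multiple of 1/(8c²), so it can serve as the first index of the
expansion with no rounding loss in the bound. -/
lemma exists_int_eq_mul_kOrd {p s : ℝ} {c : ℕ} {P S : ℤ} (hp : 2 * c * p = (P : ℝ))
    (hs : 2 * c * s = (S : ℝ)) (hfp : Int.fract p = p) (hfs : Int.fract s = s) :
    ∃ k : ℤ, (k : ℝ) = 8 * c ^ 2 * (-(p - s) ^ 2 / 2 + kOrd p s) := by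
  have h1 : 8 * (c : ℝ) ^ 2 * (-(p - s) ^ 2 / 2) = -((P : ℝ) - S) ^ 2 := by
    rw [← hp, ← hs]
    ring
  have h2 : ∃ k : ℤ, (k : ℝ) = 8 * c ^ 2 * nuOrd p s := by
    rw [nuOrd]
    split_ifs
    · refine ⟨2 * c * (P + S) - c ^ 2, ?_⟩
      push_cast
      rw [← hp, ← hs]
      ring
    · refine ⟨7 * c ^ 2 - 2 * c * (P + S), ?_⟩
      push_cast
      rw [← hp, ← hs]
      ring
  have h3 : ∃ k : ℤ, (k : ℝ) = 8 * c ^ 2 * kOrd p s := by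
    rw [kOrd, hfp, hfs]
    split_ifs
    · rcases min_choice (1 / 8) (nuOrd p s) with h | h <;> rw [h]
      · exact ⟨c ^ 2, by push_cast; ring⟩
      · exact h2
    · exact h2
  obtain ⟨k, hk⟩ := h3
  refine ⟨-(P - S) ^ 2 + k, ?_⟩
  push_cast
  rw [hk, mul_add, h1]

lemma exists_hasMaassExpansion_zwF {p r s t : ℝ} {c m g : ℕ} {P S e : ℤ} (hc : 0 < c) (hm : 0 < m)
    (hg : 0 < g) (hp0 : 0 ≤ p) (hp1 : p < 1) (hs0 : 0 ≤ s) (hs1 : s < 1) (hpr : NonIntegral p r)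
    (hst : IsHalfPoint s t) (hp : 2 * c * p = (P : ℝ)) (hs : 2 * c * s = (S : ℝ)) :
    ∃ a b, HasMaassExpansion (1 / 2) (fun τ => zwF p r s t (((g : ℂ) ^ 2 * τ + e) / m))
      (8 * c ^ 2 * m) a b ∧ ∀ n : ℤ, (n : ℝ) / (8 * c ^ 2 * m : ℕ) <
        (g : ℝ) ^ 2 / m * (-(p - s) ^ 2 / 2 + kOrd p s) → a n = 0 := by
  have hcr : (0 : ℝ) < c := by exact_mod_cast hc
  have hmr : (0 : ℝ) < m := by exact_mod_cast hm
  have hgr : (0 : ℝ) < g := by exact_mod_cast hg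
  have hmc : (m : ℂ) ≠ 0 := by exact_mod_cast hm.ne'
  have hN : 0 < 8 * c ^ 2 * m := by positivity
  have hfp : Int.fract p = p := Int.fract_eq_self.mpr ⟨hp0, hp1⟩
  have hfs : Int.fract s = s := Int.fract_eq_self.mpr ⟨hs0, hs1⟩
  set L : ℂ → ℂ := fun τ => ((g : ℂ) ^ 2 * τ + e) / m with hL
  have him : ∀ τ : ℂ, (L τ).im = g ^ 2 * τ.im / m := fun τ => by
    rw [hL, Complex.div_natCast_im, Complex.add_im, Complex.intCast_im, add_zero,
      show (g : ℂ) ^ 2 * τ = ((g ^ 2 : ℝ) : ℂ) * τ by push_cast; ring, Complex.im_ofReal_mul]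
  have hLpos : ∀ τ : ℂ, 0 < τ.im → 0 < (L τ).im := fun τ hτ => by
    rw [him]
    positivity
  obtain ⟨k, hk⟩ := exists_int_eq_mul_kOrd hp hs hfp hfs
  have hB : (((g : ℤ) ^ 2 * k : ℤ) : ℝ) / (8 * c ^ 2 * m : ℕ) =
      (g : ℝ) ^ 2 / m * (-(p - s) ^ 2 / 2 + kOrd p s) := by
    push_cast
    rw [hk]
    field_simp
  obtain ⟨C, Y, hCY⟩ := exists_norm_zwFHol_le hp0 hp1 hs0 hs1 hpr hst
  have hper : Function.Periodic (zwFHol p r s t) (8 * c ^ 2 : ℕ) := fun τ =>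
    zwFHol_add_period hp hs r t τ
  obtain ⟨a, ha0, ha⟩ := exists_hasSum_of_periodic_of_bound (H := fun τ => zwFHol p r s t (L τ)) hN
    (k₀ := (g : ℤ) ^ 2 * k) (C := C) (Y := Y * m / g ^ 2)
    ((differentiableOn_zwFHol hp0 hp1 hs0 hs1 hpr hst).comp (by fun_prop) fun τ hτ => hLpos τ hτ)
    (fun τ _ => by
      -- Translating τ by 8c²m moves (g²τ+e)/m by g² periods.
      have h := hper.nat_mul (g ^ 2) (L τ)
      rw [← h]
      congr 1
      simp only [hL]
      push_cast
      field_simp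
      ring)
    (fun τ hτ => by
      have h1 : Y ≤ (L τ).im := by
        rw [him, le_div_iff₀ hmr]
        rw [div_le_iff₀ (by positivity)] at hτ
        linarith
      refine (hCY _ h1).trans (le_of_eq ?_)
      rw [him, hB]
      congr 2
      ring)
  have hz : ∀ j : ℤ, 2 * c * ((j : ℝ) + 1 / 2 + (p - s)) = ((2 * c * j + c + P - S : ℤ) : ℝ) := fun j => by
    push_cast
    rw [← hp, ← hs]
    ring
  set κ : ℤ → ℕ := fun j => ((2 * c * j + c + P - S) ^ 2 * (g : ℤ) ^ 2).toNat with hκ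
  refine ⟨a, fun n => ∑' j : κ ⁻¹' {n}, zwFNonCoeff (p - s) (r - t) e m j, ⟨hN, ⟨_, ha0⟩,
    fun τ => zwFHol p r s t (L τ), fun τ => zwF p r s t (L τ) - zwFHol p r s t (L τ), ha,
    fun τ => ?_, fun τ => by ring⟩, fun n hn => ha0 n ?_⟩
  · have hd : |p - s| < 1 := abs_sub_lt_iff.mpr ⟨by linarith, by linarith⟩
    have h1 := hasSum_zwFNonTerm hd (r := r) hst (hLpos τ τ.im_pos)
    have h2 := hasSum_fiberwise_mul (k := κ) (β := zwFNonCoeff (p - s) (r - t) e m)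
      (T := fun n : ℕ => (upperGamma (1 / 2) (4 * Real.pi * n * τ.im / (8 * c ^ 2 * m : ℕ)) : ℂ) *
        Complex.exp (-2 * Real.pi * Complex.I * n * τ / (8 * c ^ 2 * m : ℕ))) h1 (fun j hj => ?_)
      (fun j => zwFNonTerm_eq hc hm hg (hz j) τ.im_pos)
    · refine h2.congr_fun fun n => ?_
      rw [show (1 : ℝ) - 1 / 2 = 1 / 2 by norm_num, mul_assoc]
    -- Index 0 means n+d = 0, where `Real.sign 0 = 0` kills the coefficient.
    · have h0 : (2 * c * j + c + P - S) ^ 2 * (g : ℤ) ^ 2 = 0 :=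
        le_antisymm (Int.toNat_eq_zero.mp hj) (by positivity)
      have h3 : (2 * c * j + c + P - S) = 0 := by
        rcases mul_eq_zero.mp h0 with h | h
        · exact pow_eq_zero_iff (two_ne_zero) |>.mp h
        · have : (g : ℤ) ≠ 0 := by exact_mod_cast hg.ne'
          exact absurd h (pow_ne_zero 2 this)
      have h4 := hz j
      rw [h3, Int.cast_zero, mul_eq_zero] at h4
      rw [zwFNonCoeff, h4.resolve_left (by positivity)]
      simp
  · rw [← hB, div_lt_div_iff_of_pos_right (by exact_mod_cast hN)] at hn
    exact_mod_cast hn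

/-! ### Uniqueness of the invariant order -/

/-- The series converges uniformly on the circle of length N, hence in L²; pairing with the n-th
orthonormal character returns c(n). -/
lemma eq_zero_of_hasSum_exp {N : ℕ} (hN : 0 < N) {c : ℤ → ℂ} (hc : Summable fun n => ‖c n‖)
    (h : ∀ x : ℝ, HasSum (fun n : ℤ => c n * Complex.exp (2 * Real.pi * Complex.I * n * x / N)) 0)
    (n : ℤ) : c n = 0 := by
  have : Fact ((0 : ℝ) < N) := ⟨by exact_mod_cast hN⟩
  have h1 : Summable fun n : ℤ => c n • (fourier n : C(AddCircle (N : ℝ), ℂ)) := by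
    refine Summable.of_norm (hc.congr fun n => ?_)
    rw [norm_smul, fourier_norm, mul_one]
  have h2 : (∑' n : ℤ, c n • (fourier n : C(AddCircle (N : ℝ), ℂ))) = 0 := by
    ext x
    induction x using QuotientAddGroup.induction_on with
    | H x =>
      have h3 := (ContinuousMap.evalCLM ℂ (x : AddCircle (N : ℝ))).hasSum h1.hasSum
      refine h3.unique ((h x).congr_fun fun n => ?_)
      simp
  have h4 := (ContinuousMap.toLp (E := ℂ) 2 (AddCircle.haarAddCircle (T := (N : ℝ))) ℂ).hasSum
    h1.hasSum
  rw [h2, map_zero] at h4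
  have h5 := (innerSL ℂ (fourierLp (T := (N : ℝ)) 2 n)).hasSum h4
  rw [map_zero] at h5
  have h6 : ∀ k : ℤ, innerSL ℂ (fourierLp (T := (N : ℝ)) 2 n) ((ContinuousMap.toLp (E := ℂ) 2
      (AddCircle.haarAddCircle (T := (N : ℝ))) ℂ) (c k • fourier k)) = if k = n then c n else 0 := by
    intro k
    have := orthonormal_iff_ite.mp (orthonormal_fourier (T := (N : ℝ))) n k
    rw [map_smul, map_smul, innerSL_apply_apply, smul_eq_mul]
    rw [show (ContinuousMap.toLp (E := ℂ) 2 (AddCircle.haarAddCircle (T := (N : ℝ))) ℂ) (fourier k) =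
      fourierLp (T := (N : ℝ)) 2 k from rfl, this]
    by_cases hk : n = k
    · simp [hk]
    · simp [hk, Ne.symm hk]
  have h7 := h5.unique ((hasSum_ite_eq n (c n)).congr_fun fun k => h6 k)
  exact h7.symm

lemma tendsto_upperGamma_half : Tendsto (upperGamma (1 / 2)) atTop (nhds 0) := by
  have h1 : ∀ᶠ t : ℝ in atTop, upperGamma (1 / 2) t = Real.sqrt Real.pi *
      (1 - zwE (Real.sqrt (t / Real.pi))) := by
    filter_upwards [eventually_gt_atTop 0] with t ht
    have hx : 0 < Real.sqrt (t / Real.pi) := Real.sqrt_pos.mpr (div_pos ht Real.pi_pos)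
    rw [one_sub_zwE_eq_upperGamma hx, Real.sq_sqrt (div_pos ht Real.pi_pos).le,
      mul_div_cancel₀ _ Real.pi_ne_zero, ← mul_assoc,
      mul_inv_cancel₀ (Real.sqrt_pos.mpr Real.pi_pos).ne', one_mul]
  have h2 : Tendsto (fun t : ℝ => Real.sqrt Real.pi * Real.exp (-t)) atTop (nhds 0) := by
    simpa using (Real.tendsto_exp_neg_atTop_nhds_zero.const_mul (Real.sqrt Real.pi))
  refine tendsto_of_tendsto_of_tendsto_of_le_of_le' tendsto_const_nhds h2 ?_ ?_
  · filter_upwards [h1] with t ht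
    rw [ht]
    exact mul_nonneg (Real.sqrt_nonneg _) (one_sub_zwE_nonneg _)
  · filter_upwards [h1, eventually_gt_atTop 0] with t ht ht0
    rw [ht]
    refine mul_le_mul_of_nonneg_left ((one_sub_zwE_le (Real.sqrt_nonneg _)).trans (le_of_eq ?_))
      (Real.sqrt_nonneg _)
    rw [Real.sq_sqrt (div_pos ht0 Real.pi_pos).le, neg_mul, mul_div_cancel₀ _ Real.pi_ne_zero]

/-- The `n`-th Fourier coefficient of `h⁺ + h⁻` on the line `Im τ = y`. -/
def maassCoeff (k : ℝ) (N : ℕ) (a : ℤ → ℂ) (b : ℕ → ℂ) (y : ℝ) (n : ℤ) : ℂ :=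
  (a n + if n < 0 then b n.natAbs * (upperGamma (1 - k) (4 * Real.pi * n.natAbs * y / N) : ℂ) else 0) *
    Complex.exp (-2 * Real.pi * n * y / N)

lemma HasMaassExpansion.hasSum_maassCoeff {k : ℝ} {h : ℍ → ℂ} {N : ℕ} {a : ℤ → ℂ} {b : ℕ → ℂ}
    (H : HasMaassExpansion k h N a b) (τ : ℍ) : HasSum (fun n : ℤ => maassCoeff k N a b τ.im n *
      Complex.exp (2 * Real.pi * Complex.I * n * τ.re / N)) (h τ) := by
  obtain ⟨-, -, hplus, hminus, h1, h2, h3⟩ := H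
  have hinj : Function.Injective fun n : ℕ => -((n : ℤ) + 1) := fun m n hmn => by
    simpa using hmn
  set B : ℤ → ℂ := fun n => if n < 0 then b n.natAbs *
    (upperGamma (1 - k) (4 * Real.pi * n.natAbs * τ.im / N) : ℂ) *
      Complex.exp (2 * Real.pi * Complex.I * n * (τ : ℂ) / N) else 0 with hB
  have h4 : HasSum B (hminus τ) := by
    rw [← hinj.hasSum_iff]
    · refine (h2 τ).congr_fun fun n => ?_
      have hn : (-((n : ℤ) + 1)).natAbs = n + 1 := by omega
      simp only [hB, Function.comp_apply]
      rw [if_pos (by omega), hn]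
      congr 2
      push_cast
      ring
    · intro n hn
      simp only [hB]
      refine if_neg fun h0 => hn ⟨n.natAbs - 1, ?_⟩
      simp only
      omega
  have h5 := (h1 τ).add h4
  rw [← h3] at h5
  refine h5.congr_fun fun n => ?_
  have hτ : (τ : ℂ) = τ.re + τ.im * Complex.I := (Complex.re_add_im (τ : ℂ)).symm
  have he : Complex.exp (2 * Real.pi * Complex.I * n * (τ : ℂ) / N) =
      Complex.exp (-2 * Real.pi * n * τ.im / N) *
        Complex.exp (2 * Real.pi * Complex.I * n * τ.re / N) := by
    rw [← Complex.exp_add]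
    congr 1
    rw [hτ]
    linear_combination (2 * Real.pi * n * τ.im / N : ℂ) * Complex.I_sq
  simp only [hB, maassCoeff]
  split_ifs
  · rw [he]
    ring
  · rw [he]
    ring

/-- Fourier uniqueness on the line Im τ = y gives a(n) + b(|n|)Γ(1/2, 4π|n|y/N) for n < 0. Letting y
→ ∞ removes the Gamma term. -/
lemma HasMaassExpansion.coeff_unique {h : ℍ → ℂ} {N : ℕ} {a a' : ℤ → ℂ} {b b' : ℕ → ℂ}
    (H : HasMaassExpansion (1 / 2) h N a b) (H' : HasMaassExpansion (1 / 2) h N a' b') : a = a' := by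
  have hN := H.1
  have hNr : (0 : ℝ) < N := by exact_mod_cast hN
  have key : ∀ y : ℝ, 0 < y → ∀ n, maassCoeff (1 / 2) N a b y n = maassCoeff (1 / 2) N a' b' y n := by
    intro y hy n
    have hs : ∀ x : ℝ, HasSum (fun n : ℤ => (maassCoeff (1 / 2) N a b y n - maassCoeff (1 / 2) N a' b' y n) *
        Complex.exp (2 * Real.pi * Complex.I * n * x / N)) 0 := fun x => by
      have h1 := H.hasSum_maassCoeff ⟨⟨x, y⟩, hy⟩
      have h2 := H'.hasSum_maassCoeff ⟨⟨x, y⟩, hy⟩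
      have h3 := h1.sub h2
      rw [sub_self] at h3
      exact h3.congr_fun fun n => sub_mul _ _ _
    refine sub_eq_zero.mp (eq_zero_of_hasSum_exp hN (c := fun n => maassCoeff (1 / 2) N a b y n -
      maassCoeff (1 / 2) N a' b' y n) ?_ hs n)
    have h0 := (hs 0).summable.norm
    simpa using h0
  funext n
  have key' : ∀ y : ℝ, 0 < y → (a n + if n < 0 then b n.natAbs *
      (upperGamma (1 / 2) (4 * Real.pi * n.natAbs * y / N) : ℂ) else 0) = (a' n + if n < 0 then
        b' n.natAbs * (upperGamma (1 / 2) (4 * Real.pi * n.natAbs * y / N) : ℂ) else 0) := fun y hy => by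
    have h1 := mul_right_cancel₀ (Complex.exp_ne_zero _) (key y hy n)
    rwa [show (1 : ℝ) - 1 / 2 = 1 / 2 by norm_num] at h1
  by_cases hn : n < 0
  · simp only [if_pos hn] at key'
    have hn' : (0 : ℝ) < n.natAbs := by
      have : 0 < n.natAbs := by omega
      exact_mod_cast this
    have ht : Tendsto (fun y : ℝ => 4 * Real.pi * n.natAbs * y / N) atTop atTop := by
      have h1 := tendsto_id.const_mul_atTop (show 0 < 4 * Real.pi * n.natAbs / N by positivity)
      refine h1.congr fun y => ?_
      simp only [id]
      ring
    have hG : Tendsto (fun y : ℝ => (upperGamma (1 / 2) (4 * Real.pi * n.natAbs * y / N) : ℂ)) atTop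
        (nhds 0) := by
      have := (Complex.continuous_ofReal.tendsto 0).comp (tendsto_upperGamma_half.comp ht)
      simpa [Function.comp_def] using this
    have h1 := (hG.const_mul (b n.natAbs)).const_add (a n)
    have h2 := (hG.const_mul (b' n.natAbs)).const_add (a' n)
    rw [mul_zero, add_zero] at h1 h2
    refine tendsto_nhds_unique (h1.congr' ?_) h2
    filter_upwards [eventually_gt_atTop 0] with y hy using key' y hy
  · simpa [hn] using key' 1 one_pos

/-- Brings expansions over N and N' to the common denominator NN'. -/
lemma HasMaassExpansion.rescale {k : ℝ} {h : ℍ → ℂ} {N : ℕ} {a : ℤ → ℂ} {b : ℕ → ℂ}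
    (H : HasMaassExpansion k h N a b) {d : ℕ} (hd : 0 < d) :
    HasMaassExpansion k h (N * d) (fun n => if (d : ℤ) ∣ n then a (n / d) else 0)
      (fun n => if d ∣ n then b (n / d) else 0) := by
  obtain ⟨hN, ⟨n₀, hn₀⟩, hplus, hminus, h1, h2, h3⟩ := H
  have hdz : (0 : ℤ) < d := by exact_mod_cast hd
  have hdc : (d : ℂ) ≠ 0 := by exact_mod_cast hd.ne'
  have hdr : (d : ℝ) ≠ 0 := by exact_mod_cast hd.ne'
  have hNc : (N : ℂ) ≠ 0 := by exact_mod_cast hN.ne'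
  have hNr : (N : ℝ) ≠ 0 := by exact_mod_cast hN.ne'
  refine ⟨Nat.mul_pos hN hd, ⟨n₀ * d, fun n hn => ?_⟩, hplus, hminus, fun τ => ?_, fun τ => ?_, h3⟩
  · beta_reduce
    split_ifs with hdn
    · exact hn₀ _ (Int.ediv_lt_of_lt_mul hdz hn)
    · rfl
  · have hinj : Function.Injective fun n : ℤ => n * d := fun m n hmn =>
      mul_right_cancel₀ hdz.ne' hmn
    rw [← hinj.hasSum_iff]
    · refine (h1 τ).congr_fun fun n => ?_
      simp only [Function.comp_apply]
      rw [if_pos (dvd_mul_left _ _), Int.mul_ediv_cancel _ hdz.ne']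
      congr 2
      push_cast
      field_simp
    · intro n hn
      beta_reduce
      rw [if_neg fun hdn => hn ⟨n / d, Int.ediv_mul_cancel hdn⟩, zero_mul]
  -- The summand at n carries the index n+1, so index n+1 goes to (n+1)d, stored at position
  -- (n+1)d-1.
  · have hinj : Function.Injective fun n : ℕ => (n + 1) * d - 1 := fun m n hmn => by
      have h1 : 0 < (m + 1) * d := by positivity
      have h2 : 0 < (n + 1) * d := by positivity
      have h3 : (m + 1) * d = (n + 1) * d := by
        simp only at hmn
        omega
      simpa using Nat.eq_of_mul_eq_mul_right hd h3
    have hs : ∀ n : ℕ, (n + 1) * d - 1 + 1 = (n + 1) * d := fun n => by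
      have h1 : 0 < (n + 1) * d := by positivity
      omega
    rw [← hinj.hasSum_iff]
    · refine (h2 τ).congr_fun fun n => ?_
      simp only [Function.comp_apply]
      rw [hs, if_pos (dvd_mul_left _ _), Nat.mul_div_cancel _ hd]
      congr 2
      · congr 2
        push_cast
        field_simp
      · push_cast
        field_simp
    · intro n hn
      have hdn : ¬ d ∣ n + 1 := fun ⟨j, hj⟩ => hn ⟨j - 1, by
        have hj0 : j ≠ 0 := by
          rintro rfl
          simp at hj
        simp only
        rw [Nat.sub_add_cancel (Nat.pos_of_ne_zero hj0), mul_comm, ← hj]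
        rfl⟩
      beta_reduce
      rw [if_neg hdn, zero_mul, zero_mul]

/-- `r` is the order of the first nonvanishing term of `∑ a(n) q^{n/N}`. -/
def IsCoeffOrder (N : ℕ) (a : ℤ → ℂ) (r : WithTop ℝ) : Prop :=
  ((∀ n, a n = 0) ∧ r = ⊤) ∨
    ∃ m₀ : ℤ, a m₀ ≠ 0 ∧ (∀ n < m₀, a n = 0) ∧ r = (((m₀ : ℝ) / N : ℝ) : WithTop ℝ)

lemma IsCoeffOrder.rescale {N : ℕ} {a : ℤ → ℂ} {r : WithTop ℝ} (h : IsCoeffOrder N a r) {d : ℕ}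
    (hd : 0 < d) : IsCoeffOrder (N * d) (fun n => if (d : ℤ) ∣ n then a (n / d) else 0) r := by
  have hdz : (0 : ℤ) < d := by exact_mod_cast hd
  have hdr : (d : ℝ) ≠ 0 := by exact_mod_cast hd.ne'
  rcases h with ⟨h0, hr⟩ | ⟨m₀, hm, hlt, rfl⟩
  · exact Or.inl ⟨fun n => by simp [h0], hr⟩
  · refine Or.inr ⟨m₀ * d, ?_, fun n hn => ?_, ?_⟩
    · beta_reduce
      rwa [if_pos (dvd_mul_left _ _), Int.mul_ediv_cancel _ hdz.ne']
    · beta_reduce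
      split_ifs with hdn
      · exact hlt _ (Int.ediv_lt_of_lt_mul hdz hn)
      · rfl
    · push_cast
      rw [mul_div_mul_right _ _ hdr]

lemma IsCoeffOrder.unique {N : ℕ} {a : ℤ → ℂ} {r r' : WithTop ℝ} (h : IsCoeffOrder N a r)
    (h' : IsCoeffOrder N a r') : r = r' := by
  rcases h with ⟨h0, rfl⟩ | ⟨m₀, hm, hlt, rfl⟩ <;> rcases h' with ⟨h0', rfl⟩ | ⟨m₀', hm', hlt', rfl⟩
  · rfl
  · exact absurd (h0 _) hm'
  · exact absurd (h0' _) hm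
  · have h1 : ¬ m₀ < m₀' := fun h => hm (hlt' _ h)
    have h2 : ¬ m₀' < m₀ := fun h => hm' (hlt _ h)
    rw [show m₀ = m₀' by omega]

lemma IsHolOrderAtInfty.unique {h : ℍ → ℂ} {r r' : WithTop ℝ} (H : IsHolOrderAtInfty (1 / 2) h r)
    (H' : IsHolOrderAtInfty (1 / 2) h r') : r = r' := by
  obtain ⟨N, a, b, hE, hr⟩ := H
  obtain ⟨N', a', b', hE', hr'⟩ := H'
  have h1 := hE.rescale hE'.1
  have h2 := hE'.rescale hE.1
  have hr1 := IsCoeffOrder.rescale hr hE'.1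
  have hr2 := IsCoeffOrder.rescale hr' hE.1
  rw [mul_comm N' N] at h2 hr2
  rw [h1.coeff_unique h2] at hr1
  exact hr1.unique hr2

/-- An integer translation multiplies each coefficient by a root of unity. -/
lemma IsHolOrderAtInfty.vadd {k : ℝ} {h : ℍ → ℂ} {r : WithTop ℝ} (H : IsHolOrderAtInfty k h r)
    (j : ℤ) : IsHolOrderAtInfty k (fun τ => h ((j : ℝ) +ᵥ τ)) r := by
  obtain ⟨N, a, b, ⟨hN, ⟨n₀, hn₀⟩, hplus, hminus, h1, h2, h3⟩, hr⟩ := H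
  refine ⟨N, fun n => a n * Complex.exp (2 * Real.pi * Complex.I * n * j / N),
    fun n => b n * Complex.exp (-2 * Real.pi * Complex.I * n * j / N),
    ⟨hN, ⟨n₀, fun n hn => mul_eq_zero_of_left (hn₀ n hn) _⟩, fun τ => hplus ((j : ℝ) +ᵥ τ),
      fun τ => hminus ((j : ℝ) +ᵥ τ), fun τ => ?_, fun τ => ?_, fun τ => h3 _⟩, ?_⟩
  · refine (h1 ((j : ℝ) +ᵥ τ)).congr_fun fun n => ?_
    rw [mul_assoc, ← Complex.exp_add, UpperHalfPlane.coe_vadd]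
    congr 2
    push_cast
    ring
  · refine (h2 ((j : ℝ) +ᵥ τ)).congr_fun fun n => ?_
    rw [UpperHalfPlane.coe_vadd, UpperHalfPlane.vadd_im, show -2 * Real.pi * Complex.I *
      ((n + 1 : ℕ) : ℂ) * (((j : ℝ) : ℂ) + τ) / N = -2 * Real.pi * Complex.I * ((n + 1 : ℕ) : ℂ) * j / N +
      -2 * Real.pi * Complex.I * ((n + 1 : ℕ) : ℂ) * τ / N by push_cast; ring, Complex.exp_add]
    ring
  · simpa [Complex.exp_ne_zero] using hr

lemma halfSlash_mul_T_zpow (κ : ℤ) (f : ℍ → ℂ) (A : SL(2, ℤ)) (j : ℤ) (τ : ℍ) :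
    halfSlash κ f (A * ModularGroup.T ^ j) τ = halfSlash κ f A ((j : ℝ) +ᵥ τ) := by
  rw [halfSlash, halfSlash, mul_smul, UpperHalfPlane.modular_T_zpow_smul, UpperHalfPlane.coe_vadd]
  congr 2
  simp only [Matrix.SpecialLinearGroup.coe_mul, ModularGroup.coe_T_zpow, Matrix.mul_apply,
    Fin.sum_univ_two]
  simp
  ring

lemma eq_mul_T_zpow {A B : SL(2, ℤ)} (h0 : A 0 0 = B 0 0) (h1 : A 1 0 = B 1 0) :
    ∃ j : ℤ, B = A * ModularGroup.T ^ j := by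
  have hA := A.det_coe
  have hB := B.det_coe
  rw [Matrix.det_fin_two] at hA hB
  -- The upper right entry of A⁻¹B, which is unipotent since the first columns agree.
  refine ⟨A 1 1 * B 0 1 - A 0 1 * B 1 1, ?_⟩
  ext i l
  simp only [Matrix.SpecialLinearGroup.coe_mul, ModularGroup.coe_T_zpow, Matrix.mul_apply,
    Fin.sum_univ_two]
  fin_cases i <;> fin_cases l <;> simp
  · exact h0.symm
  · rw [← h0, ← h1] at hB
    linear_combination (-B 0 1) * hA + (A 0 1) * hB
  · exact h1.symm
  · rw [← h0, ← h1] at hB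
    linear_combination (-B 1 1) * hA + (A 1 1) * hB

lemma IsHolOrderAtCusp.unique {f : ℍ → ℂ} {α γ : ℤ} {r r' : WithTop ℝ}
    (H : IsHolOrderAtCusp 1 f α γ r) (H' : IsHolOrderAtCusp 1 f α γ r') : r = r' := by
  obtain ⟨A, hα, hγ, hA⟩ := H
  obtain ⟨B, hα', hγ', hB⟩ := H'
  obtain ⟨j, rfl⟩ := eq_mul_T_zpow (hα.trans hα'.symm) (hγ.trans hγ'.symm)
  have h1 := hA.vadd j
  simp only [← halfSlash_mul_T_zpow] at h1
  rw [Int.cast_one] at h1 hB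
  exact h1.unique hB

/-! ### The expansion of `M(a,c;mτ)` at a cusp -/

lemma bigM_eq_zwF (a c : ℤ) (τ : ℂ) : bigM a c τ = zwF ((a : ℝ) / c) 0 (1 / 2) 0 τ := by
  rw [bigM, zwF]
  congr 1
  · congr 1
    push_cast
    ring
  · congr 1 <;> push_cast <;> ring

lemma nonIntegral_div {a : ℤ} {c : ℕ} (hc : 0 < c) (hac : ¬ (c : ℤ) ∣ a) :
    NonIntegral ((a : ℝ) / c) 0 := by
  rintro ⟨k, l, hk, -⟩
  have hcr : (c : ℝ) ≠ 0 := by exact_mod_cast hc.ne'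
  rw [div_eq_iff hcr] at hk
  exact hac ⟨k, by rw [mul_comm]; exact_mod_cast hk⟩

lemma isHalfPoint_half_zero : IsHalfPoint (1 / 2) 0 := by
  refine ⟨?_, 1, 0, by norm_num, by norm_num⟩
  rintro ⟨k, l, hk, -⟩
  have h1 : (1 : ℝ) = 2 * k := by linarith
  have h2 : (1 : ℤ) = 2 * k := by exact_mod_cast h1
  omega

/-- ℍ is connected, so a continuous square root of a nonzero constant cannot change sign. This
compares the principal branch of (γτ+δ)^{-1/2} with the unspecified factor in `ZwFTransforms`. -/
lemma exists_eq_const_of_sq_eq {ψ : ℍ → ℂ} (hψ : Continuous ψ) {C : ℂ} (hC : C ≠ 0)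
    (h : ∀ τ, ψ τ ^ 2 = C) : ∃ ζ : ℂ, ∀ τ, ψ τ = ζ := by
  have hne : ψ UpperHalfPlane.I ≠ 0 := fun h0 => hC (by rw [← h UpperHalfPlane.I, h0]; simp)
  have h1 := (isPreconnected_univ (α := ℍ)).eq_or_eq_neg_of_sq_eq (f := ψ)
    (g := fun _ => ψ UpperHalfPlane.I) hψ.continuousOn continuousOn_const
    (fun τ _ => by simp [h]) (fun _ => hne)
  rcases h1 with h1 | h1
  · exact ⟨_, fun τ => h1 (Set.mem_univ τ)⟩
  · exact ⟨_, fun τ => h1 (Set.mem_univ τ)⟩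

lemma continuous_autFactor_cpow (A : SL(2, ℤ)) (w : ℂ) : Continuous fun τ => autFactor A τ ^ w := by
  by_cases h : A 1 0 = 0
  · simp only [autFactor, h, Int.cast_zero, zero_mul, zero_add]
    exact continuous_const
  · refine (continuous_autFactor A).cpow continuous_const fun τ => ?_
    refine Complex.mem_slitPlane_iff.mpr (Or.inr ?_)
    have h1 : (autFactor A τ).im = A 1 0 * τ.im := by simp [autFactor]
    rw [h1]
    exact mul_ne_zero (by exact_mod_cast h) τ.im_pos.ne'

/-- Rests on diag(m,1)·A = B·(g e; 0 m₁) with m = g·m₁. The first column of diag(m,1)·A is g times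
the coprime pair (x, γ/g), which is completed to B. -/
lemma exists_halfSlash_bigMScaled_eq {a : ℤ} {c m g : ℕ} {x : ℤ} (hc : 0 < c) (hm : 0 < m)
    (hac : ¬ (c : ℤ) ∣ a) (A : SL(2, ℤ)) (hg : (g : ℤ) = Int.gcd m (A 1 0))
    (hx : x = m * A 0 0 / g) : ∃ (ζ : ℂ) (b e : ℤ), NonIntegral ((a : ℝ) / c * x) ((a : ℝ) / c * b) ∧
      IsHalfPoint (1 / 2 * x) (1 / 2 * b) ∧ ∀ τ : ℍ,
      halfSlash 1 (bigMScaled a c m) A τ = ζ * zwF ((a : ℝ) / c * x) ((a : ℝ) / c * b)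
        (1 / 2 * x) (1 / 2 * b) (((g : ℂ) ^ 2 * τ + e) / m) := by
  have hdet := A.det_coe
  rw [Matrix.det_fin_two] at hdet
  have hgm : (g : ℤ) ∣ m := hg ▸ Int.gcd_dvd_left _ _
  have hgγ : (g : ℤ) ∣ A 1 0 := hg ▸ Int.gcd_dvd_right _ _
  obtain ⟨m₁, hm₁⟩ := hgm
  obtain ⟨γ₁, hγ₁⟩ := hgγ
  have hmz : (0 : ℤ) < m := by exact_mod_cast hm
  have hgz : (0 : ℤ) < g := by
    rcases (Int.natCast_nonneg g).eq_or_lt with h | h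
    · rw [← h, zero_mul] at hm₁
      omega
    · exact h
  have hm₁pos : 0 < m₁ := by
    rw [hm₁] at hmz
    exact pos_of_mul_pos_right hmz hgz.le
  have hx' : x = m₁ * A 0 0 := by
    rw [hx, hm₁, mul_assoc, Int.mul_ediv_cancel_left _ hgz.ne']
  have hcop₁ : IsCoprime m₁ γ₁ := by
    rw [Int.isCoprime_iff_gcd_eq_one]
    have h1 : Int.gcd ((g : ℤ) * m₁) (g * γ₁) = g * Int.gcd m₁ γ₁ := by
      rw [Int.gcd_mul_left, Int.natAbs_natCast]
    rw [← hm₁, ← hγ₁] at h1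
    have h2 : g = g * Int.gcd m₁ γ₁ := by
      rw [← h1]
      exact_mod_cast hg
    have hg0 : 0 < g := by exact_mod_cast hgz
    exact (Nat.eq_of_mul_eq_mul_left hg0 (by rw [mul_one]; exact h2)).symm
  have hcop₂ : IsCoprime (A 0 0) γ₁ :=
    ⟨A 1 1, -A 0 1 * g, by rw [mul_assoc, ← hγ₁]; linarith⟩
  obtain ⟨B, hB0, hB1⟩ := (hcop₁.mul_left hcop₂).exists_SL2_col 0
  rw [← hx'] at hB0
  have hdetB := B.det_coe
  rw [Matrix.det_fin_two, hB0, hB1] at hdetB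
  -- The upper right entry of B⁻¹·diag(m,1)·A; `h1` and `h2` give the second column of the
  -- factorisation.
  set e : ℤ := B 1 1 * m * A 0 1 - B 0 1 * A 1 1 with he
  have h1 : x * e + B 0 1 * m₁ = m * A 0 1 := by
    rw [he, hx', hm₁]
    rw [hx'] at hdetB
    rw [hγ₁] at hdet
    linear_combination (g * m₁ * A 0 1) * hdetB - (B 0 1 * m₁) * hdet
  have h2 : γ₁ * e + B 1 1 * m₁ = A 1 1 := by
    rw [he, hm₁]
    rw [hx'] at hdetB
    rw [hγ₁] at hdet
    linear_combination (A 1 1) * hdetB - (B 1 1 * m₁) * hdet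
  have hm₁c : (m₁ : ℂ) ≠ 0 := by exact_mod_cast hm₁pos.ne'
  have hgc : (g : ℂ) ≠ 0 := by exact_mod_cast hgz.ne'
  have hmc : (m : ℂ) = g * m₁ := by exact_mod_cast hm₁
  have him : ∀ τ : ℍ, 0 < (((g : ℂ) * τ + e) / m₁).im := fun τ => by
    have : (((g : ℂ) * τ + e) / m₁) = (((g : ℝ) / m₁ : ℝ) : ℂ) * τ + ((e / m₁ : ℝ) : ℂ) := by
      push_cast
      ring
    rw [this, Complex.add_im, Complex.im_ofReal_mul, Complex.ofReal_im, add_zero]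
    have hgr : (0 : ℝ) < g := by exact_mod_cast hgz
    have hmr : (0 : ℝ) < m₁ := by exact_mod_cast hm₁pos
    have := τ.im_pos
    rw [UpperHalfPlane.coe_im]
    positivity
  set L : ℍ → ℍ := fun τ => ⟨((g : ℂ) * τ + e) / m₁, him τ⟩ with hL
  have hLc : ∀ τ, ((L τ : ℍ) : ℂ) = ((g : ℂ) * τ + e) / m₁ := fun τ => rfl
  have hLcont : Continuous L := by
    refine UpperHalfPlane.isEmbedding_coe.continuous_iff.mpr ?_
    have : Continuous fun τ : ℍ => ((g : ℂ) * τ + e) / m₁ := by fun_prop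
    exact this
  have h1c : (x : ℂ) * e + (B 0 1 : ℤ) * m₁ = g * m₁ * (A 0 1 : ℤ) := by
    rw [← hmc]
    exact_mod_cast h1
  have h2c : (γ₁ : ℂ) * e + (B 1 1 : ℤ) * m₁ = (A 1 1 : ℤ) := by exact_mod_cast h2
  have haut : ∀ τ, autFactor B (L τ) = autFactor A τ / m₁ := fun τ => by
    rw [autFactor, autFactor, hLc, hB1, hγ₁]
    field_simp
    push_cast
    linear_combination h2c
  have hsmul : ∀ τ, ((B • L τ : ℍ) : ℂ) = m * ((A • τ : ℍ) : ℂ) := fun τ => by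
    have h0 := autFactor_ne_zero A τ
    rw [coe_smul_eq, coe_smul_eq, haut, hLc, hB0, hmc]
    field_simp
    rw [hx'] at h1c ⊢
    push_cast at h1c ⊢
    linear_combination h1c
  obtain ⟨φ, hφ, ⟨χ, hχ, hφ2⟩, htr⟩ := zwFTransforms B
  -- The automorphy factor of B at (gτ+e)/m₁ is that of A at τ divided by m₁, so the square is
  -- constant.
  have hψ2 : ∀ τ, (autFactor A τ ^ (-(((1 : ℤ) : ℂ) / 2)) * φ (L τ)) ^ 2 = χ / m₁ := fun τ => by
    have h0 := autFactor_ne_zero A τ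
    rw [mul_pow, hφ2, haut, ← Complex.cpow_nat_mul, show ((2 : ℕ) : ℂ) * (-(((1 : ℤ) : ℂ) / 2)) = -1 by
      push_cast; ring, Complex.cpow_neg_one]
    field_simp
  obtain ⟨ζ, hζ⟩ := exists_eq_const_of_sq_eq
    ((continuous_autFactor_cpow A _).mul (hφ.comp hLcont)) (div_ne_zero hχ hm₁c) hψ2
  have hrow : ∀ p : ℝ, rowFst B p 0 = p * x ∧ rowSnd B p 0 = p * (B 0 1 : ℤ) := fun p => by
    rw [rowFst, rowSnd, hB0]
    simp
  have hni := (nonIntegral_div hc hac).row B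
  have hhp := isHalfPoint_half_zero.row B
  rw [(hrow _).1, (hrow _).2] at hni hhp
  refine ⟨ζ, B 0 1, g * e, hni, hhp, fun τ => ?_⟩
  have hM := htr ((a : ℝ) / c) 0 (1 / 2) 0 (nonIntegral_div hc hac) isHalfPoint_half_zero (L τ)
  rw [(hrow _).1, (hrow _).2, (hrow _).1, (hrow _).2, hsmul] at hM
  have hτ : ((L τ : ℍ) : ℂ) = ((g : ℂ) ^ 2 * τ + ((g * e : ℤ) : ℂ)) / m := by
    rw [hLc, hmc]
    push_cast
    field_simp
  rw [halfSlash, bigMScaled, bigM_eq_zwF, ← hζ τ, Int.cast_natCast, Int.cast_natCast, hM, hτ,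
    ← mul_assoc]
  rfl

/-! ### Existence of the order and its lower bound. -/

lemma HasMaassExpansion.const_mul {k : ℝ} {h : ℍ → ℂ} {N : ℕ} {a : ℤ → ℂ} {b : ℕ → ℂ}
    (H : HasMaassExpansion k h N a b) (ζ : ℂ) :
    HasMaassExpansion k (fun τ => ζ * h τ) N (fun n => ζ * a n) (fun n => ζ * b n) := by
  obtain ⟨hN, ⟨n₀, hn₀⟩, hplus, hminus, h1, h2, h3⟩ := H
  refine ⟨hN, ⟨n₀, fun n hn => mul_eq_zero_of_right _ (hn₀ n hn)⟩, fun τ => ζ * hplus τ,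
    fun τ => ζ * hminus τ, fun τ => ?_, fun τ => ?_, fun τ => ?_⟩
  · exact ((h1 τ).mul_left ζ).congr_fun fun n => mul_assoc _ _ _
  · refine ((h2 τ).mul_left ζ).congr_fun fun n => ?_
    ring
  · beta_reduce
    rw [h3, mul_add]

lemma HasMaassExpansion.exists_isHolOrderAtInfty {k : ℝ} {h : ℍ → ℂ} {N : ℕ} {a : ℤ → ℂ} {b : ℕ → ℂ}
    (H : HasMaassExpansion k h N a b) {B : ℝ} (hB : ∀ n : ℤ, (n : ℝ) / N < B → a n = 0) :
    ∃ r, IsHolOrderAtInfty k h r ∧ (B : WithTop ℝ) ≤ r := by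
  by_cases h0 : ∀ n, a n = 0
  · exact ⟨⊤, ⟨N, a, b, H, Or.inl ⟨h0, rfl⟩⟩, le_top⟩
  · push Not at h0
    obtain ⟨n₀, hn₀⟩ := H.2.1
    obtain ⟨m₀, hm₀, hmin⟩ := Int.exists_least_of_bdd (P := fun n => a n ≠ 0)
      ⟨n₀, fun z hz => not_lt.mp fun h => hz (hn₀ z h)⟩ h0
    refine ⟨_, ⟨N, a, b, H, Or.inr ⟨m₀, hm₀, fun n hn => by_contra fun h =>
      absurd (hmin n h) (not_le.mpr hn), rfl⟩⟩, WithTop.coe_le_coe.mpr ?_⟩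
    exact not_lt.mp fun h => hm₀ (hB m₀ h)

/-- The floor terms of ν̃ are exactly what compensates the change of (u-w)²/2 under reduction modulo
1. -/
lemma neg_sq_half_add_nuTilde (u w : ℝ) : -(u - w) ^ 2 / 2 + nuTilde u w =
    -(Int.fract u - Int.fract w) ^ 2 / 2 + kOrd (Int.fract u) (Int.fract w) := by
  rw [nuTilde, kOrd, kOrd, Int.fract_fract, Int.fract_fract]
  have hu := Int.floor_add_fract u
  have hw := Int.floor_add_fract w
  have h : u - w = (⌊u⌋ - ⌊w⌋ : ℝ) + (Int.fract u - Int.fract w) := by linarith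
  rw [h]
  ring

lemma exists_isHolOrderAtCusp_bigMScaled {a : ℤ} {c m g : ℕ} {x α γ : ℤ} (hc : 0 < c) (hm : 0 < m)
    (hac : ¬ (c : ℤ) ∣ a) (hαγ : Int.gcd α γ = 1) (hg : (g : ℤ) = Int.gcd m γ)
    (hx : x = m * α / g) : ∃ r, IsHolOrderAtCusp 1 (bigMScaled a c m) α γ r ∧
      (((g : ℝ) ^ 2 / m * (-((a : ℝ) / c * x - 1 / 2 * x) ^ 2 / 2 +
        nuTilde ((a : ℝ) / c * x) (1 / 2 * x)) : ℝ) : WithTop ℝ) ≤ r := by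
  obtain ⟨A, hα, hγ⟩ := (Int.isCoprime_iff_gcd_eq_one.mpr hαγ).exists_SL2_col 0
  subst hα hγ
  obtain ⟨ζ, b, e, hni, hhp, hζ⟩ := exists_halfSlash_bigMScaled_eq hc hm hac A hg hx
  have hg0 : 0 < g := by
    have : 0 < Int.gcd m (A 1 0) := Int.gcd_pos_of_ne_zero_left _ (by exact_mod_cast hm.ne')
    omega
  have hcr : (c : ℝ) ≠ 0 := by exact_mod_cast hc.ne'
  set p : ℝ := (a : ℝ) / c * x with hp
  set s : ℝ := 1 / 2 * x with hs
  have hpf : p + ((-⌊p⌋ : ℤ) : ℝ) = Int.fract p := by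
    rw [Int.cast_neg, ← sub_eq_add_neg, Int.self_sub_floor]
  have hsf : s + ((-⌊s⌋ : ℤ) : ℝ) = Int.fract s := by
    rw [Int.cast_neg, ← sub_eq_add_neg, Int.self_sub_floor]
  have hni' := hni.add_int_left (-⌊p⌋)
  have hhp' := hhp.add_int_left (-⌊s⌋)
  rw [hpf] at hni'
  rw [hsf] at hhp'
  have hP : 2 * c * Int.fract p = ((2 * a * x - 2 * c * ⌊p⌋ : ℤ) : ℝ) := by
    rw [← Int.self_sub_floor, hp]
    push_cast
    field_simp
  have hS : 2 * c * Int.fract s = ((c * x - 2 * c * ⌊s⌋ : ℤ) : ℝ) := by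
    rw [← Int.self_sub_floor, hs]
    push_cast
    ring
  obtain ⟨u, v, H, hB⟩ := exists_hasMaassExpansion_zwF (e := e) hc hm hg0 (Int.fract_nonneg p)
    (Int.fract_lt_one p) (Int.fract_nonneg s) (Int.fract_lt_one s) hni' hhp' hP hS
  -- Passing back from fractional parts to p and s costs only the constant η, so the expansion of
  -- the reduced function can be used.
  obtain ⟨η, -, hη⟩ := exists_zwF_add_int hni' hhp' ⌊p⌋ ⌊s⌋
  rw [Int.fract_add_floor, Int.fract_add_floor] at hη
  obtain ⟨r, hr, hBr⟩ := (H.const_mul (ζ * η)).exists_isHolOrderAtInfty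
    fun n hn => mul_eq_zero_of_right _ (hB n hn)
  refine ⟨r, ⟨A, rfl, rfl, ?_⟩, ?_⟩
  · convert hr using 1
    · norm_num
    · funext τ
      rw [hζ, hη, mul_assoc]
      have him : (((g : ℂ) ^ 2 * τ + e) / m).im = g ^ 2 * τ.im / m := by
        rw [Complex.div_natCast_im, Complex.add_im, Complex.intCast_im, add_zero,
          show (g : ℂ) ^ 2 * τ = ((g ^ 2 : ℝ) : ℂ) * τ by push_cast; ring, Complex.im_ofReal_mul,
          UpperHalfPlane.coe_im]
      rw [him]
      have := τ.im_pos
      positivity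
  · rwa [neg_sq_half_add_nuTilde]

end

/-- If `τ ↦ M(a,c;mτ)` is a harmonic weak Maass form (of weight `1/2`), then at each cusp `α/γ` its
holomorphic part has a well-defined invariant order, and this order is at least
`-(g²x²/2m)(a/c-1/2)² + (g²/m) ν̃(ax/c, x/2)`, where `g = gcd(m,γ)` and `x = mα/g`
(an exact quotient). -/
theorem proposition6p4 (a c m : ℤ) (hc : 0 < c) (hm : 0 < m) (hac : ¬ c ∣ a)
    (hM : ∃ Γ : Subgroup SL(2, ℤ), IsHarmonicWeakMaassForm 1 Γ (bigMScaled a c m))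
    (α γ : ℤ) (hα : 0 ≤ α) (hγ : 0 ≤ γ) (hαγ : Int.gcd α γ = 1)
    (g x : ℤ) (hg : g = (Int.gcd m γ : ℤ)) (hx : x = m * α / g) :
    (∃! r : WithTop ℝ, IsHolOrderAtCusp 1 (bigMScaled a c m) α γ r) ∧
    ∀ r : WithTop ℝ, IsHolOrderAtCusp 1 (bigMScaled a c m) α γ r →
      ((-((g : ℝ) ^ 2 * (x : ℝ) ^ 2 / (2 * m)) * ((a : ℝ) / c - 1 / 2) ^ 2
          + (g : ℝ) ^ 2 / m * nuTilde ((a : ℝ) * x / c) ((x : ℝ) / 2) : ℝ) : WithTop ℝ) ≤ r := by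
  lift c to ℕ using hc.le
  lift m to ℕ using hm.le
  have hc' : 0 < c := by exact_mod_cast hc
  have hm' : 0 < m := by exact_mod_cast hm
  subst hg
  obtain ⟨r, hr, hB⟩ := exists_isHolOrderAtCusp_bigMScaled hc' hm' hac hαγ rfl hx
  refine ⟨⟨r, hr, fun r' hr' => hr'.unique hr⟩, fun r' hr' => ?_⟩
  rw [hr'.unique hr]
  refine le_trans (le_of_eq (congrArg _ ?_)) hB
  rw [show (a : ℝ) / ((c : ℤ) : ℝ) = (a : ℝ) / c by rw [Int.cast_natCast],
    show (a : ℝ) * x / ((c : ℤ) : ℝ) = (a : ℝ) / c * x by rw [Int.cast_natCast]; ring,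
    show (x : ℝ) / 2 = 1 / 2 * x by ring]
  push_cast
  ring
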